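/- **Notation.** Let $\Omega\subset\mathbb R^2$ be open and bounded, and let $u:\Omega\to\mathbb C$ and $A:\Omega\to\mathbb R^2$ be $C^1$. Write $\nabla_Au=(\nabla-iA)u$ and $\operatorname{curl}A=\partial_1A_2-\partial_2A_1$. Let $\Omega_\varepsilon=\{x\in\Omega:\operatorname{dist}(x,\partial\Omega)>\varepsilon\}$ and $$F_\varepsilon(|u|,\Omega)=\frac12\int_\Omega|\nabla|u||^2+\frac{(1-|u|^2)^2}{2\varepsilon^2}.$$ All balls are closed and have positive radius. For a finite collection $\mathcal B$ of disjoint balls, $r(\mathcal B)$ is the sum of the radii. For a ball $B$ with center $a_B$, contained in $\Omega$ and such that $u\neq0$ on $\partial B$, let $d_B=\deg(u/|u|,\partial B)$. A family $\{\mathcal B(t)\}_{t\ge0}$ of finite collections of disjoint balls is *grown from* $\mathcal B(0)$ if * the union of the balls of $\mathcal B(t)$ is nondecreasing in $t$; * $r(\mathcal B(t))=e^tr(\mathcal B(0))$ for all $t\ge0$; * there is a finite set $T$ of merging times such that $\mathcal B(t')$ consists of the concentric dilates $e^{t'-t}B$, $B\in\mathcal B(t)$, whenever $[t,t']\cap T=\varnothing$.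 **Theorem (improved lower bounds).** There are universal constants $C_0,C>0$ such that for every $\alpha\in(0,1)$ there is $\varepsilon_0>0$, depending only on $\alpha$, with the following property. Let $0<\varepsilon\le\varepsilon_0$, let $\Omega,u,A$ be as above with $F_\varepsilon(|u|,\Omega)\le\varepsilon^{\alpha-1}$, put $\delta=\varepsilon^{\alpha/4}$, and let $C\varepsilon^{\alpha/2}<r<1$. Then there is a finite collection $\mathcal B$ of disjoint closed balls such that: 1. $r(\mathcal B)=r$. 2. $\{x\in\Omega_\varepsilon:\big||u(x)|-1\big|\ge\delta\}\subset V:=\Omega_\varepsilon\cap\bigcup_{B\in\mathcal B}B$. 3. There are numbers $\sigma,s\ge0$ and two grown families $\mathcal C(t)$ and $\mathcal B(t)$ with the following properties: * $\mathcal B(s)=\mathcal B$ and $r(\mathcal B(0))=C_0\varepsilon^{\alpha/2}$; * $\mathcal B(0)$ covers the set on the left-hand side of item 2; * $r(\mathcal C(\sigma))=\frac38r(\mathcal B(0))$, and the balls of $\mathcal C(\sigma)$ are contained in the union of those of $\mathcal B(0)$; * $\mathcal C(0)$ covers all points with $|u|\le\frac12$ or $|u|\ge\frac32$ in those balls of $\mathcal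 B(0)$ that are contained in $\Omega_\varepsilon$. For every $\eta\in(0,1)$, the vector field $G$ built from these families as described below satisfies the following. If $$D=\sum_{B\in\mathcal B,\,B\subset\Omega_\varepsilon}|d_B|$$ is nonzero, then $$\frac12\int_V|\nabla_Au|^2+\frac{(1-|u|^2)^2}{2\varepsilon^2}+r^2(\operatorname{curl}A)^2\ \ge\ \pi D\Big(\log\frac{r}{\varepsilon D}-C\Big)+\frac1{18}\int_V|\nabla_{A+G}u|^2+\frac{(1-|u|^2)^2}{2\varepsilon^2}.$$ The integrals over $V$ extend over all the terms that follow, and both are finite. **Definition of $G$.** Put $\mathcal D(t)=\mathcal C(t)$ for $0\le t<\sigma$ and $\mathcal D(t)=\mathcal B(t-\sigma)$ for $\sigma\le t\le\sigma+s$. Let $K\in\mathcal B$ with $K\subset\Omega_\varepsilon$. Let $N(t)$ be the sum of $|d_B|$ over the balls $B\in\mathcal D(t)$ with $B\subset K$ and $d_B<0$, and let $P(t)$ be the sum of $d_B$ over those with $d_B>0$. Let $t_K$ be the infimum of the times $t\in[0,\sigma+s]$ such that, at all times of $[t,\sigma+s]$, $N\le\eta P$ if $d_K\ge0$, and $P\le\eta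 N$ if $d_K<0$. For $B\in\mathcal D(t)$ with $B\subset K$ put $\beta_B=1$ if $t<t_K$, and $$\beta_B=|d_K|^{1/2}\Big(\sum_{B'\in\mathcal D(t),\,B'\subset K}d_{B'}^2\Big)^{-1/2}$$ if $t\ge t_K$ (read as $0$ if the sum vanishes). Then $$G(x)=\frac{d_B\,\beta_B}{|x-a_B|}\,\tau_{\partial B}(x)$$ if $x\in\partial B$ for some $B\in\mathcal D(t)$ that is contained in a ball $K\in\mathcal B$ with $K\subset\Omega_\varepsilon$, where $t\in[0,\sigma+s]$ is not a merging time and $\tau_{\partial B}$ is the counterclockwise unit tangent to $\partial B$. At all other points $G(x)=0$. -/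

import Mathlib

namespace VortexBalls

/-- The Euclidean plane `ℝ²`. -/
abbrev Plane : Type := EuclideanSpace ℝ (Fin 2)

/-! ### Functions, vector fields and energies on the plane -/

/-- The partial derivative `∂_j f`. -/
noncomputable def partialD {F : Type*} [NormedAddCommGroup F] [NormedSpace ℝ F]
    (j : Fin 2) (f : Plane → F) (x : Plane) : F :=
  fderiv ℝ f x (EuclideanSpace.single j 1)

/-- `curl A = ∂₁A₂ - ∂₂A₁`. -/
noncomputable def curl (A : Plane → Plane) (x : Plane) : ℝ :=
  partialD 0 (fun y => A y 1) x - partialD 1 (fun y => A y 0) x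

/-- `|∇_A u|²`, where `∇_A u = (∇ - i A) u`. -/
noncomputable def covGradSq (u : Plane → ℂ) (A : Plane → Plane) (x : Plane) : ℝ :=
  ∑ j : Fin 2, ‖partialD j u x - Complex.I * (A x j : ℂ) * u x‖ ^ 2

/-- `(1 - |u|²)² / (2ε²)`. -/
noncomputable def potential (ε : ℝ) (u : Plane → ℂ) (x : Plane) : ℝ :=
  1 / (2 * ε ^ 2) * (1 - ‖u x‖ ^ 2) ^ 2

/-- `F_ε(|u|, Ω) = ½ ∫_Ω |∇|u||² + (1 - |u|²)² / (2ε²)`, with values in `[0, ∞]`. The function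
`|u|` is locally Lipschitz for `u` of class `C¹`, so that its gradient exists almost everywhere. -/
noncomputable def modulusEnergy (ε : ℝ) (u : Plane → ℂ) (Ω : Set Plane) : ENNReal :=
  ∫⁻ x in Ω, ENNReal.ofReal
    (1 / 2 * ((∑ j : Fin 2, partialD j (fun y => ‖u y‖) x ^ 2) + potential ε u x))

/-- `Ω_ε`: the points of `Ω` at distance larger than `ε` from `∂Ω`. -/
def interiorAt (Ω : Set Plane) (ε : ℝ) : Set Plane :=
  {x | x ∈ Ω ∧ ε < Metric.infDist x (frontier Ω)}

/-! ### Balls, collections of balls, ball growth -/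

/-- A closed ball of the plane, given by its center and its radius. -/
structure Disc where
  center : Plane
  radius : ℝ

/-- The underlying set of a closed ball. -/
def Disc.toSet (B : Disc) : Set Plane := Metric.closedBall B.center B.radius

/-- The concentric ball `k B`. -/
def Disc.dilate (k : ℝ) (B : Disc) : Disc := ⟨B.center, k * B.radius⟩

/-- The union of the balls of a collection. -/
def discUnion (𝓑 : Finset Disc) : Set Plane := ⋃ B ∈ 𝓑, B.toSet

/-- The sum of the radii of the balls of a collection. -/
def totalRadius (𝓑 : Finset Disc) : ℝ := ∑ B ∈ 𝓑, B.radius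

/-- A finite collection of pairwise disjoint closed balls (of positive radius). -/
structure IsDiscCollection (𝓑 : Finset Disc) : Prop where
  radius_pos : ∀ B ∈ 𝓑, 0 < B.radius
  disjoint : ∀ B ∈ 𝓑, ∀ B' ∈ 𝓑, B ≠ B' → Disjoint B.toSet B'.toSet

open Classical in
/-- The balls of a collection that are contained in the set `U`. -/
noncomputable def discsIn (𝓑 : Finset Disc) (U : Set Plane) : Finset Disc :=
  𝓑.filter (fun B => B.toSet ⊆ U)

/-- `𝓑(t)`, `t ≥ 0`, is grown from `𝓑(0)`: away from a finite set `T` of merging times all balls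
are dilated concentrically by the common factor `e^(s-t)`; at the merging times balls are merged
into larger ones, and the total radius is `e^t r(𝓑(0))` throughout. -/
structure IsDiscGrowth (𝓑 : ℝ → Finset Disc) (T : Finset ℝ) : Prop where
  collection : ∀ t, 0 ≤ t → IsDiscCollection (𝓑 t)
  union_subset : ∀ t s, 0 ≤ t → t ≤ s → discUnion (𝓑 t) ⊆ discUnion (𝓑 s)
  dilate : ∀ t s, 0 ≤ t → t ≤ s → (∀ q ∈ T, q ∉ Set.Icc t s) →
    ∀ B, B ∈ 𝓑 s ↔ ∃ B' ∈ 𝓑 t, B = B'.dilate (Real.exp (s - t))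
  totalRadius_eq : ∀ t, 0 ≤ t → totalRadius (𝓑 t) = Real.exp t * totalRadius (𝓑 0)

/-! ### Degrees -/

/-- The point of `∂B` at the angle `θ`. -/
noncomputable def Disc.bdryPoint (B : Disc) (θ : ℝ) : Plane :=
  B.center + B.radius • !₂[Real.cos θ, Real.sin θ]

/-- The degree `d_B = deg(u/|u|, ∂B) = (1/2π) ∫ ∂_θ φ dθ`, where `u = |u| e^{iφ}` on `∂B`, for `u` of
class `C¹` without zeros on `∂B`; note that `∂_θ φ = Im (∂_θ u / u)`. -/
noncomputable def deg (u : Plane → ℂ) (B : Disc) : ℝ :=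
  (2 * Real.pi)⁻¹ * ∫ θ in (0 : ℝ)..(2 * Real.pi),
    (deriv (fun t => u (B.bdryPoint t)) θ / u (B.bdryPoint θ)).im

/-- `D = ∑ |d_B|` over the balls `B` of the collection that are contained in `U`. -/
noncomputable def totalDegree (u : Plane → ℂ) (U : Set Plane) (𝓑 : Finset Disc) : ℝ :=
  ∑ B ∈ discsIn 𝓑 U, |deg u B|

/-! ### The two phases of the growth, and the vector field -/

/-- Two one-parameter families of collections of balls: a first one `𝓒(t)`, used for
`0 ≤ t ≤ σ`, and a second one `𝓑(t)`, used for `0 ≤ t ≤ s`, with their sets of merging times. -/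
structure TwoPhase where
  famC : ℝ → Finset Disc
  timesC : Finset ℝ
  σ : ℝ
  famB : ℝ → Finset Disc
  timesB : Finset ℝ
  s : ℝ

namespace TwoPhase

/-- The final collection `𝓑(s)`. -/
def final (P : TwoPhase) : Finset Disc := P.famB P.s

open Classical in
/-- The concatenated family `𝓓(t)`, `0 ≤ t ≤ σ + s`. -/
noncomputable def famD (P : TwoPhase) (t : ℝ) : Finset Disc :=
  if t < P.σ then P.famC t else P.famB (t - P.σ)

/-- The times at which a merging occurs in the concatenated family. -/
def IsMergingTime (P : TwoPhase) (t : ℝ) : Prop :=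
  (t < P.σ ∧ t ∈ P.timesC) ∨ (P.σ ≤ t ∧ t - P.σ ∈ P.timesB)

/-- The requirements on the two phases: both are obtained by ball growth; `𝓑(0)` has total radius
`r₀` and covers the part of `U` where `||u| - 1| ≥ δ`; the first phase stays inside `𝓑(0)`, reaches
the total radius `3 r₀ / 8`, and starts from balls that cover the points with `|u| ≤ 1/2` or
`|u| ≥ 3/2` in the balls of `𝓑(0)` contained in `U`. -/
structure IsAdmissible (P : TwoPhase) (u : Plane → ℂ) (U : Set Plane) (δ r₀ : ℝ) : Prop where
  growthC : IsDiscGrowth P.famC P.timesC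
  growthB : IsDiscGrowth P.famB P.timesB
  σ_nonneg : 0 ≤ P.σ
  s_nonneg : 0 ≤ P.s
  totalRadius_famB : totalRadius (P.famB 0) = r₀
  cover_famB : {x | x ∈ U ∧ δ ≤ |‖u x‖ - 1|} ⊆ discUnion (P.famB 0)
  totalRadius_famC : totalRadius (P.famC P.σ) = 3 / 8 * r₀
  famC_subset : discUnion (P.famC P.σ) ⊆ discUnion (P.famB 0)
  cover_famC : {x | x ∈ discUnion (discsIn (P.famB 0) U) ∧ (‖u x‖ ≤ 1 / 2 ∨ 3 / 2 ≤ ‖u x‖)} ⊆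
    discUnion (P.famC 0)

/-- The negative vorticity mass `N(t)` in the final ball `K`: the sum of `|d_B|` over the balls `B`
of `𝓓(t)` inside `K` with `d_B < 0`. -/
noncomputable def negMass (P : TwoPhase) (u : Plane → ℂ) (K : Disc) (t : ℝ) : ℝ :=
  ∑ B ∈ discsIn (P.famD t) K.toSet, max (-deg u B) 0

/-- The positive vorticity mass `P(t)` in the final ball `K`: the sum of `d_B` over the balls `B`
of `𝓓(t)` inside `K` with `d_B > 0`. -/
noncomputable def posMass (P : TwoPhase) (u : Plane → ℂ) (K : Disc) (t : ℝ) : ℝ :=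
  ∑ B ∈ discsIn (P.famD t) K.toSet, max (deg u B) 0

/-- At the time `t` the vorticity of the sign opposite to that of `d_K` is at most `η` times the
vorticity of the sign of `d_K`. -/
def IsDominated (P : TwoPhase) (u : Plane → ℂ) (η : ℝ) (K : Disc) (t : ℝ) : Prop :=
  (0 ≤ deg u K → P.negMass u K t ≤ η * P.posMass u K t) ∧
  (deg u K < 0 → P.posMass u K t ≤ η * P.negMass u K t)

/-- The transition time `t_K`: the first time from which on the domination above holds. -/
noncomputable def transitionTime (P : TwoPhase) (u : Plane → ℂ) (η : ℝ) (K : Disc) : ℝ :=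
  sInf {t | t ∈ Set.Icc 0 (P.σ + P.s) ∧
    ∀ t' ∈ Set.Icc t (P.σ + P.s), P.IsDominated u η K t'}

open Classical in
/-- The weight `β_B` of the balls `B` of `𝓓(t)` inside the final ball `K`: it is `1` before the
transition time, and `|d_K|^(1/2) (∑ d_{B'}²)^(-1/2)` from then on, with `B'` running over the
balls of `𝓓(t)` inside `K` (and `0` if the sum vanishes). -/
noncomputable def beta (P : TwoPhase) (u : Plane → ℂ) (η : ℝ) (K : Disc) (t : ℝ) : ℝ :=
  if t < P.transitionTime u η K then 1
  else Real.sqrt |deg u K| / Real.sqrt (∑ B ∈ discsIn (P.famD t) K.toSet, deg u B ^ 2)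

/-- The point `x` lies on the boundary of the ball `B` of `𝓓(t)`, where `t` is not a merging time,
and `B` is inside the final ball `K`, which is contained in `U`. -/
structure OnCircle (P : TwoPhase) (U : Set Plane) (x : Plane) (t : ℝ) (B K : Disc) : Prop where
  time_mem : t ∈ Set.Icc 0 (P.σ + P.s)
  not_merging : ¬ P.IsMergingTime t
  mem_famD : B ∈ P.famD t
  mem_final : K ∈ discsIn P.final U
  subset : B.toSet ⊆ K.toSet
  mem_sphere : x ∈ Metric.sphere B.center B.radius

end TwoPhase

/-- The counterclockwise unit tangent vector at `x` to the circle with center `a` through `x`. -/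
noncomputable def tangent (a x : Plane) : Plane :=
  (dist x a)⁻¹ • !₂[-(x 1 - a 1), x 0 - a 0]

/-- The vector field of the construction: `G = (d_B β_B / |x - a_B|) τ` on the circles `∂B` swept
by the balls that end up in final balls contained in `U`, and `G = 0` elsewhere. -/
structure IsVortexField (P : TwoPhase) (u : Plane → ℂ) (U : Set Plane) (η : ℝ)
    (G : Plane → Plane) : Prop where
  on_circle : ∀ x t B K, P.OnCircle U x t B K →
    G x = (deg u B * P.beta u η K t / dist x B.center) • tangent B.center x
  off_circle : ∀ x, (∀ t B K, ¬ P.OnCircle U x t B K) → G x = 0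

end VortexBalls

open VortexBalls

namespace VortexBalls

/-! ### Winding numbers on circles -/

/-! On a circle of radius `ρ` let `h` be the gauge invariant tangential derivative of the phase and
`g` the tangential component of `G`. Where `|u| = 1`, the angular part of the difference of the two
energy densities is `h²/2 - (h - g)²/18 = g h - g²/2 + (4/9) (h - g)²`, so it is at least `g h -
g²/2`. This is linear in `h`, whose integral over the circle is `2π d` minus the circulation of `A`.
With `g = d β / ρ` the circle contributes `π (2β - β²) d² / ρ`, up to the circulation, which Green's
theorem and Young's inequality charge to `r² (curl A)²`.

Growth multiplies radii by `e^t`, so integration over the radii gives `π ∑ (2β - β²) d_B²` per unit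
of time inside a final ball `K`. This rate is at least `π |d_K|` for both weights: the degrees are
integers with sum `d_K`, hence `|d_K| ≤ S = ∑ d_B²`, and the rate divided by `π` is `S` for the
first weight and `2 √(|d_K| S) - |d_K|` for the second. The time at which the weight changes is
therefore irrelevant to the bound.

The error caused by `|u| ≠ 1` is of the order `g² |1 - |u|²|`. In the second phase it is at most a
multiple of `δ g²`, which is harmless since the phase has duration at most `2/δ`. In the first phase
the potential reduces it to a multiple of `g⁴ ε²`, which is summable because radii stay above `10 ε
e^t |d_B|`.

The total time `τ` of the growth satisfies `e^τ = 3r / (8 r_c)`, where `r_c` is the total radius of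
the initial discs, whereas `log (r/(ε D))` is wanted. The gap is `D log (r_c/(ε D))`, and it is
absorbed by the energy of the initial discs if that is at least a constant times `r_c/ε`. Initial
discs with this property that are not small compared with their degrees are obtained by enlarging
discs that are too small: the covariant energy gained is at least proportional to the radius gained.

The main steps are `exists_le_integral_modDensity` (energy near points with modulus far from one),
`IsCore.exists_final` (initial discs), `annulus_excess` and `IsRegularOn.le_integral_excess`
(growth), `log_ratio_bound` and `IsAdapted.energy_bound` (balance). -/

/-- The unit vector in the direction `θ`. -/
noncomputable def dir (θ : ℝ) : Plane := !₂[Real.cos θ, Real.sin θ]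

@[simp] lemma dir_zero (θ : ℝ) : dir θ 0 = Real.cos θ := rfl

@[simp] lemma dir_one (θ : ℝ) : dir θ 1 = Real.sin θ := rfl

lemma norm_sq_plane (x : Plane) : ‖x‖ ^ 2 = x 0 ^ 2 + x 1 ^ 2 := by
  rw [EuclideanSpace.norm_sq_eq]; simp [Fin.sum_univ_two]

lemma norm_dir (θ : ℝ) : ‖dir θ‖ = 1 := by
  have := norm_sq_plane (dir θ)
  simp only [dir_zero, dir_one, Real.cos_sq_add_sin_sq] at this
  exact (pow_eq_one_iff_of_nonneg (norm_nonneg _) two_ne_zero).1 this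

lemma plane_ext {x y : Plane} (h0 : x 0 = y 0) (h1 : x 1 = y 1) : x = y := by
  ext i; fin_cases i <;> assumption

lemma contDiff_dir : ContDiff ℝ ⊤ dir := by
  rw [contDiff_euclidean]
  intro i
  fin_cases i
  · exact Real.contDiff_cos
  · exact Real.contDiff_sin

lemma hasDerivAt_dir (θ : ℝ) : HasDerivAt dir !₂[-Real.sin θ, Real.cos θ] θ := by
  have h : dir = fun θ => Real.cos θ • (!₂[1, 0] : Plane) + Real.sin θ • (!₂[0, 1] : Plane) := by
    funext θ; apply plane_ext <;> simp
  rw [h]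
  refine (((Real.hasDerivAt_cos θ).smul_const _).add
    ((Real.hasDerivAt_sin θ).smul_const _)).congr_deriv ?_
  apply plane_ext <;> simp

lemma continuous_dir : Continuous dir := contDiff_dir.continuous

lemma bdryPoint_eq (B : Disc) (θ : ℝ) : B.bdryPoint θ = B.center + B.radius • dir θ := rfl

lemma continuous_bdryPoint (B : Disc) : Continuous B.bdryPoint := by
  have := continuous_dir
  simp only [funext (bdryPoint_eq B)]
  fun_prop

lemma bdryPoint_mem_sphere {B : Disc} (hB : 0 < B.radius) (θ : ℝ) :
    B.bdryPoint θ ∈ Metric.sphere B.center B.radius := by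
  simp [bdryPoint_eq, norm_smul, norm_dir, hB.le]

/-- The complex number `x - a`. -/
noncomputable def toC (a x : Plane) : ℂ := ⟨x 0 - a 0, x 1 - a 1⟩

lemma continuous_toC (a : Plane) : Continuous (toC a) := by
  have : toC a = fun x => ((x 0 - a 0 : ℝ) : ℂ) + ((x 1 - a 1 : ℝ) : ℂ) * Complex.I := by
    funext x; apply Complex.ext <;> simp [toC]
  rw [this]; fun_prop

lemma norm_toC (a x : Plane) : ‖toC a x‖ = dist x a := by
  rw [dist_eq_norm, ← sq_eq_sq₀ (norm_nonneg _) (norm_nonneg _), norm_sq_plane,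
    Complex.sq_norm, Complex.normSq_apply]
  simp [toC]; ring

lemma toC_ne_zero {a x : Plane} (h : x ≠ a) : toC a x ≠ 0 := by
  rw [← norm_ne_zero_iff, norm_toC]; exact dist_ne_zero.2 h

/-- `f` has winding number `n` on the boundary of `B`. -/
def HasWinding (f : Plane → ℂ) (B : Disc) (n : ℝ) : Prop :=
  ∃ l : ℝ → ℂ, Continuous l ∧ (∀ θ, Complex.exp (l θ) = f (B.bdryPoint θ)) ∧
    ∀ θ, l (θ + 2 * Real.pi) = l θ + 2 * Real.pi * n * Complex.I

/-- The exponential is a covering map onto the nonzero complex numbers, so a continuous logarithm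
along the line is determined by its value at one point. This makes winding numbers well defined. -/
lemma lift_unique {l₁ l₂ : ℝ → ℂ} (h₁ : Continuous l₁) (h₂ : Continuous l₂)
    (h : ∀ θ, Complex.exp (l₁ θ) = Complex.exp (l₂ θ)) (θ : ℝ) :
    l₁ θ - l₂ θ = l₁ 0 - l₂ 0 := by
  have := Complex.isCoveringMap_exp.eq_of_comp_eq (A := ℝ) (g₁ := l₁)
    (g₂ := fun θ => l₂ θ + (l₁ 0 - l₂ 0)) h₁ (by fun_prop)
    (by
      funext θ
      apply Subtype.ext
      simp only [Function.comp]
      rw [Complex.exp_add, Complex.exp_sub, ← h 0, div_self (Complex.exp_ne_zero _), mul_one, h])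
    0 (by simp)
  rw [congrFun this θ]; ring

lemma bdryPoint_periodic (B : Disc) (θ : ℝ) :
    B.bdryPoint (θ + 2 * Real.pi) = B.bdryPoint θ := by
  simp [Disc.bdryPoint]

/-- The logarithm and its shift by `2π` are lifts of the same function, so their difference is
constant and a single value determines it. -/
lemma HasWinding.of_eq_at {f : Plane → ℂ} {B : Disc} {n : ℝ} {l : ℝ → ℂ} (hl : Continuous l)
    (he : ∀ θ, Complex.exp (l θ) = f (B.bdryPoint θ))
    (h : l (2 * Real.pi) = l 0 + 2 * Real.pi * n * Complex.I) : HasWinding f B n := by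
  refine ⟨l, hl, he, fun θ => ?_⟩
  have := lift_unique (l₁ := fun θ => l (θ + 2 * Real.pi)) (l₂ := l) (by fun_prop) hl
    (fun θ => by rw [he, he, bdryPoint_periodic]) θ
  simp only [zero_add, h] at this
  linear_combination this

lemma HasWinding.congr {f g : Plane → ℂ} {B : Disc} {n : ℝ} (h : HasWinding f B n)
    (hfg : ∀ θ, g (B.bdryPoint θ) = f (B.bdryPoint θ)) : HasWinding g B n := by
  obtain ⟨l, h1, h2, h3⟩ := h
  exact ⟨l, h1, fun θ => by rw [h2, hfg], h3⟩

lemma HasWinding.unique {f : Plane → ℂ} {B : Disc} {n m : ℝ} (h : HasWinding f B n)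
    (h' : HasWinding f B m) : n = m := by
  obtain ⟨l, h1, h2, h3⟩ := h
  obtain ⟨l', h1', h2', h3'⟩ := h'
  have := lift_unique h1 h1' (fun θ => by rw [h2, h2']) (0 + 2 * Real.pi)
  rw [h3, h3'] at this
  have h4 : (2 * Real.pi * Complex.I : ℂ) * n = 2 * Real.pi * Complex.I * m := by
    linear_combination this
  have := mul_left_cancel₀ (Complex.two_pi_I_ne_zero) h4
  exact_mod_cast this

lemma HasWinding.exists_int {f : Plane → ℂ} {B : Disc} {n : ℝ} (h : HasWinding f B n) :
    ∃ k : ℤ, n = k := by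
  obtain ⟨l, h1, h2, h3⟩ := h
  have : Complex.exp (2 * Real.pi * n * Complex.I) = 1 := by
    have h4 := h2 (0 + 2 * Real.pi)
    rw [bdryPoint_periodic, ← h2, h3, Complex.exp_add] at h4
    exact mul_left_cancel₀ (Complex.exp_ne_zero (l 0)) (by rw [h4, mul_one])
  obtain ⟨k, hk⟩ := Complex.exp_eq_one_iff.1 this
  refine ⟨k, ?_⟩
  have : (2 * Real.pi * Complex.I : ℂ) * n = 2 * Real.pi * Complex.I * k := by
    linear_combination hk
  have := mul_left_cancel₀ (Complex.two_pi_I_ne_zero) this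
  exact_mod_cast this

lemma HasWinding.mul {f g : Plane → ℂ} {B : Disc} {n m : ℝ} (hf : HasWinding f B n)
    (hg : HasWinding g B m) : HasWinding (fun x => f x * g x) B (n + m) := by
  obtain ⟨l, h1, h2, h3⟩ := hf
  obtain ⟨l', h1', h2', h3'⟩ := hg
  refine ⟨fun θ => l θ + l' θ, h1.add h1', fun θ => by rw [Complex.exp_add, h2, h2'],
    fun θ => ?_⟩
  simp only [h3, h3']; push_cast; ring

lemma HasWinding.zpow {f : Plane → ℂ} {B : Disc} {n : ℝ} (hf : HasWinding f B n) (k : ℤ) :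
    HasWinding (fun x => f x ^ k) B (k * n) := by
  obtain ⟨l, h1, h2, h3⟩ := hf
  refine ⟨fun θ => k * l θ, by fun_prop, fun θ => by rw [Complex.exp_int_mul, h2], fun θ => ?_⟩
  simp only [h3]; push_cast; ring

lemma exists_log {F : Plane → ℂ} (hF : Continuous F) (h0 : ∀ x, F x ≠ 0) :
    ∃ l : Plane → ℂ, Continuous l ∧ ∀ x, Complex.exp (l x) = F x := by
  obtain ⟨G, ⟨-, hG⟩, -⟩ := Complex.isCoveringMap_exp.existsUnique_continuousMap_lifts (A := Plane)
    ⟨fun x => ⟨F x, h0 x⟩, by fun_prop⟩ 0 (Complex.log (F 0))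
    (by apply Subtype.ext; simp [Complex.exp_log (h0 0)])
  exact ⟨G, G.continuous, fun x => congrArg Subtype.val (congrFun hG x)⟩

/-- The radial retraction onto a closed disc. -/
noncomputable def retract (B : Disc) (x : Plane) : Plane :=
  B.center + (B.radius / max B.radius (dist x B.center)) • (x - B.center)

lemma continuous_retract {B : Disc} (hB : 0 < B.radius) : Continuous (retract B) := by
  have : ∀ x : Plane, max B.radius (dist x B.center) ≠ 0 := fun x =>
    (lt_max_of_lt_left hB).ne'
  unfold retract
  fun_prop (disch := assumption)

lemma retract_mem {B : Disc} (hB : 0 < B.radius) (x : Plane) : retract B x ∈ B.toSet := by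
  have h : 0 < max B.radius (dist x B.center) := lt_max_of_lt_left hB
  simp only [Disc.toSet, retract, Metric.mem_closedBall, dist_self_add_left, norm_smul,
    Real.norm_eq_abs, abs_div, abs_of_pos h, abs_of_pos hB, ← dist_eq_norm]
  rw [div_mul_eq_mul_div, div_le_iff₀ h]
  exact mul_le_mul_of_nonneg_left (le_max_right _ _) hB.le

lemma retract_of_mem {B : Disc} (hB : 0 < B.radius) {x : Plane} (hx : x ∈ B.toSet) :
    retract B x = x := by
  simp only [Disc.toSet, Metric.mem_closedBall] at hx
  simp [retract, max_eq_left hx, hB.ne']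

/-- Composition with the retraction extends `f` without zeros to the plane, where a global logarithm
exists; on the circle it is periodic. -/
lemma hasWinding_zero {f : Plane → ℂ} {B : Disc} (hB : 0 < B.radius)
    (hf : ContinuousOn f B.toSet) (h0 : ∀ x ∈ B.toSet, f x ≠ 0) : HasWinding f B 0 := by
  obtain ⟨l, hl, hl'⟩ := exists_log (F := fun x => f (retract B x))
    (hf.comp_continuous (continuous_retract hB) (retract_mem hB)) (fun x => h0 _ (retract_mem hB x))
  refine ⟨fun θ => l (B.bdryPoint θ), hl.comp (continuous_bdryPoint B), fun θ => ?_, fun θ => ?_⟩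
  · rw [hl', retract_of_mem hB (Metric.sphere_subset_closedBall (bdryPoint_mem_sphere hB θ))]
  · simp [bdryPoint_periodic]

lemma hasWinding_toC_one {B : Disc} {a : Plane} (ha : a ∈ Metric.ball B.center B.radius) :
    HasWinding (toC a) B 1 := by
  have hB : 0 < B.radius := Metric.pos_of_mem_ball ha
  -- On the circle, `x - a` equals `radius · e^{iθ} (1 + w θ)`. Since `a` lies inside, `|w| < 1`,
  -- and the principal logarithm of `1 + w` is continuous.
  set w : ℝ → ℂ := fun θ => toC a B.center / B.radius * Complex.exp (-(θ * Complex.I)) with hw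
  have hw1 : ∀ θ, ‖w θ‖ < 1 := fun θ => by
    simp only [hw]
    rw [norm_mul, norm_div, norm_toC, show (-((θ : ℂ) * Complex.I)) = ((-θ : ℝ) : ℂ) * Complex.I by
      push_cast; ring, Complex.norm_exp_ofReal_mul_I, mul_one, Complex.norm_real,
      Real.norm_eq_abs, abs_of_pos hB, div_lt_one hB, dist_comm]
    exact ha
  have hc : Continuous w := by fun_prop
  refine HasWinding.of_eq_at (l := fun θ => Complex.log B.radius + θ * Complex.I +
    Complex.log (1 + w θ)) ?_ ?_ ?_
  · refine Continuous.add (by fun_prop) ?_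
    exact (continuous_const.add hc).clog fun θ => Complex.mem_slitPlane_of_norm_lt_one (hw1 θ)
  · intro θ
    have hr : (B.radius : ℂ) ≠ 0 := by exact_mod_cast hB.ne'
    rw [Complex.exp_add, Complex.exp_add, Complex.exp_log hr,
      Complex.exp_log (Complex.slitPlane_ne_zero (Complex.mem_slitPlane_of_norm_lt_one (hw1 θ)))]
    have h1 : Complex.exp (θ * Complex.I) * Complex.exp (-(θ * Complex.I)) = 1 := by
      rw [← Complex.exp_add]; simp
    have h2 : toC a (B.bdryPoint θ) = toC a B.center + B.radius * Complex.exp (θ * Complex.I) := by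
      rw [Complex.exp_mul_I]
      apply Complex.ext <;>
        simp [toC, bdryPoint_eq, Complex.cos_ofReal_re, Complex.sin_ofReal_re,
          Complex.cos_ofReal_im, Complex.sin_ofReal_im] <;> ring
    rw [h2]
    simp only [hw]
    field_simp
    linear_combination (toC a B.center) * h1
  · have : w (2 * Real.pi) = w 0 := by
      simp only [hw]
      congr 1
      rw [Complex.exp_neg]; push_cast; rw [Complex.exp_two_pi_mul_I]; simp
    simp only [this]; push_cast; ring

/-- With winding number zero the logarithm is periodic and descends to a function of the angle. A
radial cut-off, equal to one on the circle and to zero on the disc of half the radius, removes its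
singularity at the centre; the exponential of the product never vanishes. -/
lemma exists_extension {f : Plane → ℂ} {B : Disc} (hB : 0 < B.radius) (h : HasWinding f B 0) :
    ∃ g : Plane → ℂ, Continuous g ∧ (∀ x, g x ≠ 0) ∧
      ∀ x ∈ Metric.sphere B.center B.radius, g x = f x := by
  obtain ⟨l, h1, h2, h3⟩ := h
  have hp : Function.Periodic l (2 * Real.pi) := fun θ => by simpa using h3 θ
  set m : Real.Angle → ℂ := hp.lift with hm
  have hmc : Continuous m := by
    refine continuous_coinduced_dom.2 ?_
    exact h1
  set p : Plane → ℂ := fun x => m ((Complex.arg (toC B.center x) : ℝ) : Real.Angle) with hpdef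
  have hpc : ∀ x, x ≠ B.center → ContinuousAt p x := fun x hx => by
    have := (Complex.continuousAt_arg_coe_angle (toC_ne_zero hx)).comp
      (f := toC B.center) (continuous_toC _).continuousAt
    exact hmc.continuousAt.comp this
  set q : Plane → ℂ := fun x => ((max 0 (2 * dist x B.center / B.radius - 1) : ℝ) : ℂ) * p x with hq
  refine ⟨fun x => Complex.exp (q x), ?_, fun x => Complex.exp_ne_zero _, ?_⟩
  · refine Complex.continuous_exp.comp (continuous_iff_continuousAt.2 fun x => ?_)
    by_cases hx : x = B.center
    · subst hx
      have : q =ᶠ[nhds B.center] fun _ => 0 := by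
        filter_upwards [Metric.ball_mem_nhds B.center (half_pos hB)] with y hy
        have : 2 * dist y B.center / B.radius - 1 ≤ 0 := by
          rw [sub_nonpos, div_le_one hB]; rw [Metric.mem_ball] at hy; linarith
        simp [hq, max_eq_left this]
      exact this.continuousAt
    · refine ContinuousAt.mul ?_ (hpc x hx)
      have : Continuous fun x : Plane =>
          ((max 0 (2 * dist x B.center / B.radius - 1) : ℝ) : ℂ) := by fun_prop
      exact this.continuousAt
  · intro x hx
    have hd : dist x B.center = B.radius := hx
    have h4 : max 0 (2 * dist x B.center / B.radius - 1) = (1 : ℝ) := by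
      rw [hd, mul_div_assoc, div_self hB.ne']; norm_num
    simp only [hq, h4, Complex.ofReal_one, one_mul, hpdef, hm]
    have : hp.lift ((Complex.arg (toC B.center x) : ℝ) : Real.Angle)
      = l (Complex.arg (toC B.center x)) := hp.lift_coe _
    rw [this, h2]
    congr 1
    have hn : ‖toC B.center x‖ = B.radius := by rw [norm_toC, hd]
    have hne : toC B.center x ≠ 0 := by rw [← norm_ne_zero_iff, hn]; exact hB.ne'
    have hcos := Complex.cos_arg hne
    have hsin := Complex.sin_arg (toC B.center x)
    rw [hn] at hcos hsin
    apply plane_ext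
    · simp only [bdryPoint_eq, PiLp.add_apply, PiLp.smul_apply, dir_zero, hcos, smul_eq_mul]
      field_simp
      simp [toC]
    · simp only [bdryPoint_eq, PiLp.add_apply, PiLp.smul_apply, dir_one, hsin, smul_eq_mul]
      field_simp
      simp [toC]

/-- Additivity of winding numbers over disjoint discs inside a disc. -/
lemma HasWinding.eq_sum {K : Disc} (hK : 0 < K.radius) (s : Finset Disc) (n : Disc → ℝ) :
    ∀ (f : Plane → ℂ) (N : ℝ), IsDiscCollection s → (∀ B ∈ s, B.toSet ⊆ K.toSet) →
    ContinuousOn f (K.toSet \ ⋃ B ∈ s, Metric.ball B.center B.radius) →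
    (∀ x ∈ K.toSet \ ⋃ B ∈ s, Metric.ball B.center B.radius, f x ≠ 0) →
    (∀ B ∈ s, HasWinding f B (n B)) → HasWinding f K N → N = ∑ B ∈ s, n B := by
  classical
  induction s using Finset.induction_on with
  | empty =>
    intro f N _ _ hf h0 _ hN
    simp only [Finset.notMem_empty, Set.iUnion_of_empty, Set.iUnion_empty, Set.sdiff_empty] at hf h0
    simpa using hN.unique (hasWinding_zero hK hf h0)
  | insert B s hBs ih =>
    intro f N hs hsub hf h0 hw hN
    have hB : 0 < B.radius := hs.radius_pos B (Finset.mem_insert_self _ _)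
    have hBK : B.toSet ⊆ K.toSet := hsub B (Finset.mem_insert_self _ _)
    have hballK : Metric.ball B.center B.radius ⊆ Metric.ball K.center K.radius := by
      rw [← interior_closedBall K.center hK.ne', ← interior_closedBall B.center hB.ne']
      exact interior_mono hBK
    have hdisj : ∀ B' ∈ s, Disjoint B.toSet B'.toSet := fun B' hB' =>
      hs.disjoint B (Finset.mem_insert_self _ _) B' (Finset.mem_insert_of_mem hB')
        (fun h => hBs (h ▸ hB'))
    obtain ⟨k, hk⟩ := (hw B (Finset.mem_insert_self _ _)).exists_int
    set X := K.toSet \ ⋃ B' ∈ s, Metric.ball B'.center B'.radius with hX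
    set Y := K.toSet \ ⋃ B' ∈ insert B s, Metric.ball B'.center B'.radius with hY
    have hYX : Y = X \ Metric.ball B.center B.radius := by
      ext x; simp only [hY, hX, Set.mem_sdiff, Set.mem_iUnion, Finset.mem_insert]; aesop
    have hclX : IsClosed X := by
      refine IsClosed.sdiff Metric.isClosed_closedBall ?_
      exact isOpen_biUnion fun B' _ => Metric.isOpen_ball
    have hclY : IsClosed Y := hYX ▸ hclX.sdiff Metric.isOpen_ball
    have hBX : B.toSet ⊆ X := fun x hx => by
      refine ⟨hBK hx, ?_⟩
      simp only [Set.mem_iUnion, not_exists]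
      intro B' hB' hx'
      exact Set.disjoint_left.1 (hdisj B' hB') hx (Metric.ball_subset_closedBall hx')
    have hYne : ∀ x ∈ Y, x ≠ B.center := fun x hx h => by
      rw [hYX] at hx
      exact hx.2 (h ▸ Metric.mem_ball_self hB)
    -- Division by the `k`-th power of `x - B.center` cancels the winding around `B`, does not
    -- affect the other discs and lowers the winding around `K` by `k`. The quotient extends across
    -- `B` without zeros, so one disc fewer remains.
    set g : Plane → ℂ := fun x => f x * toC B.center x ^ (-k) with hg
    have hgc : ContinuousOn g Y := by
      refine hf.mul ?_
      exact (continuous_toC _).continuousOn.zpow₀ _ fun x hx => Or.inl (toC_ne_zero (hYne x hx))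
    have hg0 : ∀ x ∈ Y, g x ≠ 0 := fun x hx =>
      mul_ne_zero (h0 x hx) (zpow_ne_zero _ (toC_ne_zero (hYne x hx)))
    have hgB : HasWinding g B 0 := by
      have := (hw B (Finset.mem_insert_self _ _)).mul
        ((hasWinding_toC_one (Metric.mem_ball_self hB)).zpow (-k))
      have e : n B + ((-k : ℤ) : ℝ) * 1 = 0 := by rw [hk]; push_cast; ring
      rwa [e] at this
    have hgs : ∀ B' ∈ s, HasWinding g B' (n B') := fun B' hB' => by
      have hz : HasWinding (toC B.center) B' 0 := by
        refine hasWinding_zero (hs.radius_pos B' (Finset.mem_insert_of_mem hB'))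
          (continuous_toC _).continuousOn fun x hx => toC_ne_zero fun h => ?_
        exact Set.disjoint_left.1 (hdisj B' hB') (Metric.mem_closedBall_self hB.le) (h ▸ hx)
      have := (hw B' (Finset.mem_insert_of_mem hB')).mul (hz.zpow (-k))
      rwa [mul_zero, add_zero] at this
    have hgK : HasWinding g K (N - k) := by
      have := hN.mul ((hasWinding_toC_one (hballK (Metric.mem_ball_self hB))).zpow (-k))
      have e : N + ((-k : ℤ) : ℝ) * 1 = N - k := by push_cast; ring
      rwa [e] at this
    obtain ⟨e, hec, he0, heq⟩ := exists_extension hB hgB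
    set F : Plane → ℂ := fun x => if x ∈ Metric.ball B.center B.radius then e x else g x with hF
    have hFY : ∀ x, x ∉ Metric.ball B.center B.radius → F x = g x := fun x hx => if_neg hx
    have hFB : ∀ x ∈ B.toSet, F x = e x := fun x hx => by
      by_cases h : x ∈ Metric.ball B.center B.radius
      · exact if_pos h
      · rw [hFY x h]
        refine (heq x ?_).symm
        exact le_antisymm hx (not_lt.1 h)
    have hXYB : X = Y ∪ B.toSet := by
      ext x
      constructor
      · intro hx
        by_cases h : x ∈ Metric.ball B.center B.radius
        · exact Or.inr (Metric.ball_subset_closedBall h)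
        · left; rw [hYX]; exact ⟨hx, h⟩
      · rintro (hx | hx)
        · rw [hYX] at hx; exact hx.1
        · exact hBX hx
    have hnotY : ∀ x ∈ Y, x ∉ Metric.ball B.center B.radius := fun x hx => by
      rw [hYX] at hx; exact hx.2
    have hFc : ContinuousOn F X := by
      rw [hXYB]
      refine ContinuousOn.union_of_isClosed ?_ ?_ hclY Metric.isClosed_closedBall
      · exact hgc.congr fun x hx => hFY x (hnotY x hx)
      · exact hec.continuousOn.congr hFB
    have hF0 : ∀ x ∈ X, F x ≠ 0 := fun x hx => by
      rw [hXYB] at hx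
      rcases hx with hx | hx
      · rw [hFY x (hnotY x hx)]; exact hg0 x hx
      · rw [hFB x hx]; exact he0 x
    have := ih F (N - k) ⟨fun B' h => hs.radius_pos B' (Finset.mem_insert_of_mem h),
      fun B' h B'' h' => hs.disjoint B' (Finset.mem_insert_of_mem h) B''
        (Finset.mem_insert_of_mem h')⟩
      (fun B' h => hsub B' (Finset.mem_insert_of_mem h)) hFc hF0
      (fun B' hB' => (hgs B' hB').congr fun θ => hFY _ fun hx =>
        Set.disjoint_left.1 (hdisj B' hB') (Metric.ball_subset_closedBall hx)
          (Metric.sphere_subset_closedBall (bdryPoint_mem_sphere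
            (hs.radius_pos B' (Finset.mem_insert_of_mem hB')) θ)))
      (hgK.congr fun θ => hFY _ fun hx => by
        have h1 := bdryPoint_mem_sphere hK θ
        have h2 := hballK hx
        rw [Metric.mem_sphere] at h1
        rw [Metric.mem_ball] at h2
        exact h2.ne h1)
    rw [Finset.sum_insert hBs, ← this, hk]; ring

/-! ### The degree of a map of class `C¹` -/

section Degree

variable {u : Plane → ℂ} {Ω : Set Plane}

lemma hasDerivAt_bdryPoint (B : Disc) (θ : ℝ) :
    HasDerivAt B.bdryPoint (B.radius • !₂[-Real.sin θ, Real.cos θ]) θ := by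
  simp only [funext (bdryPoint_eq B)]
  exact ((hasDerivAt_dir θ).const_smul B.radius).const_add B.center

lemma contDiff_bdryPoint (B : Disc) : ContDiff ℝ 1 B.bdryPoint := by
  simp only [funext (bdryPoint_eq B)]
  exact contDiff_const.add ((contDiff_dir.of_le le_top).const_smul B.radius)

lemma contDiff_comp_bdry (hΩ : IsOpen Ω) (hu : ContDiffOn ℝ 1 u Ω) {B : Disc}
    (hB : ∀ θ, B.bdryPoint θ ∈ Ω) : ContDiff ℝ 1 fun t => u (B.bdryPoint t) := by
  rw [contDiff_iff_contDiffAt]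
  intro t
  exact (hu.contDiffAt (hΩ.mem_nhds (hB t))).comp t (contDiff_bdryPoint B).contDiffAt

/-- The primitive of `γ'/γ` is, up to a constant, a logarithm of `γ`. Its increment over a period is
an integer multiple of `2πi`, so nothing is lost in `deg`, which records only the imaginary part. -/
lemma hasWinding_deg (hΩ : IsOpen Ω) (hu : ContDiffOn ℝ 1 u Ω) {B : Disc}
    (hB : ∀ θ, B.bdryPoint θ ∈ Ω) (h0 : ∀ θ, u (B.bdryPoint θ) ≠ 0) :
    HasWinding u B (deg u B) := by
  set γ : ℝ → ℂ := fun t => u (B.bdryPoint t) with hγ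
  have hγ1 : ContDiff ℝ 1 γ := contDiff_comp_bdry hΩ hu hB
  have hγd : Continuous (deriv γ) := hγ1.continuous_deriv le_rfl
  set q : ℝ → ℂ := fun t => deriv γ t / γ t with hq
  have hqc : Continuous q := hγd.div hγ1.continuous h0
  set I : ℝ → ℂ := fun θ => ∫ t in (0 : ℝ)..θ, q t with hI
  have hId : ∀ θ, HasDerivAt I (q θ) θ := fun θ => hqc.integral_hasStrictDerivAt 0 θ |>.hasDerivAt
  have hIc : Continuous I := continuous_iff_continuousAt.2 fun θ => (hId θ).continuousAt
  have key : ∀ θ, γ θ * Complex.exp (-I θ) = γ 0 := by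
    have hd : ∀ θ, HasDerivAt (fun θ => γ θ * Complex.exp (-I θ)) 0 θ := fun θ => by
      have h1 : HasDerivAt γ (deriv γ θ) θ :=
        (hγ1.differentiable one_ne_zero θ).hasDerivAt
      have h2 := h1.mul ((hId θ).neg.cexp)
      refine HasDerivAt.congr_deriv (f := fun θ => γ θ * Complex.exp (-I θ)) h2 ?_
      have h3 : deriv γ θ = q θ * γ θ := (div_mul_cancel₀ _ (h0 θ)).symm
      rw [h3]; ring
    intro θ
    have := is_const_of_deriv_eq_zero (fun θ => (hd θ).differentiableAt)
      (fun θ => (hd θ).deriv) θ 0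
    simpa [hI] using this
  have hexp : ∀ θ, Complex.exp (Complex.log (γ 0) + I θ) = γ θ := fun θ => by
    rw [Complex.exp_add, Complex.exp_log (show γ 0 ≠ 0 from h0 0), ← key θ, mul_assoc,
      ← Complex.exp_add]
    simp
  refine HasWinding.of_eq_at (l := fun θ => Complex.log (γ 0) + I θ) (by fun_prop) hexp ?_
  have hI0 : I 0 = 0 := by simp [hI]
  rw [hI0, add_zero]
  congr 1
  have hper : Complex.exp (I (2 * Real.pi)) = 1 := by
    have h1 := hexp (2 * Real.pi)
    have h2 : γ (2 * Real.pi) = γ 0 := by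
      have := bdryPoint_periodic B 0
      rw [zero_add] at this
      simp only [hγ, this]
    rw [h2, Complex.exp_add, Complex.exp_log (show γ 0 ≠ 0 from h0 0)] at h1
    exact mul_left_cancel₀ (h0 0) (by rw [h1, mul_one])
  obtain ⟨k, hk⟩ := Complex.exp_eq_one_iff.1 hper
  have him : (I (2 * Real.pi)).im = 2 * Real.pi * deg u B := by
    have h3 : (I (2 * Real.pi)).im = ∫ t in (0 : ℝ)..(2 * Real.pi), (q t).im := by
      have := Complex.imCLM.intervalIntegral_comp_comm (hqc.intervalIntegrable 0 (2 * Real.pi))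
        (μ := MeasureTheory.volume)
      simpa [hI] using this.symm
    rw [h3, deg, ← mul_assoc, mul_inv_cancel₀ (by positivity), one_mul]
  rw [hk] at him ⊢
  have h4 : (k : ℝ) * (2 * Real.pi) = 2 * Real.pi * deg u B := by simpa using him
  have h5 : (deg u B : ℂ) = k := by
    have : deg u B = k := by
      have h6 : (2 * Real.pi) * deg u B = 2 * Real.pi * k := by linarith
      exact mul_left_cancel₀ (by positivity) h6
    exact_mod_cast this
  rw [h5]; ring

lemma deg_int (hΩ : IsOpen Ω) (hu : ContDiffOn ℝ 1 u Ω) {B : Disc}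
    (hB : ∀ θ, B.bdryPoint θ ∈ Ω) (h0 : ∀ θ, u (B.bdryPoint θ) ≠ 0) :
    ∃ k : ℤ, deg u B = k := (hasWinding_deg hΩ hu hB h0).exists_int

/-- Applied to a single inner disc, this says that degrees do not change under dilation; applied to
all discs inside a larger one, that they add up under merging. -/
lemma deg_eq_sum (hΩ : IsOpen Ω) (hu : ContDiffOn ℝ 1 u Ω) {K : Disc} (hK : 0 < K.radius)
    (hKΩ : K.toSet ⊆ Ω) {s : Finset Disc} (hs : IsDiscCollection s)
    (hsub : ∀ B ∈ s, B.toSet ⊆ K.toSet)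
    (h0 : ∀ x ∈ K.toSet, (∀ B ∈ s, x ∉ Metric.ball B.center B.radius) → u x ≠ 0) :
    deg u K = ∑ B ∈ s, deg u B := by
  have h0' : ∀ x ∈ K.toSet \ ⋃ B ∈ s, Metric.ball B.center B.radius, u x ≠ 0 := by
    rintro x ⟨hx, hx'⟩
    refine h0 x hx fun B hB h => hx' (Set.mem_biUnion hB h)
  have hsph : ∀ {D : Disc}, 0 < D.radius → ∀ θ, D.bdryPoint θ ∈ D.toSet := fun hD θ =>
    Metric.sphere_subset_closedBall (bdryPoint_mem_sphere hD θ)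
  refine HasWinding.eq_sum hK s (deg u) u (deg u K) hs hsub
    ((hu.continuousOn.mono hKΩ).mono Set.sdiff_subset) h0' (fun B hB => ?_) ?_
  · have hBr := hs.radius_pos B hB
    refine hasWinding_deg hΩ hu (fun θ => hKΩ (hsub B hB (hsph hBr θ))) fun θ => ?_
    refine h0 _ (hsub B hB (hsph hBr θ)) fun B' hB' h => ?_
    by_cases hBB : B = B'
    · subst hBB
      have := bdryPoint_mem_sphere hBr θ
      rw [Metric.mem_sphere] at this
      rw [Metric.mem_ball] at h
      exact h.ne this
    · exact Set.disjoint_left.1 (hs.disjoint B hB B' hB' hBB) (hsph hBr θ)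
        (Metric.ball_subset_closedBall h)
  · refine hasWinding_deg hΩ hu (fun θ => hKΩ (hsph hK θ)) fun θ => ?_
    refine h0 _ (hsph hK θ) fun B hB h => ?_
    have hBr := hs.radius_pos B hB
    have hballK : Metric.ball B.center B.radius ⊆ Metric.ball K.center K.radius := by
      rw [← interior_closedBall K.center hK.ne', ← interior_closedBall B.center hBr.ne']
      exact interior_mono (hsub B hB)
    have h1 := bdryPoint_mem_sphere hK θ
    have h2 := hballK h
    rw [Metric.mem_sphere] at h1
    rw [Metric.mem_ball] at h2
    exact h2.ne h1

end Degree

end VortexBalls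

namespace VortexBalls

/-! ### Collections of discs: merging and growing -/

section Discs

lemma mem_discUnion {𝓑 : Finset Disc} {x : Plane} :
    x ∈ discUnion 𝓑 ↔ ∃ B ∈ 𝓑, x ∈ B.toSet := by simp [discUnion]

lemma mem_discsIn {𝓑 : Finset Disc} {U : Set Plane} {B : Disc} :
    B ∈ discsIn 𝓑 U ↔ B ∈ 𝓑 ∧ B.toSet ⊆ U := by simp [discsIn]

lemma isClosed_toSet (B : Disc) : IsClosed B.toSet := Metric.isClosed_closedBall

lemma isClosed_discUnion (𝓑 : Finset Disc) : IsClosed (discUnion 𝓑) :=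
  𝓑.finite_toSet.isClosed_biUnion fun B _ => isClosed_toSet B

lemma center_mem_toSet {B : Disc} (hB : 0 < B.radius) : B.center ∈ B.toSet :=
  Metric.mem_closedBall_self hB.le

lemma isPreconnected_toSet (B : Disc) : IsPreconnected B.toSet :=
  (convex_closedBall _ _).isPreconnected

lemma ball_subset_toSet (B : Disc) : Metric.ball B.center B.radius ⊆ B.toSet :=
  Metric.ball_subset_closedBall

lemma ball_subset_ball_of_toSet {B K : Disc} (hB : 0 < B.radius) (hK : 0 < K.radius)
    (h : B.toSet ⊆ K.toSet) :
    Metric.ball B.center B.radius ⊆ Metric.ball K.center K.radius := by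
  rw [← interior_closedBall K.center hK.ne', ← interior_closedBall B.center hB.ne']
  exact interior_mono h

lemma IsDiscCollection.eq_of_mem {𝓑 : Finset Disc} (h : IsDiscCollection 𝓑) {B B' : Disc}
    (hB : B ∈ 𝓑) (hB' : B' ∈ 𝓑) {x : Plane} (hx : x ∈ B.toSet) (hx' : x ∈ B'.toSet) : B = B' := by
  by_contra hne
  exact Set.disjoint_left.1 (h.disjoint B hB B' hB' hne) hx hx'

lemma IsDiscCollection.subset {𝓑 𝓒 : Finset Disc} (h : IsDiscCollection 𝓑) (hs : 𝓒 ⊆ 𝓑) :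
    IsDiscCollection 𝓒 :=
  ⟨fun B hB => h.radius_pos B (hs hB), fun B hB B' hB' => h.disjoint B (hs hB) B' (hs hB')⟩

lemma IsDiscCollection.discsIn {𝓑 : Finset Disc} (h : IsDiscCollection 𝓑) (U : Set Plane) :
    IsDiscCollection (discsIn 𝓑 U) := h.subset fun _ hB => (mem_discsIn.1 hB).1

/-- A disc meeting a ball of the collection and contained in the union is contained in the ball. -/
lemma IsDiscCollection.toSet_subset {𝓑 : Finset Disc} (h : IsDiscCollection 𝓑) {D B : Disc}
    (hD : D.toSet ⊆ discUnion 𝓑) (hB : B ∈ 𝓑) {x : Plane} (hxD : x ∈ D.toSet)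
    (hxB : x ∈ B.toSet) : D.toSet ⊆ B.toSet := by
  classical
  -- A disc is connected, and `B` and the union of the other discs are disjoint closed sets, so a
  -- disc in the union that meets `B` stays in `B`.
  have hcl : IsClosed (⋃ B' ∈ 𝓑.erase B, B'.toSet) :=
    (𝓑.erase B).finite_toSet.isClosed_biUnion fun B' _ => isClosed_toSet B'
  have hdis : Disjoint B.toSet (⋃ B' ∈ 𝓑.erase B, B'.toSet) := by
    simp only [Set.disjoint_iUnion_right, Finset.mem_erase]
    intro B' hB'
    exact h.disjoint B hB B' hB'.2 (Ne.symm hB'.1)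
  have hsub : D.toSet ⊆ B.toSet ∪ ⋃ B' ∈ 𝓑.erase B, B'.toSet := by
    intro y hy
    obtain ⟨B', hB', hy'⟩ := mem_discUnion.1 (hD hy)
    by_cases e : B' = B
    · exact Or.inl (e ▸ hy')
    · exact Or.inr (Set.mem_biUnion (Finset.mem_erase.2 ⟨e, hB'⟩) hy')
  rcases isPreconnected_iff_subset_of_disjoint_closed.1 (isPreconnected_toSet D) _ _
    (isClosed_toSet B) hcl hsub (by rw [hdis.inter_eq, Set.inter_empty]) with h1 | h1
  · exact h1
  · exact absurd (h1 hxD) (Set.disjoint_left.1 hdis hxB)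

lemma IsDiscCollection.exists_subset {𝓑 : Finset Disc} (h : IsDiscCollection 𝓑) {D : Disc}
    (hr : 0 < D.radius) (hD : D.toSet ⊆ discUnion 𝓑) : ∃ B ∈ 𝓑, D.toSet ⊆ B.toSet := by
  obtain ⟨B, hB, hx⟩ := mem_discUnion.1 (hD (center_mem_toSet hr))
  exact ⟨B, hB, h.toSet_subset hD hB (center_mem_toSet hr) hx⟩

/-- Two intersecting discs are contained in a disc whose radius is the sum of the radii. -/
lemma exists_enclosing {B₁ B₂ : Disc} (h₁ : 0 < B₁.radius) (h₂ : 0 < B₂.radius)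
    (h : ¬ Disjoint B₁.toSet B₂.toSet) :
    ∃ c : Plane, B₁.toSet ⊆ (Disc.mk c (B₁.radius + B₂.radius)).toSet ∧
      B₂.toSet ⊆ (Disc.mk c (B₁.radius + B₂.radius)).toSet := by
  obtain ⟨x, hx1, hx2⟩ := Set.not_disjoint_iff.1 h
  have hd : dist B₁.center B₂.center ≤ B₁.radius + B₂.radius := by
    have := dist_triangle_right B₁.center B₂.center x
    simp only [Disc.toSet, Metric.mem_closedBall'] at hx1 hx2
    linarith
  set R := B₁.radius + B₂.radius with hR
  have hRp : 0 < R := by positivity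
  -- This point divides the segment of centres so that its distance to each centre is at most the
  -- radius of the other disc.
  set c : Plane := B₁.center + (B₂.radius / R) • (B₂.center - B₁.center) with hc
  have e1 : dist B₁.center c ≤ B₂.radius := by
    rw [hc, dist_self_add_right, norm_smul, Real.norm_eq_abs, abs_of_pos (by positivity),
      ← dist_eq_norm, dist_comm]
    calc B₂.radius / R * dist B₁.center B₂.center ≤ B₂.radius / R * R := by gcongr
      _ = B₂.radius := by field_simp
  have e2 : dist B₂.center c ≤ B₁.radius := by
    have : c = B₂.center + (B₁.radius / R) • (B₁.center - B₂.center) := by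
      have h5 : B₂.radius / R = 1 - B₁.radius / R := by field_simp; rw [hR]; ring
      rw [hc, h5]; module
    rw [this, dist_self_add_right, norm_smul, Real.norm_eq_abs, abs_of_pos (by positivity),
      ← dist_eq_norm]
    calc B₁.radius / R * dist B₁.center B₂.center ≤ B₁.radius / R * R := by gcongr
      _ = B₁.radius := by field_simp
  refine ⟨c, ?_, ?_⟩
  · exact Metric.closedBall_subset_closedBall' (by simp only; linarith)
  · exact Metric.closedBall_subset_closedBall' (by simp only; linarith)

/-- Finitely many balls can be merged into disjoint ones, adding the radii. -/
lemma exists_merge {ι : Type*} [DecidableEq ι] [DecidableEq Disc] (n : ℕ) : ∀ (s : Finset ι) (D : ι → Disc),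
    s.card = n → (∀ i ∈ s, 0 < (D i).radius) →
    ∃ (𝓒 : Finset Disc) (p : ι → Disc), IsDiscCollection 𝓒 ∧
      (∀ i ∈ s, p i ∈ 𝓒 ∧ (D i).toSet ⊆ (p i).toSet) ∧
      (∀ B ∈ 𝓒, B.radius = ∑ i ∈ s, if p i = B then (D i).radius else 0) ∧
      𝓒.card ≤ s.card ∧
      ((∃ i ∈ s, ∃ j ∈ s, i ≠ j ∧ ¬ Disjoint (D i).toSet (D j).toSet) → 𝓒.card < s.card) := by
  induction n with
  | zero =>
    intro s D hs _
    rw [Finset.card_eq_zero] at hs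
    subst hs
    exact ⟨∅, D, ⟨by simp, by simp⟩, by simp, by simp, by simp, by simp⟩
  | succ n ih =>
    intro s D hs hpos
    by_cases hd : ∃ i ∈ s, ∃ j ∈ s, i ≠ j ∧ ¬ Disjoint (D i).toSet (D j).toSet
    · obtain ⟨i, hi, j, hj, hij, hdis⟩ := hd
      obtain ⟨c, hc1, hc2⟩ := exists_enclosing (hpos i hi) (hpos j hj) hdis
      set M : Disc := ⟨c, (D i).radius + (D j).radius⟩ with hM
      -- The enclosing disc takes the index `i` and the index `j` is dropped; in the end `j` is
      -- assigned the same merged disc as `i`, so radii over each merged disc still add up.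
      set D' := Function.update D i M with hD'
      have hcard : (s.erase j).card = n := by rw [Finset.card_erase_of_mem hj, hs]; rfl
      have hDi : D' i = M := by simp [hD']
      have hDk : ∀ k, k ≠ i → D' k = D k := fun k hk => by simp [hD', hk]
      obtain ⟨𝓒, p, h1, h2, h3, h4, -⟩ := ih (s.erase j) D' hcard (fun k hk => by
        by_cases e : k = i
        · rw [e, hDi]; exact add_pos (hpos i hi) (hpos j hj)
        · rw [hDk k e]; exact hpos k (Finset.mem_of_mem_erase hk))
      have hie : i ∈ s.erase j := Finset.mem_erase.2 ⟨hij, hi⟩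
      refine ⟨𝓒, Function.update p j (p i), h1, ?_, ?_, ?_, ?_⟩
      · intro k hk
        by_cases e : k = j
        · subst e
          simp only [Function.update_self]
          have := h2 i hie
          exact ⟨this.1, hc2.trans (hDi ▸ this.2)⟩
        · rw [Function.update_of_ne e]
          have := h2 k (Finset.mem_erase.2 ⟨e, hk⟩)
          refine ⟨this.1, ?_⟩
          by_cases e' : k = i
          · subst e'
            exact hc1.trans (hDi ▸ this.2)
          · rw [← hDk k e']; exact this.2
      · intro B hB
        rw [h3 B hB, ← Finset.add_sum_erase s _ hj, ← Finset.add_sum_erase (s.erase j) _ hie,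
          ← Finset.add_sum_erase (s.erase j) _ hie, Function.update_self,
          Function.update_of_ne hij, hDi]
        have : ∑ k ∈ (s.erase j).erase i, (if p k = B then (D' k).radius else 0)
            = ∑ k ∈ (s.erase j).erase i, if Function.update p j (p i) k = B
              then (D k).radius else 0 := by
          refine Finset.sum_congr rfl fun k hk => ?_
          have hk1 := Finset.ne_of_mem_erase hk
          have hk2 := Finset.ne_of_mem_erase (Finset.mem_of_mem_erase hk)
          rw [Function.update_of_ne hk2, hDk k hk1]
        rw [this]
        by_cases e : p i = B
        · simp only [e, if_true, hM]; ring
        · simp [e]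
      · have : (s.erase j).card ≤ s.card := Finset.card_le_card (Finset.erase_subset _ _)
        omega
      · intro _
        have : (s.erase j).card < s.card := Finset.card_erase_lt_of_mem hj
        omega
    · have hd' : ∀ i ∈ s, ∀ j ∈ s, i ≠ j → Disjoint (D i).toSet (D j).toSet := by
        intro i hi j hj hij
        by_contra hcon
        exact hd ⟨i, hi, j, hj, hij, hcon⟩
      have hinj : ∀ i ∈ s, ∀ j ∈ s, D i = D j → i = j := by
        intro i hi j hj hij
        by_contra hne
        have := hd' i hi j hj hne
        rw [hij] at this
        exact Set.disjoint_left.1 this (center_mem_toSet (hpos j hj)) (center_mem_toSet (hpos j hj))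
      refine ⟨s.image D, D, ⟨?_, ?_⟩, ?_, ?_, Finset.card_image_le, fun h => absurd h hd⟩
      · intro B hB
        obtain ⟨i, hi, rfl⟩ := Finset.mem_image.1 hB
        exact hpos i hi
      · intro B hB B' hB' hne
        obtain ⟨i, hi, rfl⟩ := Finset.mem_image.1 hB
        obtain ⟨j, hj, rfl⟩ := Finset.mem_image.1 hB'
        exact hd' i hi j hj fun e => hne (by rw [e])
      · exact fun i hi => ⟨Finset.mem_image_of_mem D hi, subset_rfl⟩
      · intro B hB
        obtain ⟨i, hi, rfl⟩ := Finset.mem_image.1 hB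
        rw [Finset.sum_eq_single i]
        · simp
        · intro j hj hji
          exact if_neg fun e => hji (hinj j hj i hi e)
        · exact fun h => absurd hi h

lemma totalRadius_merge {ι : Type*} {s : Finset ι} {D : ι → Disc} {𝓒 : Finset Disc}
    {p : ι → Disc} [DecidableEq Disc] (hp : ∀ i ∈ s, p i ∈ 𝓒)
    (h : ∀ B ∈ 𝓒, B.radius = ∑ i ∈ s, if p i = B then (D i).radius else 0) :
    totalRadius 𝓒 = ∑ i ∈ s, (D i).radius := by
  rw [totalRadius, Finset.sum_congr rfl h, Finset.sum_comm]
  refine Finset.sum_congr rfl fun i hi => ?_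
  rw [Finset.sum_ite_eq, if_pos (hp i hi)]

/-- A ball growth in which radii are added when balls are merged. -/
structure IsAdditiveGrowth (𝓑 : ℝ → Finset Disc) (T : Finset ℝ) : Prop
    extends IsDiscGrowth 𝓑 T where
  radius_eq : ∀ t, 0 ≤ t → ∀ B ∈ 𝓑 t,
    B.radius = Real.exp t * ∑ B' ∈ discsIn (𝓑 0) B.toSet, B'.radius

lemma dilate_dilate (k l : ℝ) (B : Disc) : (B.dilate k).dilate l = B.dilate (l * k) := by
  simp [Disc.dilate, mul_assoc]

lemma dilate_one (B : Disc) : B.dilate 1 = B := by simp [Disc.dilate]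

lemma dilate_injective {k : ℝ} (hk : k ≠ 0) : Function.Injective (Disc.dilate k) := by
  rintro ⟨a, r⟩ ⟨b, s⟩ h
  simp only [Disc.dilate, Disc.mk.injEq] at h
  rw [Disc.mk.injEq]
  exact ⟨h.1, mul_left_cancel₀ hk h.2⟩

lemma toSet_subset_dilate {B : Disc} (hB : 0 < B.radius) {k : ℝ} (hk : 1 ≤ k) :
    B.toSet ⊆ (B.dilate k).toSet :=
  Metric.closedBall_subset_closedBall (le_mul_of_one_le_left hB.le hk)

lemma dilate_subset_dilate {B : Disc} (hB : 0 < B.radius) {k l : ℝ} (hk : k ≤ l) :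
    (B.dilate k).toSet ⊆ (B.dilate l).toSet :=
  Metric.closedBall_subset_closedBall (mul_le_mul_of_nonneg_right hk hB.le)

open Classical in
/-- The dilated collection. -/
noncomputable def dilates (𝓒 : Finset Disc) (t : ℝ) : Finset Disc :=
  𝓒.image (Disc.dilate (Real.exp t))

lemma mem_dilates {𝓒 : Finset Disc} {t : ℝ} {B : Disc} :
    B ∈ dilates 𝓒 t ↔ ∃ B' ∈ 𝓒, B = B'.dilate (Real.exp t) := by
  simp [dilates, eq_comm]

lemma totalRadius_dilates (𝓒 : Finset Disc) (t : ℝ) :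
    totalRadius (dilates 𝓒 t) = Real.exp t * totalRadius 𝓒 := by
  classical
  rw [totalRadius, dilates, Finset.sum_image fun _ _ _ _ h => dilate_injective (Real.exp_ne_zero t) h,
    totalRadius, Finset.mul_sum]
  rfl

lemma mem_dilates_iff {𝓒 : Finset Disc} {t s : ℝ} {B : Disc} :
    B ∈ dilates 𝓒 s ↔ ∃ B' ∈ dilates 𝓒 t, B = B'.dilate (Real.exp (s - t)) := by
  constructor
  · intro h
    obtain ⟨B', hB', rfl⟩ := mem_dilates.1 h
    refine ⟨_, mem_dilates.2 ⟨B', hB', rfl⟩, ?_⟩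
    rw [dilate_dilate, ← Real.exp_add, sub_add_cancel]
  · rintro ⟨B', hB', rfl⟩
    obtain ⟨B'', hB'', rfl⟩ := mem_dilates.1 hB'
    rw [dilate_dilate, ← Real.exp_add, sub_add_cancel]
    exact mem_dilates.2 ⟨B'', hB'', rfl⟩

lemma dilates_collection {𝓒 : Finset Disc} (h : IsDiscCollection 𝓒) {t : ℝ}
    (hd : ∀ B ∈ 𝓒, ∀ B' ∈ 𝓒, B ≠ B' →
      Real.exp t * (B.radius + B'.radius) < dist B.center B'.center) :
    IsDiscCollection (dilates 𝓒 t) := by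
  refine ⟨fun B hB => ?_, fun B hB B' hB' hne => ?_⟩
  · obtain ⟨B0, hB0, rfl⟩ := mem_dilates.1 hB
    exact mul_pos (Real.exp_pos t) (h.radius_pos B0 hB0)
  · obtain ⟨B0, hB0, rfl⟩ := mem_dilates.1 hB
    obtain ⟨B1, hB1, rfl⟩ := mem_dilates.1 hB'
    have := hd B0 hB0 B1 hB1 fun e => hne (by rw [e])
    exact Metric.closedBall_disjoint_closedBall (by simp only [Disc.dilate]; linarith)

lemma dilates_radius_eq {𝓒 : Finset Disc} (h : IsDiscCollection 𝓒) {t : ℝ} (ht : 0 ≤ t)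
    (hd : IsDiscCollection (dilates 𝓒 t)) {B : Disc} (hB : B ∈ dilates 𝓒 t) :
    B.radius = Real.exp t * ∑ B' ∈ discsIn 𝓒 B.toSet, B'.radius := by
  obtain ⟨B0, hB0, rfl⟩ := mem_dilates.1 hB
  have h1 : 1 ≤ Real.exp t := Real.one_le_exp ht
  have : discsIn 𝓒 (B0.dilate (Real.exp t)).toSet = {B0} := by
    ext B'
    rw [mem_discsIn, Finset.mem_singleton]
    constructor
    · rintro ⟨hB', hsub⟩
      have hp := h.radius_pos B' hB'
      have hm : B'.center ∈ (B'.dilate (Real.exp t)).toSet :=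
        toSet_subset_dilate hp h1 (center_mem_toSet hp)
      have := hd.eq_of_mem (mem_dilates.2 ⟨B', hB', rfl⟩) hB hm (hsub (center_mem_toSet hp))
      exact dilate_injective (Real.exp_ne_zero t) this
    · rintro rfl
      exact ⟨hB0, toSet_subset_dilate (h.radius_pos _ hB0) h1⟩
  rw [this, Finset.sum_singleton]
  rfl

lemma dilates_zero (𝓒 : Finset Disc) : dilates 𝓒 0 = 𝓒 := by
  ext B
  rw [mem_dilates]
  constructor
  · rintro ⟨B', h, rfl⟩; rwa [Real.exp_zero, dilate_one]
  · exact fun h => ⟨B, h, by rw [Real.exp_zero, dilate_one]⟩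

lemma discUnion_dilates_mono {𝓒 : Finset Disc} (h : IsDiscCollection 𝓒) {t s : ℝ} (hts : t ≤ s) :
    discUnion (dilates 𝓒 t) ⊆ discUnion (dilates 𝓒 s) := by
  intro x hx
  obtain ⟨B, hB, hxB⟩ := mem_discUnion.1 hx
  obtain ⟨B0, hB0, rfl⟩ := mem_dilates.1 hB
  exact mem_discUnion.2 ⟨_, mem_dilates.2 ⟨B0, hB0, rfl⟩,
    dilate_subset_dilate (h.radius_pos B0 hB0) (Real.exp_le_exp.2 hts) hxB⟩

lemma radius_add_lt_dist {B B' : Disc} (hB : 0 < B.radius) (hB' : 0 < B'.radius)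
    (h : Disjoint B.toSet B'.toSet) : B.radius + B'.radius < dist B.center B'.center :=
  (disjoint_closedBall_closedBall_iff hB.le hB'.le).1 h

/-- Every finite collection of disjoint balls can be grown. -/
lemma exists_growth (n : ℕ) : ∀ 𝓒 : Finset Disc, 𝓒.card = n → IsDiscCollection 𝓒 →
    ∃ (𝓑 : ℝ → Finset Disc) (T : Finset ℝ), IsAdditiveGrowth 𝓑 T ∧ 𝓑 0 = 𝓒 := by
  classical
  induction n using Nat.strong_induction_on with
  | _ n ih =>
  intro 𝓒 hn h𝓒
  by_cases hne : 𝓒.offDiag.Nonempty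
  -- `τ` is the time at which two dilating discs touch. All discs can be dilated until the least
  -- such time `t₁`; merging there strictly lowers the number of discs, and the induction hypothesis
  -- continues the growth.
  · set τ : Disc × Disc → ℝ := fun q =>
      Real.log (dist q.1.center q.2.center / (q.1.radius + q.2.radius)) with hτ
    obtain ⟨q, hq, hqmin⟩ := Finset.exists_min_image 𝓒.offDiag τ hne
    set t₁ := τ q with ht₁
    have hpair : ∀ B ∈ 𝓒, ∀ B' ∈ 𝓒, B ≠ B' → ∀ t,
        (Real.exp t * (B.radius + B'.radius) < dist B.center B'.center ↔ t < τ (B, B')) := by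
      intro B hB B' hB' hBB t
      have h1 := h𝓒.radius_pos B hB
      have h2 := h𝓒.radius_pos B' hB'
      have h3 := radius_add_lt_dist h1 h2 (h𝓒.disjoint B hB B' hB' hBB)
      have h4 : 0 < B.radius + B'.radius := by positivity
      simp only [hτ]
      rw [Real.lt_log_iff_exp_lt (div_pos (h4.trans h3) h4), lt_div_iff₀ h4]
    have hcoll : ∀ t, t < t₁ → IsDiscCollection (dilates 𝓒 t) := fun t ht =>
      dilates_collection h𝓒 fun B hB B' hB' hBB => (hpair B hB B' hB' hBB t).2
        (ht.trans_le (hqmin (B, B') (Finset.mem_offDiag.2 ⟨hB, hB', hBB⟩)))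
    obtain ⟨hq1, hq2, hq3⟩ := Finset.mem_offDiag.1 hq
    have ht₁pos : 0 < t₁ := by
      rw [ht₁, ← (hpair q.1 hq1 q.2 hq2 hq3 0)]
      simpa using radius_add_lt_dist (h𝓒.radius_pos _ hq1) (h𝓒.radius_pos _ hq2)
        (h𝓒.disjoint _ hq1 _ hq2 hq3)
    obtain ⟨𝓒₁, p, hc1, hc2, hc3, -, hc5⟩ := exists_merge 𝓒.card 𝓒
      (fun B => B.dilate (Real.exp t₁)) rfl
      (fun B hB => mul_pos (Real.exp_pos _) (h𝓒.radius_pos B hB))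
    have hlt : 𝓒₁.card < n := by
      rw [← hn]
      refine hc5 ⟨q.1, hq1, q.2, hq2, hq3, fun hdis => ?_⟩
      have := radius_add_lt_dist (mul_pos (Real.exp_pos t₁) (h𝓒.radius_pos _ hq1))
        (mul_pos (Real.exp_pos t₁) (h𝓒.radius_pos _ hq2)) hdis
      simp only [Disc.dilate, ← mul_add] at this
      exact absurd ((hpair q.1 hq1 q.2 hq2 hq3 t₁).1 this) (lt_irrefl _)
    obtain ⟨𝓑', T', hg, hg0⟩ := ih _ hlt 𝓒₁ rfl hc1
    set 𝓑 : ℝ → Finset Disc := fun t => if t < t₁ then dilates 𝓒 t else 𝓑' (t - t₁) with h𝓑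
    have hlo : ∀ t, t < t₁ → 𝓑 t = dilates 𝓒 t := fun t ht => if_pos ht
    have hhi : ∀ t, t₁ ≤ t → 𝓑 t = 𝓑' (t - t₁) := fun t ht => if_neg (not_lt.2 ht)
    have hrad : totalRadius 𝓒₁ = Real.exp t₁ * totalRadius 𝓒 := by
      rw [totalRadius_merge (fun i hi => (hc2 i hi).1) hc3, totalRadius, Finset.mul_sum]
      rfl
    have h0 : 𝓑 0 = 𝓒 := by rw [hlo 0 ht₁pos, dilates_zero]
    have hun1 : discUnion (dilates 𝓒 t₁) ⊆ discUnion 𝓒₁ := by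
      intro x hx
      obtain ⟨B, hB, hxB⟩ := mem_discUnion.1 hx
      obtain ⟨B0, hB0, rfl⟩ := mem_dilates.1 hB
      exact mem_discUnion.2 ⟨p B0, (hc2 B0 hB0).1, (hc2 B0 hB0).2 hxB⟩
    refine ⟨𝓑, insert t₁ (T'.image (· + t₁)), ⟨⟨?_, ?_, ?_, ?_⟩, ?_⟩, h0⟩
    · intro t ht
      rcases lt_or_ge t t₁ with h | h
      · rw [hlo t h]; exact hcoll t h
      · rw [hhi t h]; exact hg.collection _ (by linarith)
    · intro t s ht hts
      rcases lt_or_ge s t₁ with h | h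
      · rw [hlo s h, hlo t (hts.trans_lt h)]
        exact discUnion_dilates_mono h𝓒 hts
      · rw [hhi s h]
        rcases lt_or_ge t t₁ with h' | h'
        · rw [hlo t h']
          refine (discUnion_dilates_mono h𝓒 h'.le).trans (hun1.trans ?_)
          rw [← hg0]
          exact hg.union_subset 0 _ le_rfl (by linarith)
        · rw [hhi t h']
          exact hg.union_subset _ _ (by linarith) (by linarith)
    · intro t s ht hts hT B
      have hT1 := hT t₁ (Finset.mem_insert_self _ _)
      rcases lt_or_ge s t₁ with h | h
      · rw [hlo s h, hlo t (hts.trans_lt h)]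
        exact mem_dilates_iff
      · have h' : t₁ ≤ t := by
          by_contra hcon
          exact hT1 ⟨(not_le.1 hcon).le, h⟩
        rw [hhi s h, hhi t h', hg.dilate (t - t₁) (s - t₁) (by linarith) (by linarith)
          (fun q hq hq' => hT (q + t₁) (Finset.mem_insert_of_mem (Finset.mem_image_of_mem _ hq))
            ⟨by linarith [hq'.1], by linarith [hq'.2]⟩) B, sub_sub_sub_cancel_right]
    · intro t ht
      rw [h0]
      rcases lt_or_ge t t₁ with h | h
      · rw [hlo t h, totalRadius_dilates]
      · rw [hhi t h, hg.totalRadius_eq _ (by linarith), hg0, hrad, ← mul_assoc, ← Real.exp_add,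
          sub_add_cancel]
    · intro t ht B hB
      rw [h0]
      rcases lt_or_ge t t₁ with h | h
      · rw [hlo t h] at hB
        exact dilates_radius_eq h𝓒 ht (hcoll t h) hB
      · rw [hhi t h] at hB
        have htt : 0 ≤ t - t₁ := by linarith
        rw [hg.radius_eq _ htt B hB, hg0]
        have hsum : ∑ M ∈ discsIn 𝓒₁ B.toSet, M.radius
            = ∑ B' ∈ discsIn 𝓒 B.toSet, Real.exp t₁ * B'.radius := by
          rw [Finset.sum_congr rfl fun M hM => hc3 M (mem_discsIn.1 hM).1, Finset.sum_comm]
          simp only [discsIn]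
          rw [Finset.sum_filter]
          refine Finset.sum_congr rfl fun B' hB' => ?_
          rw [Finset.sum_ite_eq]
          have hpos := h𝓒.radius_pos B' hB'
          have hsub : B'.toSet ⊆ (p B').toSet :=
            (toSet_subset_dilate hpos (Real.one_le_exp ht₁pos.le)).trans (hc2 B' hB').2
          -- An original disc lies in `B` exactly when the merged disc containing it does, because
          -- the merged disc lies in the later union and meets `B`.
          have hiff : p B' ∈ Finset.filter (fun M : Disc => M.toSet ⊆ B.toSet) 𝓒₁
              ↔ B'.toSet ⊆ B.toSet := by
            rw [Finset.mem_filter]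
            refine ⟨fun hh => hsub.trans hh.2, fun hh => ⟨(hc2 B' hB').1, ?_⟩⟩
            refine (hg.collection _ htt).toSet_subset ?_ hB (hsub (center_mem_toSet hpos))
              (hh (center_mem_toSet hpos))
            intro x hx
            refine hg.union_subset 0 _ le_rfl htt ?_
            rw [hg0]
            exact mem_discUnion.2 ⟨_, (hc2 B' hB').1, hx⟩
          simp only [hiff]
          rfl
        rw [hsum, ← Finset.mul_sum, ← mul_assoc, ← Real.exp_add, sub_add_cancel]
  · have hall : ∀ t, IsDiscCollection (dilates 𝓒 t) := fun t =>
      dilates_collection h𝓒 fun B hB B' hB' hBB =>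
        absurd ⟨(B, B'), Finset.mem_offDiag.2 ⟨hB, hB', hBB⟩⟩ hne
    refine ⟨dilates 𝓒, ∅, ⟨⟨fun t _ => hall t, fun t s _ hts => discUnion_dilates_mono h𝓒 hts,
      fun t s _ _ _ B => mem_dilates_iff, fun t _ => ?_⟩, fun t ht B hB => ?_⟩, dilates_zero 𝓒⟩
    · rw [dilates_zero, totalRadius_dilates]
    · rw [dilates_zero]; exact dilates_radius_eq h𝓒 ht (hall t) hB

/-- A time interval without merging enlarges every disc strictly. This is what places earlier discs
in the interiors of later ones in `IsDiscGrowth.mem_ball`. -/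
lemma exists_gap (T : Finset ℝ) {a b : ℝ} (hab : a < b) :
    ∃ c d, a < c ∧ c < d ∧ d < b ∧ ∀ q ∈ T, q ∉ Set.Icc c d := by
  have hinf : (Set.Ioo a b \ (T : Set ℝ)).Nonempty :=
    ((Set.Ioo_infinite hab).sdiff T.finite_toSet).nonempty
  obtain ⟨c, hc⟩ := hinf
  have hop : IsOpen (Set.Ioo a b \ (T : Set ℝ)) := isOpen_Ioo.sdiff T.finite_toSet.isClosed
  obtain ⟨η, hη, hball⟩ := Metric.isOpen_iff.1 hop c hc
  have hmem : ∀ x ∈ Set.Icc c (c + η / 2), x ∈ Set.Ioo a b \ (T : Set ℝ) := fun x hx => hball (by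
    rw [Metric.mem_ball, Real.dist_eq, abs_of_nonneg (by linarith [hx.1])]
    linarith [hx.2])
  refine ⟨c, c + η / 2, hc.1.1, by linarith, (hmem _ ⟨by linarith, le_rfl⟩).1.2, fun q hq hq' => ?_⟩
  exact (hmem q hq').2 hq

/-- Balls at an earlier time are contained in the interiors of the balls at a later time. -/
lemma IsDiscGrowth.mem_ball {𝓑 : ℝ → Finset Disc} {T : Finset ℝ} (h : IsDiscGrowth 𝓑 T) {t s : ℝ}
    (ht : 0 ≤ t) (hts : t < s) {x : Plane} (hx : x ∈ discUnion (𝓑 t)) :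
    ∃ B ∈ 𝓑 s, x ∈ Metric.ball B.center B.radius := by
  obtain ⟨c, d, hc, hcd, hd, hT⟩ := exists_gap T hts
  have hc0 : 0 ≤ c := by linarith
  obtain ⟨B, hB, hxB⟩ := mem_discUnion.1 (h.union_subset t c ht hc.le hx)
  have hBr := (h.collection c hc0).radius_pos B hB
  have hD : B.dilate (Real.exp (d - c)) ∈ 𝓑 d := (h.dilate c d hc0 hcd.le hT _).2 ⟨B, hB, rfl⟩
  have hDr := (h.collection d (by linarith)).radius_pos _ hD
  have hcs := h.collection s (by linarith)
  obtain ⟨B', hB', hsub⟩ := hcs.exists_subset hDr (fun y hy =>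
    h.union_subset d s (by linarith) hd.le (mem_discUnion.2 ⟨_, hD, hy⟩))
  refine ⟨B', hB', ball_subset_ball_of_toSet hDr (hcs.radius_pos _ hB') hsub ?_⟩
  have : 1 < Real.exp (d - c) := Real.one_lt_exp_iff.2 (by linarith)
  simp only [Disc.dilate, Metric.mem_ball]
  have hx' : dist x B.center ≤ B.radius := hxB
  nlinarith

end Discs

end VortexBalls

namespace VortexBalls

open MeasureTheory

/-! ### Polar coordinates -/

section Polar

/-- The measure preserving identification of `ℝ²` with `ℝ × ℝ`. -/
noncomputable def planeEquiv : Plane ≃ᵐ ℝ × ℝ :=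
  (MeasurableEquiv.toLp 2 (Fin 2 → ℝ)).symm.trans MeasurableEquiv.finTwoArrow

lemma measurePreserving_planeEquiv : MeasurePreserving planeEquiv :=
  (EuclideanSpace.volume_preserving_symm_measurableEquiv_toLp (Fin 2)).trans
    (volume_preserving_finTwoArrow ℝ)

lemma integral_polar (f : Plane → ℝ) (c : Plane) :
    ∫ x, f x = ∫ p in Set.Ioi (0 : ℝ) ×ˢ Set.Ioo (-Real.pi) Real.pi,
      p.1 * f (c + p.1 • dir p.2) := by
  have h1 : ∫ x, f x = ∫ x, f (c + x) := (integral_add_left_eq_self f c).symm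
  have h2 : ∫ x, f (c + x) = ∫ p : ℝ × ℝ, f (c + !₂[p.1, p.2]) := by
    rw [← measurePreserving_planeEquiv.integral_comp' (fun p : ℝ × ℝ => f (c + !₂[p.1, p.2]))]
    congr 1
    funext x
    congr 2
    apply plane_ext <;> simp [planeEquiv, MeasurableEquiv.finTwoArrow]
  rw [h1, h2, ← integral_comp_polarCoord_symm]
  refine setIntegral_congr_fun (measurableSet_Ioi.prod measurableSet_Ioo) fun p _ => ?_
  simp only [polarCoord_symm_apply, smul_eq_mul]
  congr 3
  apply plane_ext <;> simp

/-- The open annulus with center `c` and radii `p < q`. -/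
def annulus (c : Plane) (p q : ℝ) : Set Plane := {x | p < dist x c ∧ dist x c < q}

/-- The closed annulus with center `c` and radii `p ≤ q`. -/
def closedAnnulus (c : Plane) (p q : ℝ) : Set Plane := {x | p ≤ dist x c ∧ dist x c ≤ q}

lemma annulus_subset (c : Plane) (p q : ℝ) : annulus c p q ⊆ closedAnnulus c p q :=
  fun _ hx => ⟨hx.1.le, hx.2.le⟩

lemma isOpen_annulus (c : Plane) (p q : ℝ) : IsOpen (annulus c p q) :=
  (isOpen_lt (f := fun _ => p) (g := fun x => dist x c) (by fun_prop) (by fun_prop)).inter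
    (isOpen_lt (f := fun x => dist x c) (g := fun _ => q) (by fun_prop) (by fun_prop))

lemma isCompact_closedAnnulus (c : Plane) (p q : ℝ) : IsCompact (closedAnnulus c p q) := by
  refine (isCompact_closedBall c q).of_isClosed_subset ?_ fun x hx => hx.2
  exact (isClosed_le (f := fun _ => p) (g := fun x => dist x c) (by fun_prop) (by fun_prop)).inter
    (isClosed_le (f := fun x => dist x c) (g := fun _ => q) (by fun_prop) (by fun_prop))

lemma dist_add_smul_dir (c : Plane) {r : ℝ} (hr : 0 ≤ r) (θ : ℝ) :
    dist (c + r • dir θ) c = r := by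
  rw [dist_self_add_left, norm_smul, norm_dir, mul_one, Real.norm_eq_abs, abs_of_nonneg hr]

lemma dir_periodic : Function.Periodic dir (2 * Real.pi) := fun θ => by simp [dir]

lemma continuous_polar (c : Plane) : Continuous fun p : ℝ × ℝ => c + p.1 • dir p.2 := by
  have := continuous_dir
  fun_prop

lemma integrableOn_annulus {F : Plane → ℝ} {c : Plane} {p q : ℝ}
    (hF : ContinuousOn F (closedAnnulus c p q)) : IntegrableOn F (annulus c p q) :=
  (hF.integrableOn_compact (isCompact_closedAnnulus c p q)).mono_set (annulus_subset c p q)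

lemma integral_annulus {F : Plane → ℝ} {c : Plane} {p q : ℝ} (hp : 0 ≤ p) (hpq : p ≤ q)
    (hF : ContinuousOn F (closedAnnulus c p q)) :
    ∫ x in annulus c p q, F x =
      ∫ ρ in p..q, ρ * ∫ θ in (0 : ℝ)..(2 * Real.pi), F (c + ρ • dir θ) := by
  rw [← integral_indicator (isOpen_annulus c p q).measurableSet, integral_polar _ c]
  have hpi := Real.pi_pos
  have e1 : ∀ z : ℝ × ℝ, z ∈ Set.Ioi (0 : ℝ) ×ˢ Set.Ioo (-Real.pi) Real.pi →
      z.1 * (annulus c p q).indicator F (c + z.1 • dir z.2) =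
      (Set.Ioo p q ×ˢ (Set.univ : Set ℝ)).indicator (fun z => z.1 * F (c + z.1 • dir z.2)) z := by
    intro z hz
    have hz0 : 0 < z.1 := hz.1
    have hd := dist_add_smul_dir c hz0.le z.2
    by_cases h : z.1 ∈ Set.Ioo p q
    · rw [Set.indicator_of_mem (by simpa [annulus, hd] using h),
        Set.indicator_of_mem (by simpa using h)]
    · rw [Set.indicator_of_notMem (by simpa [annulus, hd] using h),
        Set.indicator_of_notMem (by simpa using h), mul_zero]
  rw [setIntegral_congr_fun (measurableSet_Ioi.prod measurableSet_Ioo) e1,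
    setIntegral_indicator (measurableSet_Ioo.prod MeasurableSet.univ), Set.prod_inter_prod,
    Set.inter_univ, Set.inter_eq_self_of_subset_right (s := Set.Ioi (0 : ℝ)) (t := Set.Ioo p q)
      (fun x hx => lt_of_le_of_lt hp hx.1)]
  have hint : IntegrableOn (fun z : ℝ × ℝ => z.1 * F (c + z.1 • dir z.2))
      (Set.Ioo p q ×ˢ Set.Ioo (-Real.pi) Real.pi) (volume.prod volume) := by
    have hK : IsCompact (Set.Icc p q ×ˢ Set.Icc (-Real.pi) Real.pi) := isCompact_Icc.prod isCompact_Icc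
    have hc : ContinuousOn (fun z : ℝ × ℝ => z.1 * F (c + z.1 • dir z.2))
        (Set.Icc p q ×ˢ Set.Icc (-Real.pi) Real.pi) := by
      refine continuousOn_fst.mul (hF.comp (continuous_polar c).continuousOn ?_)
      intro z hz
      have := dist_add_smul_dir c (hp.trans hz.1.1) z.2
      simp only [closedAnnulus, Set.mem_ofPred_eq, this]
      exact hz.1
    exact (hc.integrableOn_compact hK).mono_set
      (Set.prod_mono Set.Ioo_subset_Icc_self Set.Ioo_subset_Icc_self)
  have hprod := setIntegral_prod (μ := volume) (ν := volume) _ hint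
  rw [← Measure.volume_eq_prod] at hprod
  rw [hprod, intervalIntegral.integral_of_le hpq, integral_Ioc_eq_integral_Ioo]
  refine setIntegral_congr_fun measurableSet_Ioo fun ρ _ => ?_
  simp only
  rw [integral_const_mul]
  congr 1
  have hper : Function.Periodic (fun θ => F (c + ρ • dir θ)) (2 * Real.pi) := fun θ => by
    simp only [dir_periodic θ]
  have := hper.intervalIntegral_add_eq 0 (-Real.pi)
  rw [zero_add, show -Real.pi + 2 * Real.pi = Real.pi by ring] at this
  rw [this, intervalIntegral.integral_of_le (by linarith), integral_Ioc_eq_integral_Ioo]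

lemma continuousOn_circle_integral {F : Plane → ℝ} {c : Plane} {p q : ℝ} (hp : 0 ≤ p)
    (hpq : p ≤ q) (hF : ContinuousOn F (closedAnnulus c p q)) :
    ContinuousOn (fun ρ => ∫ θ in (0 : ℝ)..(2 * Real.pi), F (c + ρ • dir θ)) (Set.Icc p q) := by
  -- Clamping the radius to `[p, q]` makes the integrand continuous everywhere and does not change
  -- it on the interval.
  have hc : Continuous (Function.uncurry fun ρ θ : ℝ => F (c + max p (min q ρ) • dir θ)) := by
    refine hF.comp_continuous ((continuous_polar c).comp
      (f := fun z : ℝ × ℝ => (max p (min q z.1), z.2)) (by fun_prop)) fun z => ?_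
    have := dist_add_smul_dir c (hp.trans (le_max_left p (min q z.1))) z.2
    simp only [closedAnnulus, Set.mem_ofPred_eq, this]
    exact ⟨le_max_left _ _, max_le hpq (min_le_left _ _)⟩
  refine (intervalIntegral.continuous_parametric_intervalIntegral_of_continuous'
    (μ := volume) hc 0 (2 * Real.pi)).continuousOn.congr fun ρ hρ => ?_
  simp only [min_eq_right hρ.2, max_eq_right hρ.1]

lemma intervalIntegrable_circle {F : Plane → ℝ} {c : Plane} {p q : ℝ} (hp : 0 ≤ p) (hpq : p ≤ q)
    (hF : ContinuousOn F (closedAnnulus c p q)) :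
    IntervalIntegrable (fun ρ => ρ * ∫ θ in (0 : ℝ)..(2 * Real.pi), F (c + ρ • dir θ))
      volume p q := by
  refine ContinuousOn.intervalIntegrable ?_
  rw [Set.uIcc_of_le hpq]
  exact continuousOn_id.mul (continuousOn_circle_integral hp hpq hF)

/-- A lower bound on circles gives a lower bound on annuli. -/
lemma le_integral_annulus {F : Plane → ℝ} {c : Plane} {p q : ℝ} (hp : 0 ≤ p) (hpq : p ≤ q)
    (hF : ContinuousOn F (closedAnnulus c p q)) {l : ℝ → ℝ} (hl : IntervalIntegrable l volume p q)
    (h : ∀ ρ ∈ Set.Ioo p q, l ρ ≤ ρ * ∫ θ in (0 : ℝ)..(2 * Real.pi), F (c + ρ • dir θ)) :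
    ∫ ρ in p..q, l ρ ≤ ∫ x in annulus c p q, F x := by
  rw [integral_annulus hp hpq hF]
  exact intervalIntegral.integral_mono_on_of_le_Ioo hpq hl (intervalIntegrable_circle hp hpq hF) h

lemma volume_ball_real (c : Plane) {r : ℝ} (hr : 0 ≤ r) :
    (volume (Metric.ball c r)).toReal = Real.pi * r ^ 2 := by
  rw [EuclideanSpace.volume_ball_fin_two]
  simp [mul_comm, ENNReal.toReal_ofReal hr, Real.pi_pos.le]

lemma volume_sphere (c : Plane) {r : ℝ} : volume (Metric.sphere c r) = 0 :=
  Measure.addHaar_sphere volume c r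

/-- Cauchy–Schwarz, from the nonnegativity of the integral of `(m g - a)²`, where `m` is the measure
of the set and `a` the integral of `g`. -/
lemma sq_integral_le {X : Type*} [MeasurableSpace X] {μ : Measure X} {S : Set X} {g : X → ℝ}
    (hS : μ S ≠ ⊤) (hg : IntegrableOn g S μ)
    (hg2 : IntegrableOn (fun x => g x ^ 2) S μ) :
    (∫ x in S, g x ∂μ) ^ 2 ≤ (μ S).toReal * ∫ x in S, g x ^ 2 ∂μ := by
  set m := (μ S).toReal with hm
  set a := ∫ x in S, g x ∂μ with ha
  have hconst : ∀ b : ℝ, IntegrableOn (fun _ => b) S μ := fun b => integrableOn_const hS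
  have key : 0 ≤ ∫ x in S, (m * g x - a) ^ 2 ∂μ := integral_nonneg fun x => sq_nonneg _
  have e : ∫ x in S, (m * g x - a) ^ 2 ∂μ = m ^ 2 * (∫ x in S, g x ^ 2 ∂μ) - 2 * m * a * a + a ^ 2 * m := by
    have e1 : (fun x => (m * g x - a) ^ 2) = fun x => (m ^ 2 * g x ^ 2 - 2 * m * a * g x) + a ^ 2 := by
      funext x; ring
    rw [e1, integral_add, integral_sub, integral_const_mul, integral_const_mul]
    · simp [← ha, measureReal_def, hm]; ring
    · exact hg2.const_mul _
    · exact hg.const_mul _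
    · exact (hg2.const_mul _).sub (hg.const_mul _)
    · exact hconst _
  rw [e] at key
  have hm0 : 0 ≤ m := ENNReal.toReal_nonneg
  rcases hm0.eq_or_lt with h0 | h0
  · have hz : μ S = 0 := by
      rcases (ENNReal.toReal_eq_zero_iff _).1 h0.symm with h | h
      · exact h
      · exact absurd h hS
    have : a = 0 := by rw [ha, Measure.restrict_eq_zero.2 hz, integral_zero_measure]
    rw [this, ← h0]; simp
  · have : 0 ≤ m * (m * (∫ x in S, g x ^ 2 ∂μ) - a ^ 2) := by nlinarith
    have := nonneg_of_mul_nonneg_right this h0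
    linarith

end Polar

/-! ### Green's theorem on discs -/

section Green

variable {A : Plane → Plane} {Ω : Set Plane}

/-- The unit tangent vector `(-sin θ, cos θ)`. -/
noncomputable def ndir (θ : ℝ) : Plane := !₂[-Real.sin θ, Real.cos θ]

@[simp] lemma ndir_zero (θ : ℝ) : ndir θ 0 = -Real.sin θ := rfl

@[simp] lemma ndir_one (θ : ℝ) : ndir θ 1 = Real.cos θ := rfl

lemma fderiv_dir {F : Type*} [NormedAddCommGroup F] [NormedSpace ℝ F] (f : Plane → F) (x : Plane)
    (θ : ℝ) : fderiv ℝ f x (dir θ) = Real.cos θ • partialD 0 f x + Real.sin θ • partialD 1 f x := by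
  have : dir θ = Real.cos θ • EuclideanSpace.single 0 1 + Real.sin θ • EuclideanSpace.single 1 1 := by
    apply plane_ext <;> simp
  rw [this, map_add, map_smul, map_smul]; rfl

lemma fderiv_ndir {F : Type*} [NormedAddCommGroup F] [NormedSpace ℝ F] (f : Plane → F) (x : Plane)
    (θ : ℝ) :
    fderiv ℝ f x (ndir θ) = -Real.sin θ • partialD 0 f x + Real.cos θ • partialD 1 f x := by
  have : ndir θ = -Real.sin θ • EuclideanSpace.single 0 1 + Real.cos θ • EuclideanSpace.single 1 1 := by
    apply plane_ext <;> simp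
  rw [this, map_add, map_smul, map_smul]; rfl

lemma contDiffOn_component {n : WithTop ℕ∞} (hA : ContDiffOn ℝ n A Ω) (j : Fin 2) :
    ContDiffOn ℝ n (fun y => A y j) Ω := by
  rw [contDiffOn_euclidean] at hA
  exact hA j

lemma continuousOn_partialD {F : Type*} [NormedAddCommGroup F] [NormedSpace ℝ F] {f : Plane → F}
    (hΩ : IsOpen Ω) (hf : ContDiffOn ℝ 1 f Ω) (j : Fin 2) : ContinuousOn (partialD j f) Ω :=
  (hf.continuousOn_fderiv_of_isOpen hΩ le_rfl).clm_apply continuousOn_const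

lemma continuousOn_curl (hΩ : IsOpen Ω) (hA : ContDiffOn ℝ 1 A Ω) : ContinuousOn (curl A) Ω :=
  (continuousOn_partialD hΩ (contDiffOn_component hA 1) 0).sub
    (continuousOn_partialD hΩ (contDiffOn_component hA 0) 1)

lemma hasFDerivAt_polar (c : Plane) (p : ℝ × ℝ) :
    HasFDerivAt (fun p : ℝ × ℝ => c + p.1 • dir p.2)
      (p.1 • (ContinuousLinearMap.toSpanSingleton ℝ (ndir p.2)).comp (ContinuousLinearMap.snd ℝ ℝ ℝ)
        + (ContinuousLinearMap.fst ℝ ℝ ℝ).smulRight (dir p.2)) p := by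
  have h1 : HasFDerivAt (fun p : ℝ × ℝ => dir p.2)
      ((ContinuousLinearMap.toSpanSingleton ℝ (ndir p.2)).comp (ContinuousLinearMap.snd ℝ ℝ ℝ)) p :=
    (hasDerivAt_dir p.2).hasFDerivAt.comp p hasFDerivAt_snd
  exact (hasFDerivAt_fst.smul h1).const_add c

/-- The tangential component of a field on the circle of radius `ρ` around `c`. -/
noncomputable def tangential (A : Plane → Plane) (c : Plane) (ρ θ : ℝ) : ℝ :=
  -A (c + ρ • dir θ) 0 * Real.sin θ + A (c + ρ • dir θ) 1 * Real.cos θ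

lemma green_disc (hΩ : IsOpen Ω) (hA : ContDiffOn ℝ 1 A Ω) {c : Plane} {ρ : ℝ} (hρ : 0 ≤ ρ)
    (hB : Metric.closedBall c ρ ⊆ Ω) :
    ρ * ∫ θ in (0 : ℝ)..(2 * Real.pi), tangential A c ρ θ = ∫ x in Metric.ball c ρ, curl A x := by
  classical
  have hcl : closedAnnulus c 0 ρ ⊆ Ω := fun x hx => hB hx.2
  have hball : ∫ x in Metric.ball c ρ, curl A x = ∫ x in annulus c 0 ρ, curl A x := by
    refine setIntegral_congr_set ?_
    have : annulus c 0 ρ = Metric.ball c ρ \ {c} := by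
      ext x
      simp only [annulus, Set.mem_ofPred_eq, Set.mem_sdiff, Metric.mem_ball, Set.mem_singleton_iff,
        dist_pos, and_comm]
    rw [this]
    exact (sdiff_null_ae_eq_self (measure_singleton c)).symm
  rw [hball, integral_annulus le_rfl hρ ((continuousOn_curl hΩ hA).mono hcl)]
  set P : ℝ × ℝ → Plane := fun p => c + p.1 • dir p.2 with hP
  -- In polar coordinates `∂_ρ (ρ A_τ) - ∂_θ A_ρ = ρ curl A`, with `A_τ` and `A_ρ` the tangential
  -- and radial components. In the divergence theorem on the rectangle `(0, ρ) × (0, 2π)` the sides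
  -- `θ = 0` and `θ = 2π` cancel by periodicity, and the side of radius zero contributes nothing.
  set Q : ℝ × ℝ → ℝ := fun p => p.1 * (-A (P p) 0 * Real.sin p.2 + A (P p) 1 * Real.cos p.2) with hQ
  set N : ℝ × ℝ → ℝ := fun p => -(A (P p) 0 * Real.cos p.2 + A (P p) 1 * Real.sin p.2) with hN
  set I : Set (ℝ × ℝ) := Set.Ioo 0 ρ ×ˢ Set.Ioo 0 (2 * Real.pi) with hI
  have hPΩ : ∀ p : ℝ × ℝ, p.1 ∈ Set.Icc 0 ρ → P p ∈ Ω := fun p hp => hB (by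
    rw [Metric.mem_closedBall, dist_add_smul_dir c hp.1]; exact hp.2)
  have hderiv : ∀ p ∈ I, ∃ Q' N' : ℝ × ℝ →L[ℝ] ℝ, HasFDerivAt Q Q' p ∧ HasFDerivAt N N' p ∧
      Q' (1, 0) + N' (0, 1) = p.1 * curl A (P p) := by
    intro p hp
    have hd : ∀ j : Fin 2, HasFDerivAt (fun x => A x j) (fderiv ℝ (fun x => A x j) (P p)) (P p) :=
      fun j => (((contDiffOn_component hA j).contDiffAt
        (hΩ.mem_nhds (hPΩ p ⟨hp.1.1.le, hp.1.2.le⟩))).differentiableAt one_ne_zero).hasFDerivAt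
    have h0 := (hd 0).comp p (hasFDerivAt_polar c p)
    have h1 := (hd 1).comp p (hasFDerivAt_polar c p)
    have hs : HasFDerivAt (fun p : ℝ × ℝ => Real.sin p.2) _ p :=
      (Real.hasDerivAt_sin p.2).hasFDerivAt.comp p hasFDerivAt_snd
    have hc : HasFDerivAt (fun p : ℝ × ℝ => Real.cos p.2) _ p :=
      (Real.hasDerivAt_cos p.2).hasFDerivAt.comp p hasFDerivAt_snd
    refine ⟨_, _, hasFDerivAt_fst.mul ((h0.neg.mul hs).add (h1.mul hc)),
      ((h0.mul hc).add (h1.mul hs)).neg, ?_⟩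
    simp [hP, curl, fderiv_dir, fderiv_ndir]
    linear_combination (-p.1 * partialD 1 (fun y => A y 0) (c + p.1 • dir p.2)
      + p.1 * partialD 0 (fun y => A y 1) (c + p.1 • dir p.2)) * Real.sin_sq_add_cos_sq p.2
  -- The derivatives matter only in the open rectangle. Elsewhere they are chosen so that the
  -- divergence identity holds at every point and can be rewritten under the integral.
  have hex : ∃ Q' N' : ℝ × ℝ → ℝ × ℝ →L[ℝ] ℝ, (∀ p ∈ I, HasFDerivAt Q (Q' p) p) ∧
      (∀ p ∈ I, HasFDerivAt N (N' p) p) ∧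
      ∀ p, Q' p (1, 0) + N' p (0, 1) = p.1 * curl A (P p) := by
    have : ∀ p, ∃ Q' N' : ℝ × ℝ →L[ℝ] ℝ, (p ∈ I → HasFDerivAt Q Q' p) ∧
        (p ∈ I → HasFDerivAt N N' p) ∧ Q' (1, 0) + N' (0, 1) = p.1 * curl A (P p) := by
      intro p
      by_cases hp : p ∈ I
      · obtain ⟨Q', N', h⟩ := hderiv p hp
        exact ⟨Q', N', fun _ => h.1, fun _ => h.2.1, h.2.2⟩
      · exact ⟨(p.1 * curl A (P p)) • ContinuousLinearMap.fst ℝ ℝ ℝ, 0, fun h => absurd h hp,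
          fun h => absurd h hp, by simp⟩
    choose Q' N' h1 h2 h3 using this
    exact ⟨Q', N', h1, h2, h3⟩
  obtain ⟨Q', N', hQ', hN', hdiv⟩ := hex
  have hpi : (0 : ℝ) ≤ 2 * Real.pi := by positivity
  have hcomp : ∀ j : Fin 2, ContinuousOn (fun p : ℝ × ℝ => A (P p) j)
      (Set.uIcc 0 ρ ×ˢ Set.uIcc 0 (2 * Real.pi)) := fun j => by
    refine (contDiffOn_component hA j).continuousOn.comp (continuous_polar c).continuousOn ?_
    intro p hp
    rw [Set.uIcc_of_le hρ] at hp
    exact hPΩ p hp.1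
  have hQc : ContinuousOn Q (Set.uIcc 0 ρ ×ˢ Set.uIcc 0 (2 * Real.pi)) := by
    have := hcomp 0; have := hcomp 1
    refine continuousOn_fst.mul (ContinuousOn.add (ContinuousOn.mul (hcomp 0).neg ?_)
      ((hcomp 1).mul ?_)) <;> fun_prop
  have hNc : ContinuousOn N (Set.uIcc 0 ρ ×ˢ Set.uIcc 0 (2 * Real.pi)) := by
    refine (ContinuousOn.add ((hcomp 0).mul ?_) ((hcomp 1).mul ?_)).neg <;> fun_prop
  have hcurl : ContinuousOn (fun p : ℝ × ℝ => p.1 * curl A (P p))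
      (Set.uIcc 0 ρ ×ˢ Set.uIcc 0 (2 * Real.pi)) := by
    refine continuousOn_fst.mul ((continuousOn_curl hΩ hA).comp (continuous_polar c).continuousOn ?_)
    intro p hp
    rw [Set.uIcc_of_le hρ] at hp
    exact hPΩ p hp.1
  have key := integral2_divergence_prod_of_hasFDerivAt_off_countable Q N Q' N' 0 0 ρ (2 * Real.pi)
    ∅ Set.countable_empty hQc hNc
    (by rw [min_eq_left hρ, max_eq_right hρ, min_eq_left hpi, max_eq_right hpi, Set.sdiff_empty]
        exact hQ')
    (by rw [min_eq_left hρ, max_eq_right hρ, min_eq_left hpi, max_eq_right hpi, Set.sdiff_empty]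
        exact hN')
    (by simp only [hdiv]
        exact hcurl.integrableOn_compact (isCompact_uIcc.prod isCompact_uIcc))
  simp only [hdiv] at key
  have hN2 : ∀ x, N (x, 2 * Real.pi) = N (x, 0) := fun x => by
    have : dir (2 * Real.pi) = dir 0 := by have := dir_periodic 0; rwa [zero_add] at this
    simp [hN, hP, this]
  simp only [hN2, sub_self, zero_add] at key
  have hQ0 : ∫ y in (0 : ℝ)..(2 * Real.pi), Q (0, y) = 0 := by simp [hQ]
  have hQρ : ∫ y in (0 : ℝ)..(2 * Real.pi), Q (ρ, y)
      = ρ * ∫ θ in (0 : ℝ)..(2 * Real.pi), tangential A c ρ θ := by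
    rw [← intervalIntegral.integral_const_mul]; rfl
  rw [hQ0, hQρ, sub_zero] at key
  rw [← key]
  refine intervalIntegral.integral_congr fun r _ => ?_
  simp only [intervalIntegral.integral_const_mul]
  rfl

/-- The circulation on a circle is controlled by the square integral of the curl. -/
lemma sq_circulation_le (hΩ : IsOpen Ω) (hA : ContDiffOn ℝ 1 A Ω) {c : Plane} {ρ : ℝ} (hρ : 0 ≤ ρ)
    (hB : Metric.closedBall c ρ ⊆ Ω) :
    (ρ * ∫ θ in (0 : ℝ)..(2 * Real.pi), tangential A c ρ θ) ^ 2
      ≤ Real.pi * ρ ^ 2 * ∫ x in Metric.ball c ρ, curl A x ^ 2 := by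
  rw [green_disc hΩ hA hρ hB, ← volume_ball_real c hρ]
  have hc := (continuousOn_curl hΩ hA).mono hB
  refine sq_integral_le measure_ball_lt_top.ne ?_ ?_
  · exact (hc.integrableOn_compact (isCompact_closedBall c ρ)).mono_set Metric.ball_subset_closedBall
  · exact ((hc.pow 2).integrableOn_compact (isCompact_closedBall c ρ)).mono_set
      Metric.ball_subset_closedBall

end Green

end VortexBalls

namespace VortexBalls

open MeasureTheory

/-! ### Lower bounds on circles and annuli -/

section Algebra

lemma sum_norm_sub_sq (v₀ v₁ U : ℂ) (g s c : ℝ) (h : s ^ 2 + c ^ 2 = 1) :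
    ‖v₀ - Complex.I * ((g * -s : ℝ) : ℂ) * U‖ ^ 2 + ‖v₁ - Complex.I * ((g * c : ℝ) : ℂ) * U‖ ^ 2 =
      (‖v₀‖ ^ 2 + ‖v₁‖ ^ 2) - 2 * g * ((-s * v₀ + c * v₁) * (starRingEnd ℂ) U).im
        + g ^ 2 * ‖U‖ ^ 2 := by
  simp only [Complex.sq_norm, Complex.normSq_apply]
  simp
  linear_combination (g ^ 2 * (U.re ^ 2 + U.im ^ 2)) * h

/-- Rotating the frame splits the squared gradient into a tangential and a normal part, and the
normal part is dropped. -/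
lemma sq_im_le (v₀ v₁ U : ℂ) (s c : ℝ) (h : s ^ 2 + c ^ 2 = 1) :
    ((-s * v₀ + c * v₁) * (starRingEnd ℂ) U).im ^ 2 ≤ ‖U‖ ^ 2 * (‖v₀‖ ^ 2 + ‖v₁‖ ^ 2) := by
  have h1 : ((-s * v₀ + c * v₁) * (starRingEnd ℂ) U).im ^ 2 ≤
      ‖(-s * v₀ + c * v₁) * (starRingEnd ℂ) U‖ ^ 2 := by
    rw [← sq_abs]
    exact pow_le_pow_left₀ (abs_nonneg _) (Complex.abs_im_le_norm _) 2
  rw [norm_mul, RCLike.norm_conj, mul_pow] at h1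
  rw [mul_comm (‖U‖ ^ 2)]
  refine h1.trans (mul_le_mul_of_nonneg_right ?_ (sq_nonneg _))
  have h2 : ‖v₀‖ ^ 2 + ‖v₁‖ ^ 2 = ‖-s * v₀ + c * v₁‖ ^ 2 + ‖c * v₀ + s * v₁‖ ^ 2 := by
    simp only [Complex.sq_norm, Complex.normSq_apply]
    simp
    linear_combination -(v₀.re ^ 2 + v₀.im ^ 2 + v₁.re ^ 2 + v₁.im ^ 2) * h
  rw [h2]
  linarith [sq_nonneg ‖c * v₀ + s * v₁‖]

/-- The right-hand side is `f² (h²/2 - (h - g)²/18)`. For `f = 1` the two sides differ by the square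
`(4/9) (h - g)²`; the term with `|1 - f²|` pays for the deviation of the modulus from one. -/
lemma modulus_defect {f : ℝ} (h1 : 1 / 2 ≤ f) (h2 : f ≤ 3 / 2) (g h : ℝ) :
    g * h - g ^ 2 / 2 - 9 / 4 * g ^ 2 * |1 - f ^ 2| ≤
      f ^ 2 * (4 / 9 * h ^ 2 + 1 / 9 * (g * h) - g ^ 2 / 18) := by
  have hs1 : 1 / 4 ≤ f ^ 2 := by nlinarith
  have hs2 : f ^ 2 ≤ 9 / 4 := by nlinarith
  generalize f ^ 2 = s at hs1 hs2
  have key : 0 ≤ 16 / 9 * s * (1 / 2 - s / 18 + 9 / 4 * |1 - s|) - (1 - s / 9) ^ 2 := by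
    rcases le_total s 1 with hs | hs
    · rw [abs_of_nonneg (by linarith)]; nlinarith
    · rw [abs_of_nonpos (by linarith)]; nlinarith
  -- The factor `16 s / 9` completes the square in `h`; what remains is `g²` times the one-variable
  -- inequality `key`.
  have h3 : 0 ≤ (16 / 9 * s) * (s * (4 / 9 * h ^ 2 + 1 / 9 * (g * h) - g ^ 2 / 18) -
      (g * h - g ^ 2 / 2 - 9 / 4 * g ^ 2 * |1 - s|)) := by
    have : (16 / 9 * s) * (s * (4 / 9 * h ^ 2 + 1 / 9 * (g * h) - g ^ 2 / 18) -
      (g * h - g ^ 2 / 2 - 9 / 4 * g ^ 2 * |1 - s|)) = (8 / 9 * s * h - (1 - s / 9) * g) ^ 2 +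
      g ^ 2 * (16 / 9 * s * (1 / 2 - s / 18 + 9 / 4 * |1 - s|) - (1 - s / 9) ^ 2) := by ring
    rw [this]
    positivity
  have := nonneg_of_mul_nonneg_right h3 (by linarith)
  linarith

/-- Young's inequality with weights adapted to the growth: as the sum of the increments of the radii
is at most `r`, the term with `Z` costs at most `r²/3` times the integral of the squared curl, and
the other term costs a bounded amount of time. -/
lemma curl_young {X Z ρ r b : ℝ} (hρ : 0 < ρ) (hr : 0 < r) (hX : X ^ 2 ≤ Real.pi * ρ ^ 2 * Z) :
    b * X / ρ ≤ 3 * Real.pi / 4 * b ^ 2 / r + r / 3 * Z := by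
  have hpi := Real.pi_pos
  have h1 : X ^ 2 / (Real.pi * ρ ^ 2) ≤ Z := by
    rw [div_le_iff₀ (by positivity)]; linarith
  have h2 : b * X / ρ ≤ 3 * Real.pi / 4 * b ^ 2 / r + r / 3 * (X ^ 2 / (Real.pi * ρ ^ 2)) := by
    have e : 3 * Real.pi / 4 * b ^ 2 / r + r / 3 * (X ^ 2 / (Real.pi * ρ ^ 2)) - b * X / ρ =
        (3 * Real.pi * ρ * b - 2 * r * X) ^ 2 / (12 * Real.pi * r * ρ ^ 2) := by
      field_simp; ring
    have : 0 ≤ (3 * Real.pi * ρ * b - 2 * r * X) ^ 2 / (12 * Real.pi * r * ρ ^ 2) := by positivity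
    linarith
  have : r / 3 * (X ^ 2 / (Real.pi * ρ ^ 2)) ≤ r / 3 * Z := by gcongr
  linarith

end Algebra

section Circle

variable {u : Plane → ℂ} {A : Plane → Plane} {Ω : Set Plane}

/-- The density whose integral is the difference of the two energies. -/
noncomputable def excess (ε : ℝ) (u : Plane → ℂ) (A G : Plane → Plane) (x : Plane) : ℝ :=
  1 / 2 * (covGradSq u A x + potential ε u x) - 1 / 18 * (covGradSq u (A + G) x + potential ε u x)

/-- The gauge invariant angular derivative of the phase on the circle of radius `ρ` about `c`. -/
noncomputable def phaseDeriv (u : Plane → ℂ) (A : Plane → Plane) (c : Plane) (ρ θ : ℝ) : ℝ :=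
  (deriv (fun t => u ((Disc.mk c ρ).bdryPoint t)) θ / u ((Disc.mk c ρ).bdryPoint θ)).im / ρ
    - tangential A c ρ θ

lemma deriv_bdry (hΩ : IsOpen Ω) (hu : ContDiffOn ℝ 1 u Ω) {c : Plane} {ρ θ : ℝ}
    (hx : c + ρ • dir θ ∈ Ω) :
    deriv (fun t => u ((Disc.mk c ρ).bdryPoint t)) θ =
      ρ * (-Real.sin θ * partialD 0 u (c + ρ • dir θ) + Real.cos θ * partialD 1 u (c + ρ • dir θ)) := by
  have h1 : HasFDerivAt u (fderiv ℝ u (c + ρ • dir θ)) (c + ρ • dir θ) :=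
    ((hu.contDiffAt (hΩ.mem_nhds hx)).differentiableAt one_ne_zero).hasFDerivAt
  have h2 := h1.comp_hasDerivAt_of_eq θ (hasDerivAt_bdryPoint ⟨c, ρ⟩ θ) rfl
  rw [show (fun t => u ((Disc.mk c ρ).bdryPoint t)) = u ∘ (Disc.mk c ρ).bdryPoint from rfl, h2.deriv]
  have : (ρ • (!₂[-Real.sin θ, Real.cos θ] : Plane)) = ρ • ndir θ := rfl
  rw [this, map_smul, fderiv_ndir]
  simp
  ring

lemma im_tangential (hΩ : IsOpen Ω) (hu : ContDiffOn ℝ 1 u Ω) {c : Plane} {ρ θ : ℝ} (hρ : 0 < ρ)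
    (hx : c + ρ • dir θ ∈ Ω) (h0 : u (c + ρ • dir θ) ≠ 0) :
    ((-Real.sin θ * (partialD 0 u (c + ρ • dir θ) - Complex.I * (A (c + ρ • dir θ) 0 : ℂ)
        * u (c + ρ • dir θ)) + Real.cos θ * (partialD 1 u (c + ρ • dir θ) - Complex.I *
        (A (c + ρ • dir θ) 1 : ℂ) * u (c + ρ • dir θ))) * (starRingEnd ℂ) (u (c + ρ • dir θ))).im =
      ‖u (c + ρ • dir θ)‖ ^ 2 * phaseDeriv u A c ρ θ := by
  rw [phaseDeriv, deriv_bdry hΩ hu hx, tangential]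
  change _ = ‖u (c + ρ • dir θ)‖ ^ 2 * ((_ / u (c + ρ • dir θ)).im / ρ - _)
  set x := c + ρ • dir θ
  set U := u x
  set P := partialD 0 u x
  set Q := partialD 1 u x
  generalize Real.sin θ = s
  generalize Real.cos θ = k
  have hU : ‖U‖ ^ 2 ≠ 0 := pow_ne_zero 2 (norm_ne_zero_iff.2 h0)
  have hdiv : ∀ z : ℂ, ‖U‖ ^ 2 * (z / U).im = (z * (starRingEnd ℂ) U).im := fun z => by
    have h1 : z * (starRingEnd ℂ) U = ((‖U‖ ^ 2 : ℝ) : ℂ) * (z / U) := by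
      have := Complex.mul_conj' U
      push_cast
      rw [← this]
      field_simp
    rw [h1, Complex.im_ofReal_mul]
  rw [mul_sub (‖U‖ ^ 2), ← mul_div_assoc, hdiv, Complex.sq_norm, Complex.normSq_apply]
  simp
  field_simp
  ring

lemma covGradSq_eq (u : Plane → ℂ) (B : Plane → Plane) (x : Plane) :
    covGradSq u B x = ‖partialD 0 u x - Complex.I * (B x 0 : ℂ) * u x‖ ^ 2 +
      ‖partialD 1 u x - Complex.I * (B x 1 : ℂ) * u x‖ ^ 2 := by
  rw [covGradSq, Fin.sum_univ_two]

lemma covGradSq_nonneg (u : Plane → ℂ) (B : Plane → Plane) (x : Plane) : 0 ≤ covGradSq u B x :=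
  Finset.sum_nonneg fun _ _ => sq_nonneg _

lemma potential_nonneg (ε : ℝ) (u : Plane → ℂ) (x : Plane) : 0 ≤ potential ε u x := by
  unfold potential; positivity

lemma sq_phaseDeriv_le (hΩ : IsOpen Ω) (hu : ContDiffOn ℝ 1 u Ω) {c : Plane} {ρ θ : ℝ}
    (hρ : 0 < ρ) (hx : c + ρ • dir θ ∈ Ω) (h0 : u (c + ρ • dir θ) ≠ 0) :
    ‖u (c + ρ • dir θ)‖ ^ 2 * phaseDeriv u A c ρ θ ^ 2 ≤ covGradSq u A (c + ρ • dir θ) := by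
  have h1 := sq_im_le (partialD 0 u (c + ρ • dir θ) - Complex.I * (A (c + ρ • dir θ) 0 : ℂ)
        * u (c + ρ • dir θ)) (partialD 1 u (c + ρ • dir θ) - Complex.I *
        (A (c + ρ • dir θ) 1 : ℂ) * u (c + ρ • dir θ)) (u (c + ρ • dir θ)) (Real.sin θ) (Real.cos θ)
        (Real.sin_sq_add_cos_sq θ)
  rw [im_tangential hΩ hu hρ hx h0, ← covGradSq_eq, mul_pow, pow_two (‖_‖ ^ 2), mul_assoc] at h1
  have : 0 < ‖u (c + ρ • dir θ)‖ ^ 2 := pow_pos (norm_pos_iff.2 h0) 2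
  exact le_of_mul_le_mul_left h1 this

/-- After expansion of the shifted energy the coefficient of `|∇_A u|²` is `1/2 - 1/18 = 4/9 > 0`,
so this term may be replaced by its tangential part `|u|² h²` before `modulus_defect` is applied. -/
lemma excess_ge (hΩ : IsOpen Ω) (hu : ContDiffOn ℝ 1 u Ω) {c : Plane} {ρ θ ε g : ℝ}
    {G : Plane → Plane} (hρ : 0 < ρ) (hx : c + ρ • dir θ ∈ Ω)
    (hf1 : 1 / 2 ≤ ‖u (c + ρ • dir θ)‖) (hf2 : ‖u (c + ρ • dir θ)‖ ≤ 3 / 2)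
    (hG : G (c + ρ • dir θ) = g • ndir θ) :
    g * phaseDeriv u A c ρ θ - g ^ 2 / 2 - (9 / 4 * g ^ 2 * |1 - ‖u (c + ρ • dir θ)‖ ^ 2|
      - 4 / 9 * potential ε u (c + ρ • dir θ)) ≤ excess ε u A G (c + ρ • dir θ) := by
  have h0 : u (c + ρ • dir θ) ≠ 0 := norm_pos_iff.1 (by linarith)
  have h1 := sq_phaseDeriv_le (A := A) hΩ hu hρ hx h0
  have h2 := im_tangential (A := A) hΩ hu hρ hx h0
  have h3 := modulus_defect hf1 hf2 g (phaseDeriv u A c ρ θ)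
  have h4 := sum_norm_sub_sq (partialD 0 u (c + ρ • dir θ) - Complex.I * (A (c + ρ • dir θ) 0 : ℂ)
        * u (c + ρ • dir θ)) (partialD 1 u (c + ρ • dir θ) - Complex.I *
        (A (c + ρ • dir θ) 1 : ℂ) * u (c + ρ • dir θ)) (u (c + ρ • dir θ)) g (Real.sin θ) (Real.cos θ)
        (Real.sin_sq_add_cos_sq θ)
  rw [h2, ← covGradSq_eq] at h4
  have h5 : covGradSq u (A + G) (c + ρ • dir θ) = covGradSq u A (c + ρ • dir θ) - 2 * g *
      (‖u (c + ρ • dir θ)‖ ^ 2 * phaseDeriv u A c ρ θ) + g ^ 2 * ‖u (c + ρ • dir θ)‖ ^ 2 := by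
    rw [← h4, covGradSq_eq]
    simp only [Pi.add_apply, PiLp.add_apply, hG, PiLp.smul_apply, ndir_zero, ndir_one, smul_eq_mul]
    congr 3 <;> push_cast <;> ring
  rw [excess, h5]
  nlinarith

lemma continuousOn_covGradSq {S : Set Plane} {B : Plane → Plane} (hΩ : IsOpen Ω)
    (hu : ContDiffOn ℝ 1 u Ω) (hS : S ⊆ Ω) (hB : ContinuousOn B S) :
    ContinuousOn (covGradSq u B) S := by
  have h0 := (continuousOn_partialD hΩ hu 0).mono hS
  have h1 := (continuousOn_partialD hΩ hu 1).mono hS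
  have h2 := hu.continuousOn.mono hS
  have hB0 : ContinuousOn (fun x => (B x 0 : ℂ)) S := by fun_prop
  have hB1 : ContinuousOn (fun x => (B x 1 : ℂ)) S := by fun_prop
  have h3 : ContinuousOn (fun x => Complex.I * (B x 0 : ℂ) * u x) S :=
    (continuousOn_const.mul hB0).mul h2
  have h4 : ContinuousOn (fun x => Complex.I * (B x 1 : ℂ) * u x) S :=
    (continuousOn_const.mul hB1).mul h2
  rw [funext (covGradSq_eq u B)]
  exact ((h0.sub h3).norm.pow 2).add ((h1.sub h4).norm.pow 2)

lemma continuousOn_potential {S : Set Plane} (ε : ℝ) (hu : ContinuousOn u S) :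
    ContinuousOn (potential ε u) S := by
  unfold potential; fun_prop

lemma continuous_tangential_circle (hA : ContinuousOn A Ω) {c : Plane} {ρ : ℝ}
    (hc : ∀ θ, c + ρ • dir θ ∈ Ω) : Continuous (tangential A c ρ) := by
  have hp : Continuous fun θ => c + ρ • dir θ := by have := continuous_dir; fun_prop
  have h : Continuous fun θ => A (c + ρ • dir θ) := hA.comp_continuous hp hc
  have h0 : Continuous fun θ => A (c + ρ • dir θ) 0 := (PiLp.continuous_apply 2 _ 0).comp h
  have h1 : Continuous fun θ => A (c + ρ • dir θ) 1 := (PiLp.continuous_apply 2 _ 1).comp h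
  exact (h0.neg.mul Real.continuous_sin).add (h1.mul Real.continuous_cos)

lemma continuous_phaseDeriv (hΩ : IsOpen Ω) (hu : ContDiffOn ℝ 1 u Ω) (hA : ContinuousOn A Ω)
    {c : Plane} {ρ : ℝ} (hc : ∀ θ, c + ρ • dir θ ∈ Ω) (h0 : ∀ θ, u (c + ρ • dir θ) ≠ 0) :
    Continuous (phaseDeriv u A c ρ) := by
  have h1 : ContDiff ℝ 1 fun t => u ((Disc.mk c ρ).bdryPoint t) := contDiff_comp_bdry hΩ hu hc
  have h2 := h1.continuous_deriv le_rfl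
  exact ((Complex.continuous_im.comp (h2.div h1.continuous h0)).div_const ρ).sub
    (continuous_tangential_circle hA hc)

lemma integral_phaseDeriv (hΩ : IsOpen Ω) (hu : ContDiffOn ℝ 1 u Ω) (hA : ContinuousOn A Ω)
    {c : Plane} {ρ : ℝ} (hρ : 0 < ρ) (hc : ∀ θ, c + ρ • dir θ ∈ Ω)
    (h0 : ∀ θ, u (c + ρ • dir θ) ≠ 0) :
    ρ * ∫ θ in (0 : ℝ)..(2 * Real.pi), phaseDeriv u A c ρ θ =
      2 * Real.pi * deg u ⟨c, ρ⟩ - ρ * ∫ θ in (0 : ℝ)..(2 * Real.pi), tangential A c ρ θ := by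
  have h1 : ContDiff ℝ 1 fun t => u ((Disc.mk c ρ).bdryPoint t) := contDiff_comp_bdry hΩ hu hc
  have h2 := h1.continuous_deriv le_rfl
  have h3 := continuous_tangential_circle hA hc
  have h4 : Continuous fun θ => (deriv (fun t => u ((Disc.mk c ρ).bdryPoint t)) θ /
    u ((Disc.mk c ρ).bdryPoint θ)).im := Complex.continuous_im.comp (h2.div h1.continuous h0)
  unfold phaseDeriv
  rw [intervalIntegral.integral_sub ((h4.div_const ρ).intervalIntegrable _ _)
    (h3.intervalIntegrable _ _), intervalIntegral.integral_div, deg, mul_sub,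
    mul_div_cancel₀ _ hρ.ne', ← mul_assoc, mul_inv_cancel₀ (by positivity), one_mul]

/-- As `g = d β / ρ` is constant on the circle, only the integral of the phase derivative enters,
that is `2π d` minus the circulation. The parameters `m₁` and `m₂` leave open how the modulus error
is paid for, because the two phases do it differently. -/
lemma circle_excess (hΩ : IsOpen Ω) (hu : ContDiffOn ℝ 1 u Ω) (hA : ContDiffOn ℝ 1 A Ω) {c : Plane}
    {ρ q ε β d r m₁ m₂ : ℝ} {G : Plane → Plane} (hρ : 0 < ρ) (hρq : ρ ≤ q)
    (hq : Metric.closedBall c q ⊆ Ω) (hr : 0 < r) (hβ0 : 0 ≤ β) (hβ1 : β ≤ 1) (hm₁ : 0 ≤ m₁)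
    (hd : deg u ⟨c, ρ⟩ = d)
    (hf : ∀ θ, 1 / 2 ≤ ‖u (c + ρ • dir θ)‖ ∧ ‖u (c + ρ • dir θ)‖ ≤ 3 / 2)
    (hm : ∀ θ, 9 / 4 * (d * β / ρ) ^ 2 * |1 - ‖u (c + ρ • dir θ)‖ ^ 2|
      - 4 / 9 * potential ε u (c + ρ • dir θ) ≤ m₁ * (d * β / ρ) ^ 4 * ε ^ 2
        + m₂ * (d * β / ρ) ^ 2)
    (hG : ∀ θ, G (c + ρ • dir θ) = (d * β / ρ) • ndir θ)
    (hGc : Continuous fun θ => excess ε u A G (c + ρ • dir θ)) :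
    (Real.pi * (2 * β - β ^ 2) * d ^ 2 - 2 * Real.pi * m₂ * β ^ 2 * d ^ 2) / ρ
      - (3 * Real.pi / 4 * β ^ 2 * d ^ 2 / r + r / 3 * ∫ x in Metric.ball c q, curl A x ^ 2)
      - 2 * Real.pi * m₁ * β ^ 2 * d ^ 4 * ε ^ 2 / ρ ^ 3
    ≤ ρ * ∫ θ in (0 : ℝ)..(2 * Real.pi), excess ε u A G (c + ρ • dir θ) := by
  have hpi := Real.pi_pos
  have hΩc : ∀ θ, c + ρ • dir θ ∈ Ω := fun θ => hq (by
    rw [Metric.mem_closedBall, dist_add_smul_dir c hρ.le]; exact hρq)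
  have h0 : ∀ θ, u (c + ρ • dir θ) ≠ 0 := fun θ => norm_pos_iff.1 (by linarith [(hf θ).1])
  set g := d * β / ρ with hg
  have hph := continuous_phaseDeriv (A := A) hΩ hu hA.continuousOn hΩc h0
  have h1 : ∫ θ in (0 : ℝ)..(2 * Real.pi), (g * phaseDeriv u A c ρ θ
      - (g ^ 2 / 2 + m₁ * g ^ 4 * ε ^ 2 + m₂ * g ^ 2)) ≤
      ∫ θ in (0 : ℝ)..(2 * Real.pi), excess ε u A G (c + ρ • dir θ) := by
    refine intervalIntegral.integral_mono_on (by positivity)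
      (((hph.const_mul g).sub continuous_const).intervalIntegrable _ _)
      (hGc.intervalIntegrable _ _) fun θ _ => ?_
    have := excess_ge (A := A) (ε := ε) hΩ hu hρ (hΩc θ) (hf θ).1 (hf θ).2 (hG θ)
    linarith [hm θ]
  rw [intervalIntegral.integral_sub ((hph.const_mul g).intervalIntegrable _ _)
    (continuous_const.intervalIntegrable _ _), intervalIntegral.integral_const_mul,
    intervalIntegral.integral_const, sub_zero, smul_eq_mul] at h1
  have h2 := integral_phaseDeriv (A := A) hΩ hu hA.continuousOn hρ hΩc h0
  rw [hd] at h2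
  set J := ∫ θ in (0 : ℝ)..(2 * Real.pi), phaseDeriv u A c ρ θ
  set X := ρ * ∫ θ in (0 : ℝ)..(2 * Real.pi), tangential A c ρ θ
  have hsub : Metric.closedBall c ρ ⊆ Ω := (Metric.closedBall_subset_closedBall hρq).trans hq
  have hX : X ^ 2 ≤ Real.pi * ρ ^ 2 * ∫ x in Metric.ball c q, curl A x ^ 2 := by
    refine (sq_circulation_le hΩ hA hρ.le hsub).trans ?_
    refine mul_le_mul_of_nonneg_left ?_ (by positivity)
    refine setIntegral_mono_set ?_ (ae_of_all _ fun x => sq_nonneg _)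
      (Metric.ball_subset_ball hρq).eventuallyLE
    exact ((((continuousOn_curl hΩ hA).mono hq).pow 2).integrableOn_compact
      (isCompact_closedBall c q)).mono_set Metric.ball_subset_closedBall
  set Z := ∫ x in Metric.ball c q, curl A x ^ 2
  have h3 := curl_young (b := d * β) hρ hr hX
  have h4 := mul_le_mul_of_nonneg_left h1 hρ.le
  refine le_trans ?_ h4
  have e1 : ρ * (g * J - 2 * Real.pi * (g ^ 2 / 2 + m₁ * g ^ 4 * ε ^ 2 + m₂ * g ^ 2)) =
      g * (2 * Real.pi * d - X) - 2 * Real.pi * ρ * (g ^ 2 / 2 + m₁ * g ^ 4 * ε ^ 2 + m₂ * g ^ 2) := by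
    rw [← h2]; ring
  rw [e1]
  have e2 : g * (2 * Real.pi * d - X) - 2 * Real.pi * ρ * (g ^ 2 / 2 + m₁ * g ^ 4 * ε ^ 2 + m₂ * g ^ 2)
      = (Real.pi * (2 * β - β ^ 2) * d ^ 2 - 2 * Real.pi * m₂ * β ^ 2 * d ^ 2) / ρ - d * β * X / ρ
        - 2 * Real.pi * m₁ * β ^ 4 * d ^ 4 * ε ^ 2 / ρ ^ 3 := by
    rw [hg]; field_simp; ring
  rw [e2]
  have e3 : 2 * Real.pi * m₁ * β ^ 4 * d ^ 4 * ε ^ 2 / ρ ^ 3 ≤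
      2 * Real.pi * m₁ * β ^ 2 * d ^ 4 * ε ^ 2 / ρ ^ 3 := by
    have : β ^ 4 ≤ β ^ 2 := pow_le_pow_of_le_one hβ0 hβ1 (by norm_num)
    gcongr
  have e4 : 3 * Real.pi / 4 * (d * β) ^ 2 / r = 3 * Real.pi / 4 * β ^ 2 * d ^ 2 / r := by ring
  rw [e4] at h3
  linarith

lemma continuousOn_tangent (c : Plane) : ContinuousOn (fun x => tangent c x) {c}ᶜ := by
  have h : ContinuousOn (fun x : Plane => (dist x c)⁻¹) {c}ᶜ :=
    ContinuousOn.inv₀ (by fun_prop) fun x hx => dist_ne_zero.2 hx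
  unfold tangent
  refine h.smul (Continuous.continuousOn ?_)
  have : (fun x : Plane => (!₂[-(x 1 - c 1), x 0 - c 0] : Plane)) = fun x : Plane =>
      (-(x 1 - c 1)) • (EuclideanSpace.single 0 1 : Plane)
        + (x 0 - c 0) • (EuclideanSpace.single 1 1 : Plane) := by
    funext x; apply plane_ext <;> simp
  rw [this]
  fun_prop

lemma tangent_eq {c : Plane} {ρ : ℝ} (hρ : 0 < ρ) (θ : ℝ) :
    tangent c (c + ρ • dir θ) = ndir θ := by
  rw [tangent, dist_add_smul_dir c hρ.le]
  apply plane_ext <;> simp <;> field_simp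

/-- The field `(d β / |x - c|) τ`. -/
noncomputable def radialField (c : Plane) (g : ℝ) (x : Plane) : Plane :=
  (g / dist x c) • tangent c x

lemma continuousOn_radialField (c : Plane) (g : ℝ) : ContinuousOn (radialField c g) {c}ᶜ := by
  have h : ContinuousOn (fun x : Plane => g / dist x c) {c}ᶜ :=
    continuousOn_const.div (by fun_prop) fun x hx => dist_ne_zero.2 hx
  exact h.smul (continuousOn_tangent c)

lemma continuousOn_excess {S : Set Plane} {G : Plane → Plane} (ε : ℝ) (hΩ : IsOpen Ω)
    (hu : ContDiffOn ℝ 1 u Ω) (hS : S ⊆ Ω) (hA : ContinuousOn A S) (hG : ContinuousOn G S) :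
    ContinuousOn (excess ε u A G) S := by
  have h1 := continuousOn_covGradSq hΩ hu hS hA
  have h2 := continuousOn_covGradSq hΩ hu hS (hA.add hG)
  have h3 := continuousOn_potential ε (hu.continuousOn.mono hS)
  exact (continuousOn_const.mul (h1.add h3)).sub (continuousOn_const.mul (h2.add h3))

lemma closedAnnulus_subset_compl {c : Plane} {p q : ℝ} (hp : 0 < p) :
    closedAnnulus c p q ⊆ {c}ᶜ := fun x hx h => by
  have : x = c := h
  subst this
  have := hx.1
  rw [dist_self] at this
  linarith

lemma excess_congr {ε : ℝ} {G G' : Plane → Plane} {x : Plane} (h : G x = G' x) :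
    excess ε u A G x = excess ε u A G' x := by
  simp only [excess, covGradSq, Pi.add_apply, h]

/-- The lower bound on an annulus swept by a growing ball. -/
lemma annulus_excess (hΩ : IsOpen Ω) (hu : ContDiffOn ℝ 1 u Ω) (hA : ContDiffOn ℝ 1 A Ω)
    {c : Plane} {p q ε β d r m₁ m₂ : ℝ} {G : Plane → Plane} (hp : 0 < p) (hpq : p ≤ q)
    (hq : Metric.closedBall c q ⊆ Ω) (hr : 0 < r) (hβ0 : 0 ≤ β) (hβ1 : β ≤ 1) (hm₁ : 0 ≤ m₁)
    (hd : ∀ ρ ∈ Set.Ioo p q, deg u ⟨c, ρ⟩ = d)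
    (hf : ∀ x ∈ annulus c p q, 1 / 2 ≤ ‖u x‖ ∧ ‖u x‖ ≤ 3 / 2)
    (hm : ∀ x ∈ annulus c p q, 9 / 4 * (d * β / dist x c) ^ 2 * |1 - ‖u x‖ ^ 2|
      - 4 / 9 * potential ε u x ≤ m₁ * (d * β / dist x c) ^ 4 * ε ^ 2
        + m₂ * (d * β / dist x c) ^ 2)
    (hG : ∀ x ∈ annulus c p q, G x = (d * β / dist x c) • tangent c x) :
    IntegrableOn (excess ε u A G) (annulus c p q) ∧
    Real.pi * (2 * β - β ^ 2) * d ^ 2 * Real.log (q / p)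
      - (3 * Real.pi / 4 * β ^ 2 * d ^ 2 / r + r / 3 * ∫ x in Metric.ball c q, curl A x ^ 2) * (q - p)
      - Real.pi * β ^ 2 * d ^ 2 * (m₁ * d ^ 2 * ε ^ 2 * ((p ^ 2)⁻¹ - (q ^ 2)⁻¹)
        + 2 * m₂ * Real.log (q / p))
    ≤ ∫ x in annulus c p q, excess ε u A G x := by
  have hpi := Real.pi_pos
  -- `G` is known only on the open annulus. The explicit radial field agrees with it there and is
  -- continuous on the closed annulus, so integrals can be computed on circles.
  set F := excess ε u A (radialField c (d * β)) with hF
  have hcl : closedAnnulus c p q ⊆ Ω := fun x hx => hq hx.2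
  have hFc : ContinuousOn F (closedAnnulus c p q) :=
    continuousOn_excess ε hΩ hu hcl (hA.continuousOn.mono hcl)
      ((continuousOn_radialField c _).mono (closedAnnulus_subset_compl hp))
  have hcongr : Set.EqOn (excess ε u A G) F (annulus c p q) := fun x hx => excess_congr (hG x hx)
  have hmeas := (isOpen_annulus c p q).measurableSet
  refine ⟨(integrableOn_congr_fun hcongr hmeas).2 (integrableOn_annulus hFc), ?_⟩
  rw [setIntegral_congr_fun hmeas hcongr]
  set Z := ∫ x in Metric.ball c q, curl A x ^ 2 with hZ
  set a := Real.pi * (2 * β - β ^ 2) * d ^ 2 - 2 * Real.pi * m₂ * β ^ 2 * d ^ 2 with ha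
  set b := 3 * Real.pi / 4 * β ^ 2 * d ^ 2 / r + r / 3 * Z with hb
  set e := 2 * Real.pi * m₁ * β ^ 2 * d ^ 4 * ε ^ 2 with he
  have hpos : ∀ ρ ∈ Set.uIcc p q, ρ ≠ 0 := fun ρ hρ => by
    rw [Set.uIcc_of_le hpq] at hρ; linarith [hρ.1]
  have hlc : ContinuousOn (fun ρ : ℝ => a / ρ - b - e / ρ ^ 3) (Set.uIcc p q) := by
    refine ((continuousOn_const.div continuousOn_id hpos).sub continuousOn_const).sub
      (continuousOn_const.div (by fun_prop) fun ρ hρ => pow_ne_zero 3 (hpos ρ hρ))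
  have hint : ∫ ρ in p..q, (a / ρ - b - e / ρ ^ 3) =
      a * Real.log (q / p) - b * (q - p) - e / 2 * ((p ^ 2)⁻¹ - (q ^ 2)⁻¹) := by
    have hder : ∀ ρ ∈ Set.uIcc p q, HasDerivAt (fun ρ : ℝ => a * Real.log ρ - b * ρ
        + e / 2 * (ρ ^ 2)⁻¹) (a / ρ - b - e / ρ ^ 3) ρ := fun ρ hρ => by
      have h0 := hpos ρ hρ
      have h1 := ((Real.hasDerivAt_log h0).const_mul a).sub ((hasDerivAt_id ρ).const_mul b)
      have h2 := (((hasDerivAt_pow 2 ρ).inv (pow_ne_zero 2 h0)).const_mul (e / 2))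
      refine (h1.add h2).congr_deriv ?_
      field_simp
      ring
    rw [intervalIntegral.integral_eq_sub_of_hasDerivAt hder (hlc.intervalIntegrable),
      Real.log_div (by linarith) (by linarith)]
    ring
  have hmain := le_integral_annulus hp.le hpq hFc hlc.intervalIntegrable (fun ρ hρ => by
    have hρ0 : 0 < ρ := hp.trans hρ.1
    have hmem : ∀ θ, c + ρ • dir θ ∈ annulus c p q := fun θ => by
      simp only [annulus, Set.mem_ofPred_eq, dist_add_smul_dir c hρ0.le]; exact hρ
    have hdist : ∀ θ, dist (c + ρ • dir θ) c = ρ := fun θ => dist_add_smul_dir c hρ0.le θ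
    refine circle_excess (d := d) (β := β) (r := r) (m₁ := m₁) (m₂ := m₂) hΩ hu hA hρ0 hρ.2.le hq hr
      hβ0 hβ1 hm₁ (hd ρ hρ) (fun θ => hf _ (hmem θ)) (fun θ => ?_) (fun θ => ?_) ?_
    · have := hm _ (hmem θ)
      rwa [hdist] at this
    · rw [radialField, hdist, tangent_eq hρ0]
    · have hp : Continuous fun θ => c + ρ • dir θ := by have := continuous_dir; fun_prop
      exact hFc.comp_continuous hp fun θ => annulus_subset _ _ _ (hmem θ))
  rw [hint] at hmain
  refine le_trans (le_of_eq ?_) hmain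
  rw [ha, he]
  ring

/-- The covariant energy of an annulus on which `u` has a non-zero degree. -/
lemma annulus_covGradSq (hΩ : IsOpen Ω) (hu : ContDiffOn ℝ 1 u Ω) (hA : ContDiffOn ℝ 1 A Ω)
    {c : Plane} {p q d : ℝ} (hp : 0 < p) (hpq : p ≤ q) (hq : Metric.closedBall c q ⊆ Ω)
    (hd : ∀ ρ ∈ Set.Ioo p q, deg u ⟨c, ρ⟩ = d)
    (hf : ∀ x ∈ annulus c p q, 1 / 2 ≤ ‖u x‖) :
    Real.pi / 4 * d ^ 2 * Real.log (q / p)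
      - (q ^ 2 - p ^ 2) / 16 * ∫ x in Metric.ball c q, curl A x ^ 2
    ≤ ∫ x in annulus c p q, covGradSq u A x := by
  have hpi := Real.pi_pos
  have hcl : closedAnnulus c p q ⊆ Ω := fun x hx => hq hx.2
  have hFc : ContinuousOn (covGradSq u A) (closedAnnulus c p q) :=
    continuousOn_covGradSq hΩ hu hcl (hA.continuousOn.mono hcl)
  set Z := ∫ x in Metric.ball c q, curl A x ^ 2 with hZ
  have hpos : ∀ ρ ∈ Set.uIcc p q, ρ ≠ 0 := fun ρ hρ => by
    rw [Set.uIcc_of_le hpq] at hρ; linarith [hρ.1]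
  have hlc : ContinuousOn (fun ρ : ℝ => Real.pi / 4 * d ^ 2 / ρ - ρ / 8 * Z) (Set.uIcc p q) :=
    (continuousOn_const.div continuousOn_id hpos).sub (by fun_prop)
  have hint : ∫ ρ in p..q, (Real.pi / 4 * d ^ 2 / ρ - ρ / 8 * Z) =
      Real.pi / 4 * d ^ 2 * Real.log (q / p) - (q ^ 2 - p ^ 2) / 16 * Z := by
    have hder : ∀ ρ ∈ Set.uIcc p q, HasDerivAt (fun ρ : ℝ => Real.pi / 4 * d ^ 2 * Real.log ρ
        - ρ ^ 2 / 16 * Z) (Real.pi / 4 * d ^ 2 / ρ - ρ / 8 * Z) ρ := fun ρ hρ => by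
      have h0 := hpos ρ hρ
      refine (((Real.hasDerivAt_log h0).const_mul (Real.pi / 4 * d ^ 2)).sub
        (((hasDerivAt_pow 2 ρ).div_const 16).mul_const Z)).congr_deriv ?_
      field_simp
      ring
    rw [intervalIntegral.integral_eq_sub_of_hasDerivAt hder (hlc.intervalIntegrable),
      Real.log_div (by linarith) (by linarith)]
    ring
  have hmain := le_integral_annulus hp.le hpq hFc hlc.intervalIntegrable (fun ρ hρ => by
    have hρ0 : 0 < ρ := hp.trans hρ.1
    have hmem : ∀ θ, c + ρ • dir θ ∈ annulus c p q := fun θ => by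
      simp only [annulus, Set.mem_ofPred_eq, dist_add_smul_dir c hρ0.le]; exact hρ
    have hΩc : ∀ θ, c + ρ • dir θ ∈ Ω := fun θ => hcl (annulus_subset _ _ _ (hmem θ))
    have h0 : ∀ θ, u (c + ρ • dir θ) ≠ 0 := fun θ =>
      norm_pos_iff.1 (by linarith [hf _ (hmem θ)])
    have hph := continuous_phaseDeriv (A := A) hΩ hu hA.continuousOn hΩc h0
    have h2 := integral_phaseDeriv (A := A) hΩ hu hA.continuousOn hρ0 hΩc h0
    rw [hd ρ hρ] at h2
    set X := ρ * ∫ θ in (0 : ℝ)..(2 * Real.pi), tangential A c ρ θ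
    set J := ∫ θ in (0 : ℝ)..(2 * Real.pi), phaseDeriv u A c ρ θ with hJ
    have hX : X ^ 2 ≤ Real.pi * ρ ^ 2 * Z := by
      refine (sq_circulation_le hΩ hA hρ0.le
        ((Metric.closedBall_subset_closedBall hρ.2.le).trans hq)).trans ?_
      refine mul_le_mul_of_nonneg_left ?_ (by positivity)
      refine setIntegral_mono_set ?_ (ae_of_all _ fun x => sq_nonneg _)
        (Metric.ball_subset_ball hρ.2.le).eventuallyLE
      exact ((((continuousOn_curl hΩ hA).mono hq).pow 2).integrableOn_compact
        (isCompact_closedBall c q)).mono_set Metric.ball_subset_closedBall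
    -- Jensen's inequality in linearised form: `h² ≥ 2 κ h - κ²` with `κ` the mean of `h`; the
    -- factor `1/4` bounds `|u|²` from below.
    set κ := J / (2 * Real.pi) with hκ
    have h1 : ∫ θ in (0 : ℝ)..(2 * Real.pi), 1 / 4 * (2 * κ * phaseDeriv u A c ρ θ - κ ^ 2) ≤
        ∫ θ in (0 : ℝ)..(2 * Real.pi), covGradSq u A (c + ρ • dir θ) := by
      have hcont : Continuous fun θ => covGradSq u A (c + ρ • dir θ) :=
        hFc.comp_continuous (by have := continuous_dir; fun_prop)
          fun θ => annulus_subset _ _ _ (hmem θ)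
      refine intervalIntegral.integral_mono_on (by positivity)
        (Continuous.intervalIntegrable (by fun_prop) _ _)
        (hcont.intervalIntegrable _ _) fun θ _ => ?_
      refine le_trans ?_ (sq_phaseDeriv_le hΩ hu hρ0 (hΩc θ) (h0 θ))
      have hf' := hf _ (hmem θ)
      have : 1 / 4 ≤ ‖u (c + ρ • dir θ)‖ ^ 2 := by nlinarith
      nlinarith [sq_nonneg (phaseDeriv u A c ρ θ - κ), sq_nonneg (phaseDeriv u A c ρ θ)]
    rw [intervalIntegral.integral_const_mul, intervalIntegral.integral_sub
      ((hph.const_mul _).intervalIntegrable _ _) (continuous_const.intervalIntegrable _ _),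
      intervalIntegral.integral_const_mul, intervalIntegral.integral_const, sub_zero,
      smul_eq_mul, ← hJ] at h1
    have h3 : 1 / 4 * (2 * κ * J - 2 * Real.pi * κ ^ 2) = J ^ 2 / (8 * Real.pi) := by
      rw [hκ]; field_simp; ring
    rw [h3] at h1
    refine le_trans ?_ (mul_le_mul_of_nonneg_left h1 hρ0.le)
    have h4 : ρ * (J ^ 2 / (8 * Real.pi)) = (2 * Real.pi * d - X) ^ 2 / (8 * Real.pi * ρ) := by
      rw [← h2]; field_simp
    rw [h4, div_sub' (by positivity), div_le_div_iff₀ hρ0 (by positivity)]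
    have h5 : (2 * Real.pi * d) ^ 2 / 2 - X ^ 2 ≤ (2 * Real.pi * d - X) ^ 2 := by
      nlinarith [sq_nonneg (2 * Real.pi * d - 2 * X)]
    have h6 : 8 * Real.pi * (Real.pi / 4 * d ^ 2 - ρ * (ρ / 8 * Z)) ≤ (2 * Real.pi * d - X) ^ 2 := by
      nlinarith
    nlinarith)
  rwa [hint] at hmain

end Circle

end VortexBalls

namespace VortexBalls

open MeasureTheory

/-! ### Covering the set where the modulus is far from one -/

section Modulus

variable {u : Plane → ℂ} {Ω : Set Plane}

/-- A bounded smooth function of the modulus of `u`. -/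
noncomputable def modFun (u : Plane → ℂ) (x : Plane) : ℝ := ‖u x‖ ^ 2 / (1 + ‖u x‖ ^ 2)

/-- The energy density controlling the modulus of `u`. -/
noncomputable def modDensity (ε : ℝ) (u : Plane → ℂ) (x : Plane) : ℝ :=
  (∑ j : Fin 2, partialD j (modFun u) x ^ 2) + potential ε u x

lemma contDiffOn_modFun (hu : ContDiffOn ℝ 1 u Ω) : ContDiffOn ℝ 1 (modFun u) Ω := by
  have h := hu.norm_sq ℝ
  exact h.div (contDiffOn_const.add h) fun x _ => by positivity

lemma continuousOn_modDensity (ε : ℝ) (hΩ : IsOpen Ω) (hu : ContDiffOn ℝ 1 u Ω) :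
    ContinuousOn (modDensity ε u) Ω := by
  have h := contDiffOn_modFun hu
  have h0 := continuousOn_partialD hΩ h 0
  have h1 := continuousOn_partialD hΩ h 1
  have h2 := continuousOn_potential ε hu.continuousOn
  unfold modDensity
  simp only [Fin.sum_univ_two]
  exact ((h0.pow 2).add (h1.pow 2)).add h2

lemma modDensity_nonneg (ε : ℝ) (u : Plane → ℂ) (x : Plane) : 0 ≤ modDensity ε u x :=
  add_nonneg (Finset.sum_nonneg fun _ _ => sq_nonneg _) (potential_nonneg ε u x)

lemma partialD_norm_sq {x : Plane} (hu : DifferentiableAt ℝ u x) (j : Fin 2) :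
    partialD j (fun y => ‖u y‖ ^ 2) x = 2 * ((starRingEnd ℂ) (u x) * partialD j u x).re := by
  have h : HasFDerivAt (fun y => ‖u y‖ ^ 2) _ x := hu.hasFDerivAt.norm_sq
  rw [partialD, h.fderiv]
  simp [partialD, Complex.inner]
  ring

lemma partialD_modFun {x : Plane} (hu : DifferentiableAt ℝ u x) (j : Fin 2) :
    partialD j (modFun u) x = ((1 + ‖u x‖ ^ 2) ^ 2)⁻¹ * partialD j (fun y => ‖u y‖ ^ 2) x := by
  have h : DifferentiableAt ℝ (fun y => ‖u y‖ ^ 2) x := hu.norm_sq ℝ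
  have hpos : (1 : ℝ) + ‖u x‖ ^ 2 ≠ 0 := by positivity
  have hφ : HasDerivAt (fun s : ℝ => s / (1 + s)) (((1 + ‖u x‖ ^ 2) ^ 2)⁻¹) (‖u x‖ ^ 2) := by
    refine ((hasDerivAt_id' (‖u x‖ ^ 2)).div ((hasDerivAt_id' (‖u x‖ ^ 2)).const_add 1)
      hpos).congr_deriv ?_
    field_simp; ring
  have h2 := hφ.comp_hasFDerivAt x h.hasFDerivAt
  have e : modFun u = (fun s => s / (1 + s)) ∘ fun y => ‖u y‖ ^ 2 := rfl
  rw [partialD, e, h2.fderiv]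
  rfl

/-- As a function of `N = |u|`, `modFun` has the derivative `2N / (1 + N²)² ≤ 1`. It therefore
varies no faster than `|u|`, and being a smooth function of `|u|²` it needs no special treatment at
the zeros of `u`. -/
lemma sq_partialD_modFun_le {x : Plane} (hu : DifferentiableAt ℝ u x) (j : Fin 2) {b : ℝ}
    (hb : |partialD j (fun y => ‖u y‖ ^ 2) x| ≤ 2 * ‖u x‖ * b) :
    partialD j (modFun u) x ^ 2 ≤ b ^ 2 := by
  rw [partialD_modFun hu j, mul_pow]
  set N := ‖u x‖
  have hN : 0 ≤ N := norm_nonneg _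
  have h1 : partialD j (fun y => ‖u y‖ ^ 2) x ^ 2 ≤ (2 * N * b) ^ 2 := by
    rw [← sq_abs]; exact pow_le_pow_left₀ (abs_nonneg _) hb 2
  have h2 : (2 * N) ^ 2 ≤ ((1 + N ^ 2) ^ 2) ^ 2 := by
    have : 2 * N ≤ (1 + N ^ 2) ^ 2 := by nlinarith [sq_nonneg (N - 1), sq_nonneg (N ^ 2)]
    exact pow_le_pow_left₀ (by positivity) this 2
  rw [inv_pow, inv_mul_le_iff₀ (by positivity)]
  refine h1.trans ?_
  rw [mul_pow (2 * N)]
  exact mul_le_mul_of_nonneg_right h2 (sq_nonneg b)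

lemma sq_partialD_modFun_le_norm {x : Plane} (hu : DifferentiableAt ℝ u x) (j : Fin 2) :
    partialD j (modFun u) x ^ 2 ≤ partialD j (fun y => ‖u y‖) x ^ 2 := by
  rw [← sq_abs (partialD j (fun y => ‖u y‖) x)]
  refine sq_partialD_modFun_le hu j ?_
  by_cases h0 : u x = 0
  · rw [partialD_norm_sq hu, h0]; simp
  · have h1 : HasFDerivAt (fun y => ‖u y‖) _ x := (hu.norm ℝ h0).hasFDerivAt
    have h2 : HasFDerivAt (fun y => ‖u y‖ ^ 2) _ x := h1.pow 2
    rw [partialD, h2.fderiv]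
    simp [partialD, abs_mul]

/-- The diamagnetic inequality: the gauge term `i a u` is orthogonal to `u` and does not contribute
to the derivative of `|u|²`. -/
lemma sq_partialD_modFun_le_cov {x : Plane} (hu : DifferentiableAt ℝ u x) (j : Fin 2) (a : ℝ) :
    partialD j (modFun u) x ^ 2 ≤ ‖partialD j u x - Complex.I * (a : ℂ) * u x‖ ^ 2 := by
  refine sq_partialD_modFun_le hu j ?_
  rw [partialD_norm_sq hu]
  have : ((starRingEnd ℂ) (u x) * partialD j u x).re =
      ((starRingEnd ℂ) (u x) * (partialD j u x - Complex.I * (a : ℂ) * u x)).re := by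
    simp; ring
  rw [this, abs_mul, abs_two (α := ℝ), mul_assoc 2 ‖u x‖]
  refine mul_le_mul_of_nonneg_left ?_ (by norm_num : (0 : ℝ) ≤ 2)
  refine (Complex.abs_re_le_norm _).trans ?_
  rw [norm_mul, RCLike.norm_conj]

lemma modDensity_le_cov {x : Plane} (ε : ℝ) (hu : DifferentiableAt ℝ u x) (B : Plane → Plane) :
    modDensity ε u x ≤ covGradSq u B x + potential ε u x :=
  add_le_add (Finset.sum_le_sum fun j _ => sq_partialD_modFun_le_cov hu j (B x j)) le_rfl

lemma integral_modDensity_le {ε E : ℝ} (hE : 0 ≤ E) (hΩ : IsOpen Ω) (hu : ContDiffOn ℝ 1 u Ω)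
    (hen : modulusEnergy ε u Ω ≤ ENNReal.ofReal E) {S : Set Plane} (hS : IsCompact S)
    (hSΩ : S ⊆ Ω) : ∫ x in S, modDensity ε u x ≤ 2 * E := by
  have hint : IntegrableOn (modDensity ε u) S :=
    ((continuousOn_modDensity ε hΩ hu).mono hSΩ).integrableOn_compact hS
  have h1 : ENNReal.ofReal (∫ x in S, 1 / 2 * modDensity ε u x) =
      ∫⁻ x in S, ENNReal.ofReal (1 / 2 * modDensity ε u x) :=
    ofReal_integral_eq_lintegral_ofReal (hint.const_mul _)
      (ae_of_all _ fun x => mul_nonneg (by norm_num) (modDensity_nonneg ε u x))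
  have h2 : ∫⁻ x in S, ENNReal.ofReal (1 / 2 * modDensity ε u x) ≤ modulusEnergy ε u Ω := by
    refine (lintegral_mono_set hSΩ).trans ?_
    refine setLIntegral_mono' hΩ.measurableSet fun x hx => ENNReal.ofReal_le_ofReal ?_
    have hd : DifferentiableAt ℝ u x :=
      (hu.contDiffAt (hΩ.mem_nhds hx)).differentiableAt one_ne_zero
    refine mul_le_mul_of_nonneg_left (add_le_add (Finset.sum_le_sum fun j _ => ?_) le_rfl)
      (by norm_num)
    exact sq_partialD_modFun_le_norm hd j
  have h3 := (h1.le.trans h2).trans hen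
  rw [ENNReal.ofReal_le_ofReal_iff hE, integral_const_mul] at h3
  linarith

/-- The integral of `modFun u` over the circle of radius `t` about `c`. -/
noncomputable def circleMean (u : Plane → ℂ) (c : Plane) (t : ℝ) : ℝ :=
  ∫ θ in (0 : ℝ)..(2 * Real.pi), modFun u (c + t • dir θ)

lemma closedAnnulus_subset_closedBall (c : Plane) (p q : ℝ) :
    closedAnnulus c p q ⊆ Metric.closedBall c q := fun _ hx => hx.2

/-- The difference is the integral of the radial derivative `D` over the annulus. The bound `|D| ≤ s
D²/(2a) + a/(2s)` at radius `s` gives `a/2` from the energy and `π a log 2 ≤ 5a/2` from the second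
term. The constant does not depend on the scale `t`. -/
lemma circleMean_sub_le (ε : ℝ) (hΩ : IsOpen Ω) (hu : ContDiffOn ℝ 1 u Ω) {c : Plane} {t a : ℝ}
    (ht : 0 < t) (hB : Metric.closedBall c t ⊆ Ω) (ha : 0 < a)
    (hE : ∫ x in Metric.closedBall c t, modDensity ε u x ≤ a ^ 2) :
    |circleMean u c t - circleMean u c (t / 2)| ≤ 3 * a := by
  have hpi := Real.pi_pos
  set p := t / 2 with hp
  have hp0 : 0 < p := by positivity
  have hpt : p ≤ t := by rw [hp]; linarith
  set w := modFun u with hw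
  have hw1 := contDiffOn_modFun hu
  set D : ℝ → ℝ → ℝ := fun s θ => Real.cos θ * partialD 0 w (c + s • dir θ)
    + Real.sin θ * partialD 1 w (c + s • dir θ) with hD
  have hmem : ∀ s ∈ Set.Icc p t, ∀ θ, c + s • dir θ ∈ Ω := fun s hs θ => hB (by
    rw [Metric.mem_closedBall, dist_add_smul_dir c (hp0.le.trans hs.1)]; exact hs.2)
  have hDc : ContinuousOn (Function.uncurry D) (Set.Icc p t ×ˢ Set.univ) := by
    have hm : Set.MapsTo (fun z : ℝ × ℝ => c + z.1 • dir z.2) (Set.Icc p t ×ˢ Set.univ) Ω :=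
      fun z hz => hmem z.1 hz.1 z.2
    have h0 := (continuousOn_partialD hΩ hw1 0).comp (continuous_polar c).continuousOn hm
    have h1 := (continuousOn_partialD hΩ hw1 1).comp (continuous_polar c).continuousOn hm
    have hc : ContinuousOn (fun z : ℝ × ℝ => Real.cos z.2) (Set.Icc p t ×ˢ Set.univ) := by fun_prop
    have hs : ContinuousOn (fun z : ℝ × ℝ => Real.sin z.2) (Set.Icc p t ×ˢ Set.univ) := by fun_prop
    exact (hc.mul h0).add (hs.mul h1)
  have hDer : ∀ θ, ∀ s ∈ Set.uIcc p t, HasDerivAt (fun s => w (c + s • dir θ)) (D s θ) s := by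
    intro θ s hs
    rw [Set.uIcc_of_le hpt] at hs
    have h1 : HasFDerivAt w (fderiv ℝ w (c + s • dir θ)) (c + s • dir θ) :=
      ((hw1.contDiffAt (hΩ.mem_nhds (hmem s hs θ))).differentiableAt one_ne_zero).hasFDerivAt
    have h2 : HasDerivAt (fun s : ℝ => c + s • dir θ) (dir θ) s := by
      simpa using ((hasDerivAt_id s).smul_const (dir θ)).const_add c
    have h3 := h1.comp_hasDerivAt s h2
    rw [fderiv_dir] at h3
    exact h3
  have hFTC : ∀ θ, w (c + t • dir θ) - w (c + p • dir θ) = ∫ s in p..t, D s θ := fun θ => by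
    refine (intervalIntegral.integral_eq_sub_of_hasDerivAt (hDer θ) ?_).symm
    refine ContinuousOn.intervalIntegrable ?_
    rw [Set.uIcc_of_le hpt]
    exact hDc.comp (f := fun s => (s, θ)) (by fun_prop) fun s hs => ⟨hs, trivial⟩
  have hwc : ∀ s ∈ Set.Icc p t, Continuous fun θ => w (c + s • dir θ) := fun s hs =>
    hw1.continuousOn.comp_continuous (by have := continuous_dir; fun_prop) (hmem s hs)
  have hdiff : circleMean u c t - circleMean u c p =
      ∫ s in p..t, ∫ θ in (0 : ℝ)..(2 * Real.pi), D s θ := by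
    rw [circleMean, circleMean, ← intervalIntegral.integral_sub
      ((hwc t ⟨hpt, le_rfl⟩).intervalIntegrable _ _) ((hwc p ⟨le_rfl, hpt⟩).intervalIntegrable _ _),
      intervalIntegral_intervalIntegral_swap]
    · exact intervalIntegral.integral_congr fun θ _ => hFTC θ
    · have hK : IsCompact (Set.Icc p t ×ˢ Set.Icc 0 (2 * Real.pi)) := isCompact_Icc.prod isCompact_Icc
      refine ((hDc.mono (Set.prod_mono subset_rfl (Set.subset_univ _))).integrableOn_compact
        hK).mono_set (Set.prod_mono ?_ ?_)
      · rw [Set.uIoc_of_le hpt]; exact Set.Ioc_subset_Icc_self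
      · rw [Set.uIoc_of_le (by positivity)]; exact Set.Ioc_subset_Icc_self
  have hcl : closedAnnulus c p t ⊆ Ω := (closedAnnulus_subset_closedBall c p t).trans hB
  have hmd := (continuousOn_modDensity ε hΩ hu).mono hcl
  have hDs : ∀ s ∈ Set.Icc p t, Continuous (D s) := fun s hs =>
    hDc.comp_continuous (f := fun θ => (s, θ)) (by fun_prop) fun θ => ⟨hs, trivial⟩
  have hcirc : ∀ s ∈ Set.Icc p t, Continuous fun θ => modDensity ε u (c + s • dir θ) := fun s hs =>
    (continuousOn_modDensity ε hΩ hu).comp_continuous (by have := continuous_dir; fun_prop) (hmem s hs)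
  have hbound : ∀ s ∈ Set.Icc p t, ‖∫ θ in (0 : ℝ)..(2 * Real.pi), D s θ‖ ≤
      (2 * a)⁻¹ * (s * ∫ θ in (0 : ℝ)..(2 * Real.pi), modDensity ε u (c + s • dir θ))
        + Real.pi * a / s := by
    intro s hs
    have hs0 : 0 < s := hp0.trans_le hs.1
    have h1 : ‖∫ θ in (0 : ℝ)..(2 * Real.pi), D s θ‖ ≤ ∫ θ in (0 : ℝ)..(2 * Real.pi),
        ((2 * a)⁻¹ * s * modDensity ε u (c + s • dir θ) + a / (2 * s)) := by
      refine intervalIntegral.norm_integral_le_of_norm_le (by positivity)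
        (ae_of_all _ fun θ _ => ?_)
        ((((hcirc s hs).const_mul _).add continuous_const).intervalIntegrable _ _)
      set x := c + s • dir θ
      have h2 : D s θ ^ 2 ≤ modDensity ε u x := by
        have h3 : D s θ ^ 2 ≤ partialD 0 w x ^ 2 + partialD 1 w x ^ 2 := by
          have := Real.sin_sq_add_cos_sq θ
          have e : partialD 0 w x ^ 2 + partialD 1 w x ^ 2 - D s θ ^ 2 =
            (Real.sin θ * partialD 0 w x - Real.cos θ * partialD 1 w x) ^ 2 := by
            simp only [hD]
            linear_combination (-(partialD 0 w x ^ 2 + partialD 1 w x ^ 2)) * this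
          nlinarith [sq_nonneg (Real.sin θ * partialD 0 w x - Real.cos θ * partialD 1 w x)]
        have h4 := potential_nonneg ε u x
        rw [modDensity, Fin.sum_univ_two]
        linarith
      have h5 : (2 * a)⁻¹ * s * D s θ ^ 2 + a / (2 * s) - |D s θ| =
          (s * |D s θ| - a) ^ 2 / (2 * a * s) := by
        rw [← sq_abs (D s θ)]; field_simp; ring
      have h6 : 0 ≤ (s * |D s θ| - a) ^ 2 / (2 * a * s) := by positivity
      have h7 : (2 * a)⁻¹ * s * D s θ ^ 2 ≤ (2 * a)⁻¹ * s * modDensity ε u x := by gcongr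
      rw [Real.norm_eq_abs]
      linarith
    refine h1.trans (le_of_eq ?_)
    rw [intervalIntegral.integral_add (((hcirc s hs).const_mul _).intervalIntegrable _ _)
      (continuous_const.intervalIntegrable _ _), intervalIntegral.integral_const_mul,
      intervalIntegral.integral_const, smul_eq_mul]
    field_simp
    ring
  have hii := intervalIntegrable_circle hp0.le hpt hmd
  have hinv : IntervalIntegrable (fun s => Real.pi * a / s) volume p t := by
    refine ContinuousOn.intervalIntegrable (continuousOn_const.div continuousOn_id fun s hs => ?_)
    rw [Set.uIcc_of_le hpt] at hs
    exact (hp0.trans_le hs.1).ne'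
  rw [hdiff, ← Real.norm_eq_abs]
  have h1 := intervalIntegral.norm_integral_le_of_norm_le hpt
    (ae_of_all _ fun s hs => hbound s (Set.Ioc_subset_Icc_self hs)) ((hii.const_mul _).add hinv)
  refine h1.trans ?_
  rw [intervalIntegral.integral_add (hii.const_mul _) hinv, intervalIntegral.integral_const_mul,
    ← integral_annulus hp0.le hpt hmd]
  have e1 : ∫ s in p..t, Real.pi * a / s = Real.pi * a * Real.log 2 := by
    simp only [div_eq_mul_inv]
    rw [intervalIntegral.integral_const_mul, integral_inv_of_pos hp0 ht]
    congr 2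
    rw [hp]; field_simp
  have hsub : annulus c p t ⊆ Metric.closedBall c t := fun x hx => hx.2.le
  have e2 : ∫ x in annulus c p t, modDensity ε u x ≤ a ^ 2 := by
    refine le_trans ?_ hE
    refine setIntegral_mono_set ?_ (ae_of_all _ fun x => modDensity_nonneg ε u x)
      hsub.eventuallyLE
    exact ((continuousOn_modDensity ε hΩ hu).mono hB).integrableOn_compact (isCompact_closedBall c t)
  rw [e1]
  have e3 : (2 * a)⁻¹ * ∫ x in annulus c p t, modDensity ε u x ≤ (2 * a)⁻¹ * a ^ 2 := by gcongr
  have e4 : (2 * a)⁻¹ * a ^ 2 = a / 2 := by field_simp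
  have e5 : Real.pi * Real.log 2 ≤ 5 / 2 := by
    have := Real.pi_lt_d2
    have := Real.log_two_lt_d9
    have := Real.log_two_gt_d9
    nlinarith
  have e6 : Real.pi * a * Real.log 2 ≤ 5 / 2 * a := by nlinarith
  linarith

lemma modFun_sub_half (u : Plane → ℂ) (x : Plane) :
    |modFun u x - 1 / 2| ≤ 1 / 2 * |1 - ‖u x‖ ^ 2| := by
  have h : modFun u x - 1 / 2 = (1 / (2 * (1 + ‖u x‖ ^ 2))) * -(1 - ‖u x‖ ^ 2) := by
    rw [modFun]; field_simp; ring
  rw [h, abs_mul, abs_neg]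
  refine mul_le_mul_of_nonneg_right ?_ (abs_nonneg _)
  rw [abs_of_pos (by positivity)]
  gcongr
  nlinarith [sq_nonneg ‖u x‖]

lemma le_modFun_sub_half {δ : ℝ} (hδ : 0 < δ) (hδ' : δ ≤ 1 / 2) {x : Plane} (h : δ ≤ |‖u x‖ - 1|) :
    δ / 4 ≤ |modFun u x - 1 / 2| := by
  set f := ‖u x‖ with hf
  have hf0 : 0 ≤ f := norm_nonneg _
  have e : modFun u x - 1 / 2 = (f ^ 2 - 1) / (2 * (1 + f ^ 2)) := by
    rw [modFun, ← hf]; field_simp; ring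
  rw [e]
  rcases le_abs.1 h with h | h
  · refine le_trans ?_ (le_abs_self _)
    rw [le_div_iff₀ (by positivity)]
    have h1 : 1 + 2 * δ ≤ f ^ 2 := by nlinarith
    nlinarith [mul_le_mul_of_nonneg_right h1 (by linarith : 0 ≤ 1 - δ / 2)]
  · refine le_trans ?_ (neg_le_abs _)
    rw [← neg_div, le_div_iff₀ (by positivity)]
    have h1 : f ^ 2 ≤ 1 - δ := by nlinarith
    nlinarith [mul_le_mul_of_nonneg_right h1 (by linarith : 0 ≤ 1 + δ / 2)]

/-- At the scale `ε` the potential controls the modulus: a circle with little potential energy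
exists by averaging, and there `modFun` is close in mean to `1/2`, its value for modulus one. The
circle integral of `1/2` is `π`. -/
lemma exists_circleMean_near (hΩ : IsOpen Ω) (hu : ContDiffOn ℝ 1 u Ω) {c : Plane} {ε b : ℝ}
    (hε : 0 < ε) (hb : 0 < b) (hB : Metric.closedBall c (ε / 2) ⊆ Ω)
    (hE : ∫ x in Metric.closedBall c (ε / 2), modDensity ε u x ≤ b ^ 2 / 2) :
    ∃ s ∈ Set.Ioo (ε / 4) (ε / 2), |circleMean u c s - Real.pi| ≤ 8 * b := by
  have hpi := Real.pi_pos
  have hcl : closedAnnulus c (ε / 4) (ε / 2) ⊆ Ω := (closedAnnulus_subset_closedBall _ _ _).trans hB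
  have hpot := (continuousOn_potential ε hu.continuousOn).mono hcl
  have hex : ∃ s ∈ Set.Ioo (ε / 4) (ε / 2),
      s * ∫ θ in (0 : ℝ)..(2 * Real.pi), potential ε u (c + s • dir θ) < 3 * b ^ 2 / ε := by
    by_contra! hcon
    have h1 := le_integral_annulus (by positivity) (by linarith) hpot
      (l := fun _ => 3 * b ^ 2 / ε) (intervalIntegrable_const) hcon
    have h2 : ∫ x in annulus c (ε / 4) (ε / 2), potential ε u x ≤
        ∫ x in Metric.closedBall c (ε / 2), modDensity ε u x := by
      have hi := ((continuousOn_modDensity ε hΩ hu).mono hB).integrableOn_compact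
        (isCompact_closedBall c (ε / 2)) (μ := volume)
      have hsub : annulus c (ε / 4) (ε / 2) ⊆ Metric.closedBall c (ε / 2) := fun x hx => hx.2.le
      refine (setIntegral_mono_on (integrableOn_annulus hpot) (hi.mono_set hsub)
        (isOpen_annulus _ _ _).measurableSet fun x _ => ?_).trans
        (setIntegral_mono_set hi (ae_of_all _ fun x => modDensity_nonneg ε u x) hsub.eventuallyLE)
      rw [modDensity]
      linarith [Finset.sum_nonneg fun (j : Fin 2) (_ : j ∈ Finset.univ) =>
        sq_nonneg (partialD j (modFun u) x)]
    rw [intervalIntegral.integral_const, smul_eq_mul] at h1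
    have h3 : (ε / 2 - ε / 4) * (3 * b ^ 2 / ε) = 3 / 4 * b ^ 2 := by field_simp; ring
    rw [h3] at h1
    nlinarith
  obtain ⟨s, hs, hlt⟩ := hex
  refine ⟨s, hs, ?_⟩
  have hs0 : 0 < s := lt_trans (by positivity) hs.1
  have hmem : ∀ θ, c + s • dir θ ∈ Ω := fun θ => hB (by
    rw [Metric.mem_closedBall, dist_add_smul_dir c hs0.le]; exact hs.2.le)
  have hpc : Continuous fun θ => potential ε u (c + s • dir θ) :=
    (continuousOn_potential ε hu.continuousOn).comp_continuous
      (by have := continuous_dir; fun_prop) hmem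
  have hwc : Continuous fun θ => modFun u (c + s • dir θ) :=
    (contDiffOn_modFun hu).continuousOn.comp_continuous (by have := continuous_dir; fun_prop) hmem
  have h1 : circleMean u c s - Real.pi =
      ∫ θ in (0 : ℝ)..(2 * Real.pi), (modFun u (c + s • dir θ) - 1 / 2) := by
    rw [intervalIntegral.integral_sub (hwc.intervalIntegrable _ _)
      (continuous_const.intervalIntegrable _ _), intervalIntegral.integral_const, circleMean]
    simp
    ring
  rw [h1, ← Real.norm_eq_abs]
  have h2 : ‖∫ θ in (0 : ℝ)..(2 * Real.pi), (modFun u (c + s • dir θ) - 1 / 2)‖ ≤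
      ∫ θ in (0 : ℝ)..(2 * Real.pi), (ε ^ 2 / (2 * b) * potential ε u (c + s • dir θ) + b / 4) := by
    refine intervalIntegral.norm_integral_le_of_norm_le (by positivity)
      (ae_of_all _ fun θ _ => ?_) (((hpc.const_mul _).add continuous_const).intervalIntegrable _ _)
    rw [Real.norm_eq_abs]
    refine (modFun_sub_half u _).trans ?_
    rw [potential]
    set y := 1 - ‖u (c + s • dir θ)‖ ^ 2
    have e : ε ^ 2 / (2 * b) * (1 / (2 * ε ^ 2) * y ^ 2) + b / 4 - 1 / 2 * |y| =
        (|y| - b) ^ 2 / (4 * b) := by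
      rw [← sq_abs y]; field_simp; ring
    have : 0 ≤ (|y| - b) ^ 2 / (4 * b) := by positivity
    linarith
  refine h2.trans ?_
  rw [intervalIntegral.integral_add ((hpc.const_mul _).intervalIntegrable _ _)
      (continuous_const.intervalIntegrable _ _), intervalIntegral.integral_const_mul,
      intervalIntegral.integral_const, smul_eq_mul, sub_zero]
  set J := ∫ θ in (0 : ℝ)..(2 * Real.pi), potential ε u (c + s • dir θ)
  have hJ0 : 0 ≤ J := intervalIntegral.integral_nonneg (by positivity)
    fun θ _ => potential_nonneg ε u _
  have h3 : ε / 4 * J ≤ 3 * b ^ 2 / ε := by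
    have := mul_le_mul_of_nonneg_right hs.1.le hJ0
    linarith
  have h4 : J ≤ 12 * b ^ 2 / ε ^ 2 := by
    rw [le_div_iff₀ (by positivity)]
    rw [le_div_iff₀ hε] at h3
    nlinarith
  have h5 : ε ^ 2 / (2 * b) * J ≤ ε ^ 2 / (2 * b) * (12 * b ^ 2 / ε ^ 2) := by gcongr
  have h6 : ε ^ 2 / (2 * b) * (12 * b ^ 2 / ε ^ 2) = 6 * b := by field_simp; ring
  have h7 : Real.pi ≤ 4 := Real.pi_le_four
  have h8 : 2 * Real.pi * (b / 4) ≤ 2 * b := by nlinarith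
  linarith

/-- Where the modulus is not close to one, some disc carries an amount of energy proportional to
its radius. -/
lemma exists_le_integral_modDensity (hΩ : IsOpen Ω) (hu : ContDiffOn ℝ 1 u Ω) {c : Plane}
    {ε δ : ℝ} (hε : 0 < ε) (hδ : 0 < δ) (hδ' : δ ≤ 1 / 2)
    (hB : Metric.closedBall c (ε / 2) ⊆ Ω) (hc : δ ≤ |‖u c‖ - 1|) :
    ∃ t ∈ Set.Ioc 0 (ε / 2),
      δ ^ 2 / (400 * ε) * t ≤ ∫ x in Metric.closedBall c t, modDensity ε u x := by
  by_contra! hcon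
  -- If all these discs carry little energy, the circle means at the radii `s / 2^n` change by at
  -- most `3b (3/4)^n`, in total by `12b`, and the one at radius `s` is within `8b` of `π`. Hence
  -- `2π modFun u c` is within `20b = δ` of `π`, whereas the modulus at `c` forces a distance of at
  -- least `6 · δ/4`.
  set b := δ / 20 with hb
  have hb0 : 0 < b := by positivity
  obtain ⟨s, hs, hsb⟩ := exists_circleMean_near hΩ hu hε hb0 hB
    ((hcon (ε / 2) ⟨by positivity, le_rfl⟩).le.trans_eq (by rw [hb]; field_simp; norm_num))
  have hs0 : 0 < s := lt_trans (by positivity) hs.1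
  set t : ℕ → ℝ := fun n => s * (1 / 2) ^ n with ht
  have ht0 : ∀ n, 0 < t n := fun n => by positivity
  have hts : ∀ n, t n ≤ s := fun n =>
    mul_le_of_le_one_right hs0.le (pow_le_one₀ (by norm_num) (by norm_num))
  have hstep : ∀ n, dist (circleMean u c (t n)) (circleMean u c (t (n + 1))) ≤
      3 * b * (3 / 4) ^ n := by
    intro n
    have hte : t n ≤ ε / 2 := (hts n).trans hs.2.le
    have e : t (n + 1) = t n / 2 := by simp only [ht, pow_succ]; ring
    rw [Real.dist_eq, e, mul_assoc]
    refine circleMean_sub_le ε hΩ hu (ht0 n) ((Metric.closedBall_subset_closedBall hte).trans hB)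
      (by positivity) ((hcon (t n) ⟨ht0 n, hte⟩).le.trans ?_)
    -- An energy bound linear in the radius halves at each step; its square root still decays
    -- geometrically, since `1/2 ≤ (3/4)²`.
    have h1 : ((1 : ℝ) / 2) ^ n ≤ ((3 / 4) ^ n) ^ 2 := by
      rw [← pow_mul, mul_comm n 2, pow_mul]
      exact pow_le_pow_left₀ (by norm_num) (by norm_num) n
    have h2 : δ ^ 2 / (400 * ε) * t n = b ^ 2 * (s / ε) * (1 / 2) ^ n := by
      simp only [ht, hb]; field_simp; norm_num
    have h3 : s / ε ≤ 1 := by rw [div_le_one hε]; linarith [hs.2]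
    rw [h2, mul_pow]
    calc b ^ 2 * (s / ε) * (1 / 2) ^ n ≤ b ^ 2 * 1 * ((3 / 4) ^ n) ^ 2 := by gcongr
      _ = _ := by ring
  have hlim : Filter.Tendsto (fun n => circleMean u c (t n)) Filter.atTop
      (nhds (circleMean u c 0)) := by
    have hcont : ContinuousOn (circleMean u c) (Set.Icc 0 s) :=
      continuousOn_circle_integral le_rfl hs0.le ((contDiffOn_modFun hu).continuousOn.mono
        ((closedAnnulus_subset_closedBall c 0 s).trans
          ((Metric.closedBall_subset_closedBall hs.2.le).trans hB)))
    have ht1 : Filter.Tendsto t Filter.atTop (nhds 0) := by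
      simpa [ht] using (tendsto_pow_atTop_nhds_zero_of_lt_one (by norm_num : (0 : ℝ) ≤ 1 / 2)
        (by norm_num)).const_mul s
    exact (hcont 0 ⟨le_rfl, hs0.le⟩).tendsto.comp (tendsto_nhdsWithin_iff.2
      ⟨ht1, Filter.Eventually.of_forall fun n => ⟨(ht0 n).le, hts n⟩⟩)
  have h1 := dist_le_of_le_geometric_of_tendsto₀ (3 / 4) (3 * b) (by norm_num) hstep hlim
  have e0 : circleMean u c 0 = 2 * Real.pi * modFun u c := by
    simp [circleMean]
  have et : t 0 = s := by simp [ht]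
  have e12 : 3 * b / (1 - 3 / 4) = 12 * b := by norm_num; ring
  rw [e0, et, Real.dist_eq, e12] at h1
  have h2 := le_modFun_sub_half hδ hδ' hc
  have h3 : 2 * Real.pi * |modFun u c - 1 / 2| ≤ 20 * b := by
    have e : 2 * Real.pi * |modFun u c - 1 / 2| = |2 * Real.pi * modFun u c - Real.pi| := by
      rw [← abs_of_pos Real.two_pi_pos, ← abs_mul, abs_of_pos Real.two_pi_pos]; ring_nf
    rw [e]
    have h4 := abs_sub_le (2 * Real.pi * modFun u c) (circleMean u c s) Real.pi
    rw [abs_sub_comm (2 * Real.pi * modFun u c) (circleMean u c s)] at h4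
    linarith
  have h5 := Real.pi_gt_three
  have h6 : 6 * (δ / 4) ≤ 2 * Real.pi * |modFun u c - 1 / 2| :=
    mul_le_mul (by linarith) h2 (by positivity) (by positivity)
  linarith

/-- A compact set on which the modulus is not close to one is covered by finitely many discs that
carry energy. -/
lemma exists_energy_cover (hΩ : IsOpen Ω) (hu : ContDiffOn ℝ 1 u Ω) {ε δ : ℝ} (hε : 0 < ε)
    (hδ : 0 < δ) (hδ' : δ ≤ 1 / 2) {S : Set Plane} (hS : IsCompact S)
    (hB : ∀ x ∈ S, Metric.closedBall x (ε / 2) ⊆ Ω) (hf : ∀ x ∈ S, δ ≤ |‖u x‖ - 1|) :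
    ∃ F : Finset Disc, (∀ B ∈ F, 0 < B.radius ∧ B.toSet ⊆ Ω ∧
      δ ^ 2 / (400 * ε) * B.radius ≤ ∫ x in B.toSet, modDensity ε u x) ∧
      S ⊆ ⋃ B ∈ F, Metric.ball B.center B.radius := by
  classical
  choose! t ht using fun x (hx : x ∈ S) =>
    exists_le_integral_modDensity hΩ hu hε hδ hδ' (hB x hx) (hf x hx)
  obtain ⟨F, hF, hcov⟩ := hS.elim_nhds_subcover (fun x => Metric.ball x (t x))
    fun x hx => Metric.ball_mem_nhds x (ht x hx).1.1
  refine ⟨F.image fun x => ⟨x, t x⟩, fun B hBF => ?_, ?_⟩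
  · obtain ⟨x, hx, rfl⟩ := Finset.mem_image.1 hBF
    exact ⟨(ht x (hF x hx)).1.1, (Metric.closedBall_subset_closedBall
      (ht x (hF x hx)).1.2).trans (hB x (hF x hx)), (ht x (hF x hx)).2⟩
  · simpa using hcov

/-- Vitali's covering lemma for finite collections of discs. -/
lemma exists_vitali (F : Finset Disc) (hF : ∀ B ∈ F, 0 < B.radius) :
    ∃ F' ⊆ F, IsDiscCollection F' ∧ ∀ B ∈ F, ∃ B' ∈ F', B.toSet ⊆ (B'.dilate 4).toSet := by
  classical
  obtain ⟨v, hv, hdis, hcov⟩ := Vitali.exists_disjoint_subfamily_covering_enlargement_closedBall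
    (↑F : Set Disc) Disc.center Disc.radius (∑ B ∈ F, B.radius)
    (fun B hB => Finset.single_le_sum (f := Disc.radius) (fun B hB => (hF B hB).le) hB) 4
    (by norm_num)
  have hfin : v.Finite := F.finite_toSet.subset hv
  refine ⟨hfin.toFinset, fun B hB => hv (hfin.mem_toFinset.1 hB),
    ⟨fun B hB => hF B (hv (hfin.mem_toFinset.1 hB)), fun B hB B' hB' h =>
      hdis (hfin.mem_toFinset.1 hB) (hfin.mem_toFinset.1 hB') h⟩, fun B hB => ?_⟩
  obtain ⟨B', hB', h⟩ := hcov B hB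
  exact ⟨B', hfin.mem_toFinset.2 hB', h⟩

lemma IsDiscCollection.sum_setIntegral {F : Finset Disc} (hF : IsDiscCollection F) {g : Plane → ℝ}
    (hg : ∀ B ∈ F, IntegrableOn g B.toSet) :
    ∑ B ∈ F, ∫ x in B.toSet, g x = ∫ x in discUnion F, g x :=
  (integral_biUnion_finset F (fun B _ => (isClosed_toSet B).measurableSet)
    (fun B hB B' hB' h => hF.disjoint B hB B' hB' h) hg).symm

lemma isCompact_toSet (B : Disc) : IsCompact B.toSet := isCompact_closedBall _ _

lemma isCompact_discUnion (F : Finset Disc) : IsCompact (discUnion F) :=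
  F.isCompact_biUnion fun B _ => isCompact_toSet B

/-- Disjoint discs that carry energy have a small total radius. -/
lemma totalRadius_le_of_energy (hΩ : IsOpen Ω) (hu : ContDiffOn ℝ 1 u Ω) {ε κ E : ℝ} (hE : 0 ≤ E)
    (hen : modulusEnergy ε u Ω ≤ ENNReal.ofReal E) {F : Finset Disc} (hF : IsDiscCollection F)
    (h : ∀ B ∈ F, B.toSet ⊆ Ω ∧ κ * B.radius ≤ ∫ x in B.toSet, modDensity ε u x) :
    κ * totalRadius F ≤ 2 * E := by
  have hsub : discUnion F ⊆ Ω := Set.iUnion₂_subset fun B hB => (h B hB).1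
  rw [totalRadius, Finset.mul_sum]
  refine (Finset.sum_le_sum fun B hB => (h B hB).2).trans ?_
  rw [hF.sum_setIntegral fun B hB => ((continuousOn_modDensity ε hΩ hu).mono
    (h B hB).1).integrableOn_compact (isCompact_toSet B)]
  exact integral_modDensity_le hE hΩ hu hen (isCompact_discUnion F) hsub

end Modulus

end VortexBalls

namespace VortexBalls

open MeasureTheory

/-! ### The initial collection of discs -/

/-- The standing assumptions: `U` is compactly contained in the domain of the `C¹` maps `u`, `A`. -/
structure IsConfiguration (Ω U : Set Plane) (u : Plane → ℂ) (A : Plane → Plane) : Prop where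
  isOpen : IsOpen Ω
  isOpen_sub : IsOpen U
  isCompact_closure : IsCompact (closure U)
  closure_subset : closure U ⊆ Ω
  contDiffOn : ContDiffOn ℝ 1 u Ω
  contDiffOn_field : ContDiffOn ℝ 1 A Ω

section Core

variable {Ω U : Set Plane} {u : Plane → ℂ} {A : Plane → Plane}

lemma IsConfiguration.subset (h : IsConfiguration Ω U u A) : U ⊆ Ω :=
  subset_closure.trans h.closure_subset

lemma IsConfiguration.integrableOn (h : IsConfiguration Ω U u A) {g : Plane → ℝ}
    (hg : ContinuousOn g Ω) : IntegrableOn g U :=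
  ((hg.mono h.closure_subset).integrableOn_compact h.isCompact_closure).mono_set subset_closure

lemma IsConfiguration.integrableOn_energy (h : IsConfiguration Ω U u A) (ε : ℝ) :
    IntegrableOn (fun x => covGradSq u A x + potential ε u x) U :=
  h.integrableOn ((continuousOn_covGradSq h.isOpen h.contDiffOn subset_rfl
    h.contDiffOn_field.continuousOn).add (continuousOn_potential ε h.contDiffOn.continuousOn))

lemma IsConfiguration.integrableOn_curl_sq (h : IsConfiguration Ω U u A) :
    IntegrableOn (fun x => curl A x ^ 2) U :=
  h.integrableOn ((continuousOn_curl h.isOpen h.contDiffOn_field).pow 2)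

lemma energyDensity_nonneg (ε : ℝ) (u : Plane → ℂ) (A : Plane → Plane) (x : Plane) :
    0 ≤ covGradSq u A x + potential ε u x :=
  add_nonneg (covGradSq_nonneg u A x) (potential_nonneg ε u x)

/-- The energy of a disc, with a weight on the curl adapted to its radius. -/
noncomputable def discEnergy (ε : ℝ) (u : Plane → ℂ) (A : Plane → Plane) (U : Set Plane)
    (B : Disc) : ℝ :=
  (∫ x in Metric.ball B.center B.radius ∩ U, (covGradSq u A x + potential ε u x)) +
    B.radius ^ 2 / 16 * ∫ x in Metric.ball B.center B.radius ∩ U, curl A x ^ 2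

lemma measurableSet_ball_inter (h : IsConfiguration Ω U u A) (B : Disc) :
    MeasurableSet (Metric.ball B.center B.radius ∩ U) :=
  Metric.isOpen_ball.measurableSet.inter h.isOpen_sub.measurableSet

lemma sum_setIntegral_le {ι : Type*} {s : Finset ι} {S : ι → Set Plane} {g : Plane → ℝ}
    {T : Set Plane} (hS : ∀ i ∈ s, MeasurableSet (S i)) (hd : (↑s : Set ι).PairwiseDisjoint S)
    (hT : ∀ i ∈ s, S i ⊆ T) (hTm : MeasurableSet T) (hg : IntegrableOn g T)
    (h0 : ∀ x ∈ T, 0 ≤ g x) : ∑ i ∈ s, ∫ x in S i, g x ≤ ∫ x in T, g x := by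
  rw [← integral_biUnion_finset s hS hd fun i hi => hg.mono_set (hT i hi)]
  exact setIntegral_mono_set hg (ae_restrict_of_forall_mem hTm h0)
    (Set.iUnion₂_subset hT).eventuallyLE

/-- The energy of a disc dominates the energies of disjoint discs inside. -/
lemma sum_discEnergy_le (h : IsConfiguration Ω U u A) (ε : ℝ) {ι : Type*} {s : Finset ι}
    {D : ι → Disc} {K : Disc} (hr : ∀ i ∈ s, 0 < (D i).radius) (hK : 0 < K.radius)
    (hd : (↑s : Set ι).PairwiseDisjoint fun i => Metric.ball (D i).center (D i).radius)
    (hsub : ∀ i ∈ s, (D i).toSet ⊆ K.toSet) (hle : ∀ i ∈ s, (D i).radius ≤ K.radius) :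
    ∑ i ∈ s, discEnergy ε u A U (D i) ≤ discEnergy ε u A U K := by
  have hd' : (↑s : Set ι).PairwiseDisjoint
      fun i => Metric.ball (D i).center (D i).radius ∩ U := fun i hi j hj hij =>
    (hd hi hj hij).mono Set.inter_subset_left Set.inter_subset_left
  have hm : ∀ i ∈ s, MeasurableSet (Metric.ball (D i).center (D i).radius ∩ U) :=
    fun i _ => measurableSet_ball_inter h _
  have hs : ∀ i ∈ s, Metric.ball (D i).center (D i).radius ∩ U ⊆
      Metric.ball K.center K.radius ∩ U := fun i hi =>
    Set.inter_subset_inter_left _ (ball_subset_ball_of_toSet (hr i hi) hK (hsub i hi))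
  have hKm := measurableSet_ball_inter h K
  simp only [discEnergy]
  rw [Finset.sum_add_distrib]
  refine add_le_add (sum_setIntegral_le hm hd' hs hKm
    ((h.integrableOn_energy ε).mono_set Set.inter_subset_right)
    fun x _ => energyDensity_nonneg ε u A x) ?_
  refine le_trans (Finset.sum_le_sum fun i hi => ?_) (by
    rw [← Finset.mul_sum]
    exact mul_le_mul_of_nonneg_left (sum_setIntegral_le hm hd' hs hKm
      (h.integrableOn_curl_sq.mono_set Set.inter_subset_right) fun x _ => sq_nonneg _)
        (by positivity))
  have h1 : (D i).radius ^ 2 ≤ K.radius ^ 2 := pow_le_pow_left₀ (hr i hi).le (hle i hi) 2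
  have h2 : 0 ≤ ∫ x in Metric.ball (D i).center (D i).radius ∩ U, curl A x ^ 2 :=
    integral_nonneg fun x => sq_nonneg _
  exact mul_le_mul_of_nonneg_right (by linarith) h2

lemma radius_le_of_merge {ι : Type*} [DecidableEq Disc] {s : Finset ι} {D : ι → Disc} {B : Disc}
    {p : ι → Disc} (hr : ∀ i ∈ s, 0 < (D i).radius)
    (h : B.radius = ∑ i ∈ s, if p i = B then (D i).radius else 0) {i : ι} (hi : i ∈ s)
    (hp : p i = B) : (D i).radius ≤ B.radius := by
  rw [h]
  refine le_trans (by simp [hp]) (Finset.single_le_sum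
    (f := fun i => if p i = B then (D i).radius else 0) (fun j hj => ?_) hi)
  split_ifs
  · exact (hr j hj).le
  · exact le_rfl

/-- Growing a disc of small radius compared to its degree increases its energy. -/
lemma discEnergy_grow (h : IsConfiguration Ω U u A) {ε : ℝ} (hε : 0 < ε) {c : Plane} {p q d : ℝ}
    (hp : 0 < p) (hpq : p ≤ q) (hU : Metric.ball c q ⊆ U) (hd1 : 1 ≤ |d|)
    (hq : q ≤ 10 * ε * |d|)
    (hd : ∀ ρ ∈ Set.Ioo p q, deg u ⟨c, ρ⟩ = d) (hf : ∀ x ∈ annulus c p q, 1 / 2 ≤ ‖u x‖) :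
    discEnergy ε u A U ⟨c, p⟩ + (q - p) / (6400 * ε) ≤ discEnergy ε u A U ⟨c, q⟩ := by
  have hq0 : 0 < q := hp.trans_le hpq
  have hqΩ : Metric.closedBall c q ⊆ Ω := by
    rw [← closure_ball c hq0.ne']
    exact (closure_mono hU).trans h.closure_subset
  have hpU : Metric.ball c p ⊆ U := (Metric.ball_subset_ball hpq).trans hU
  have haU : annulus c p q ⊆ Metric.ball c q := fun x hx => hx.2
  have h1 := annulus_covGradSq h.isOpen h.contDiffOn h.contDiffOn_field hp hpq hqΩ hd hf
  have hiE := h.integrableOn_energy ε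
  have hiC := h.integrableOn_curl_sq
  have h2 : (∫ x in Metric.ball c p, (covGradSq u A x + potential ε u x)) +
      ∫ x in annulus c p q, (covGradSq u A x + potential ε u x) ≤
      ∫ x in Metric.ball c q, (covGradSq u A x + potential ε u x) := by
    rw [← setIntegral_union _ (isOpen_annulus c p q).measurableSet (hiE.mono_set hpU)
      (hiE.mono_set (haU.trans hU))]
    · exact setIntegral_mono_set (hiE.mono_set hU)
        (ae_of_all _ fun x => energyDensity_nonneg ε u A x)
        (Set.union_subset (Metric.ball_subset_ball hpq) haU).eventuallyLE
    · exact Set.disjoint_left.2 fun x hx hx' => lt_asymm (Metric.mem_ball.1 hx) hx'.1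
  have h3 : ∫ x in annulus c p q, covGradSq u A x ≤
      ∫ x in annulus c p q, (covGradSq u A x + potential ε u x) := by
    refine setIntegral_mono ?_ (hiE.mono_set (haU.trans hU)) fun x => ?_
    · exact (h.integrableOn (continuousOn_covGradSq h.isOpen h.contDiffOn subset_rfl
        h.contDiffOn_field.continuousOn)).mono_set (haU.trans hU)
    · exact le_add_of_nonneg_right (potential_nonneg ε u x)
  have h4 : ∫ x in Metric.ball c p, curl A x ^ 2 ≤ ∫ x in Metric.ball c q, curl A x ^ 2 :=
    setIntegral_mono_set (hiC.mono_set hU) (ae_of_all _ fun x => sq_nonneg _)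
      (Metric.ball_subset_ball hpq).eventuallyLE
  -- From `log (q/p) ≥ 1 - p/q` the gain is at least `π d² (q - p) / (4q)`, and `q ≤ 10 ε |d| ≤ 10 ε
  -- d²` turns it into a multiple of `(q - p)/ε`.
  have h5 : (q - p) / (6400 * ε) ≤ Real.pi / 4 * d ^ 2 * Real.log (q / p) := by
    have h6 : 1 - p / q ≤ Real.log (q / p) := by
      have := Real.one_sub_inv_le_log_of_pos (div_pos hq0 hp)
      rwa [inv_div] at this
    have h7 : 0 ≤ 1 - p / q := by rw [sub_nonneg, div_le_one hq0]; exact hpq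
    have h8 : (q - p) / (6400 * ε) = (1 - p / q) * (q / (6400 * ε)) := by field_simp
    have h9 : q / (6400 * ε) ≤ Real.pi / 4 * d ^ 2 := by
      rw [div_le_iff₀ (by positivity)]
      have h10 : |d| ≤ d ^ 2 := by rw [← sq_abs]; nlinarith
      have h11 : ε * |d| ≤ ε * d ^ 2 := by gcongr
      have h12 : ε * d ^ 2 * 3 ≤ ε * d ^ 2 * Real.pi :=
        mul_le_mul_of_nonneg_left Real.pi_gt_three.le (by positivity)
      nlinarith [Real.pi_gt_three, mul_nonneg hε.le (sq_nonneg d)]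
    rw [h8, mul_comm]
    exact mul_le_mul h9 h6 h7 (by positivity)
  simp only [discEnergy, Set.inter_eq_left.2 hpU, Set.inter_eq_left.2 hU]
  -- The curl term lost in `annulus_covGradSq` is covered by the increase of the weight in
  -- `discEnergy` from `p²/16` to `q²/16`.
  have h13 : p ^ 2 / 16 * ∫ x in Metric.ball c p, curl A x ^ 2 ≤
      p ^ 2 / 16 * ∫ x in Metric.ball c q, curl A x ^ 2 := by gcongr
  linarith

/-- Collections that cover the part of `U'` where the modulus is far from one, and whose energy is
bounded from below by their total radius. -/
structure IsCore (ε L : ℝ) (u : Plane → ℂ) (A : Plane → Plane) (U U' : Set Plane)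
    (𝓒 : Finset Disc) : Prop where
  collection : IsDiscCollection 𝓒
  nonempty : 𝓒.Nonempty
  cover : ∀ x ∈ U', 1 / 2 ≤ |‖u x‖ - 1| → ∃ B ∈ 𝓒, x ∈ Metric.ball B.center B.radius
  totalRadius_le : totalRadius 𝓒 ≤ L
  energy : (totalRadius 𝓒 - ε) / (6400 * ε) ≤ ∑ B ∈ 𝓒, discEnergy ε u A U B

open Classical in
/-- The discs of small radius compared to their degree. -/
noncomputable def smallDiscs (ε : ℝ) (u : Plane → ℂ) (U' : Set Plane) (𝓒 : Finset Disc) :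
    Finset Disc :=
  (discsIn 𝓒 U').filter fun B => B.radius < 10 * ε * |deg u B|

variable {U' : Set Plane}

/-- Merging of a core some of whose discs have been enlarged. -/
lemma IsCore.merge (h : IsConfiguration Ω U u A) {ε L : ℝ} {𝓒 : Finset Disc} {D : Disc → Disc}
    (hC : 𝓒.Nonempty)
    (hr : ∀ B ∈ 𝓒, 0 < (D B).radius)
    (hcov : ∀ x ∈ U', 1 / 2 ≤ |‖u x‖ - 1| → ∃ B ∈ 𝓒, x ∈ Metric.ball (D B).center (D B).radius)
    (hL : ∑ B ∈ 𝓒, (D B).radius ≤ L)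
    (hd : (↑𝓒 : Set Disc).PairwiseDisjoint fun i => Metric.ball (D i).center (D i).radius)
    (hE : (∑ B ∈ 𝓒, (D B).radius - ε) / (6400 * ε) ≤ ∑ B ∈ 𝓒, discEnergy ε u A U (D B)) :
    ∃ 𝓒', IsCore ε L u A U U' 𝓒' ∧ 𝓒'.card ≤ 𝓒.card ∧
      ((∃ i ∈ 𝓒, ∃ j ∈ 𝓒, i ≠ j ∧ ¬ Disjoint (D i).toSet (D j).toSet) → 𝓒'.card < 𝓒.card) := by
  classical
  obtain ⟨𝓒', p, hcol, hp, hrad, hcard, hlt⟩ := exists_merge 𝓒.card 𝓒 D rfl hr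
  have htot : totalRadius 𝓒' = ∑ B ∈ 𝓒, (D B).radius :=
    totalRadius_merge (fun i hi => (hp i hi).1) hrad
  refine ⟨𝓒', ⟨hcol, ?_, ?_, htot.trans_le hL, ?_⟩, hcard, hlt⟩
  · obtain ⟨B, hB⟩ := hC
    exact ⟨p B, (hp B hB).1⟩
  · intro x hx hx1
    obtain ⟨B, hB, hxB⟩ := hcov x hx hx1
    exact ⟨p B, (hp B hB).1, ball_subset_ball_of_toSet (hr B hB)
      (hcol.radius_pos _ (hp B hB).1) (hp B hB).2 hxB⟩
  · rw [htot]
    refine hE.trans ?_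
    rw [← Finset.sum_fiberwise_of_maps_to (fun i hi => (hp i hi).1)]
    refine Finset.sum_le_sum fun K hK => sum_discEnergy_le h ε
      (fun i hi => hr i (Finset.mem_filter.1 hi).1) (hcol.radius_pos K hK) ?_ ?_ ?_
    · exact hd.subset fun i hi => (Finset.mem_filter.1 hi).1
    · intro i hi
      obtain ⟨hi, hpi⟩ := Finset.mem_filter.1 hi
      exact hpi ▸ (hp i hi).2
    · intro i hi
      obtain ⟨hi, hpi⟩ := Finset.mem_filter.1 hi
      exact radius_le_of_merge hr (hrad K hK) hi hpi

lemma lt_infDist_of_closedBall_subset {S : Set Plane} (hS : IsOpen S) (hne : Sᶜ.Nonempty)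
    {c : Plane} {ρ : ℝ} (h : Metric.closedBall c ρ ⊆ S) : ρ < Metric.infDist c Sᶜ := by
  obtain ⟨y, hy, hyd⟩ := hS.isClosed_compl.exists_infDist_eq_dist hne c
  rw [hyd]
  by_contra! hcon
  exact hy (h (by rw [Metric.mem_closedBall, dist_comm]; exact hcon))

lemma ball_infDist_compl_subset (S : Set Plane) (c : Plane) :
    Metric.ball c (Metric.infDist c Sᶜ) ⊆ S := by
  intro x hx
  by_contra hxS
  have := Metric.infDist_le_dist_of_mem (x := c) (s := Sᶜ) hxS
  rw [Metric.mem_ball, dist_comm] at hx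
  linarith

lemma sum_update {𝓒 : Finset Disc} [DecidableEq Disc] {B B₁ : Disc} (hB : B ∈ 𝓒) (g : Disc → ℝ) :
    ∑ i ∈ 𝓒, g (Function.update id B B₁ i) = ∑ i ∈ 𝓒, g i + (g B₁ - g B) := by
  rw [← Finset.add_sum_erase _ _ hB, ← Finset.add_sum_erase 𝓒 g hB]
  have : ∑ i ∈ 𝓒.erase B, g (Function.update id B B₁ i) = ∑ i ∈ 𝓒.erase B, g i :=
    Finset.sum_congr rfl fun i hi => by simp [Function.update_of_ne (Finset.ne_of_mem_erase hi)]
  rw [this, Function.update_self]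
  ring

/-- On the boundary of a disc of a core the modulus is close to one. -/
lemma IsCore.near_one_of_mem_sphere {ε L : ℝ} {𝓒 : Finset Disc} (hC : IsCore ε L u A U U' 𝓒)
    {B : Disc} (hB : B ∈ 𝓒) (hBU : B.toSet ⊆ U') {x : Plane} (hx : dist x B.center = B.radius) :
    |‖u x‖ - 1| < 1 / 2 := by
  have hxB : x ∈ B.toSet := hx.le
  by_contra! hcon
  obtain ⟨B', hB', hxB'⟩ := hC.cover x (hBU hxB) hcon
  obtain rfl := hC.collection.eq_of_mem hB hB' hxB (ball_subset_toSet _ hxB')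
  exact (Metric.mem_ball.1 hxB').ne hx

lemma ne_zero_of_near_one {x : Plane} (h : |‖u x‖ - 1| < 1 / 2) : u x ≠ 0 := fun h0 => by
  rw [h0, norm_zero] at h
  norm_num at h

lemma IsCore.one_le_abs_deg (h : IsConfiguration Ω U u A) {ε L : ℝ} {𝓒 : Finset Disc}
    (hU'U : U' ⊆ U) (hC : IsCore ε L u A U U' 𝓒) {B : Disc} (hB : B ∈ 𝓒) (hBU : B.toSet ⊆ U')
    (hd : deg u B ≠ 0) : 1 ≤ |deg u B| := by
  have hs : ∀ θ, dist (B.bdryPoint θ) B.center = B.radius := fun θ =>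
    bdryPoint_mem_sphere (hC.collection.radius_pos B hB) θ
  obtain ⟨k, hk⟩ := deg_int h.isOpen h.contDiffOn (B := B)
    (fun θ => h.subset (hU'U (hBU (hs θ).le)))
    (fun θ => ne_zero_of_near_one (hC.near_one_of_mem_sphere hB hBU (hs θ)))
  rw [hk] at hd ⊢
  exact_mod_cast Int.one_le_abs (by exact_mod_cast hd)

/-- The small disc is enlarged until the first of four events: it is no longer small, the total
radius reaches `L`, it reaches the complement of `U'`, or it touches another disc. Until then the
modulus is near one on the annulus, so the degree is unchanged and `discEnergy_grow` yields the
required energy. Touching discs are merged, which lowers their number. -/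
lemma IsCore.step (h : IsConfiguration Ω U u A) {ε L : ℝ} (hε : 0 < ε) {𝓒 : Finset Disc}
    (hU' : IsOpen U') (hU'U : U' ⊆ U) (hne : U'ᶜ.Nonempty) (hC : IsCore ε L u A U U' 𝓒)
    (hlt : totalRadius 𝓒 < L) {B : Disc} (hB : B ∈ smallDiscs ε u U' 𝓒) :
    ∃ 𝓒', IsCore ε L u A U U' 𝓒' ∧ (totalRadius 𝓒' = L ∨ 𝓒'.card < 𝓒.card ∨
      (𝓒'.card ≤ 𝓒.card ∧ (smallDiscs ε u U' 𝓒').card < (smallDiscs ε u U' 𝓒).card)) := by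
  classical
  have hBs := hB
  rw [smallDiscs, Finset.mem_filter, mem_discsIn] at hB
  obtain ⟨⟨hB, hBU⟩, hsmall⟩ := hB
  have hcol := hC.collection
  have hρ0 := hcol.radius_pos B hB
  have hd1 : 1 ≤ |deg u B| := hC.one_le_abs_deg h hU'U hB hBU fun h0 => by
    rw [h0, abs_zero, mul_zero] at hsmall; exact lt_asymm hρ0 hsmall
  set touch : Disc → ℝ := fun B' => dist B.center B'.center - B'.radius with htouch
  set vals : Finset ℝ := insert (10 * ε * |deg u B|) (insert (B.radius + (L - totalRadius 𝓒))
    (insert (Metric.infDist B.center U'ᶜ) ((𝓒.erase B).image touch))) with hvals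
  have hvne : vals.Nonempty := Finset.insert_nonempty _ _
  set ρ := vals.min' hvne with hρ
  have hρmem : ρ ∈ vals := Finset.min'_mem _ _
  have hlow : B.radius < ρ := by
    rw [hρ, Finset.lt_min'_iff]
    intro y hy
    rw [hvals, Finset.mem_insert, Finset.mem_insert, Finset.mem_insert, Finset.mem_image] at hy
    rcases hy with rfl | rfl | rfl | ⟨B', hB', rfl⟩
    · exact hsmall
    · linarith
    · exact lt_infDist_of_closedBall_subset hU' hne hBU
    · have := radius_add_lt_dist hρ0 (hcol.radius_pos B' (Finset.mem_of_mem_erase hB'))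
        (hcol.disjoint B hB B' (Finset.mem_of_mem_erase hB') (Finset.ne_of_mem_erase hB').symm)
      simp only [htouch]
      linarith
  have hρ1 : ρ ≤ 10 * ε * |deg u B| := Finset.min'_le _ _ (by simp [hvals])
  have hρ2 : ρ ≤ B.radius + (L - totalRadius 𝓒) := Finset.min'_le _ _ (by simp [hvals])
  have hρ3 : ρ ≤ Metric.infDist B.center U'ᶜ := Finset.min'_le _ _ (by simp [hvals])
  have hρ4 : ∀ B' ∈ 𝓒, B' ≠ B → ρ ≤ touch B' := fun B' hB' hne' => Finset.min'_le _ _ (by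
    rw [hvals, Finset.mem_insert, Finset.mem_insert, Finset.mem_insert]
    exact Or.inr (Or.inr (Or.inr (Finset.mem_image_of_mem _ (Finset.mem_erase.2 ⟨hne', hB'⟩)))))
  have hballU' : Metric.ball B.center ρ ⊆ U' :=
    (Metric.ball_subset_ball hρ3).trans (ball_infDist_compl_subset U' B.center)
  have hother : ∀ x, dist x B.center < ρ → ∀ B' ∈ 𝓒, B' ≠ B → x ∉ B'.toSet := by
    intro x hx B' hB' hne' hxB'
    have h1 := hρ4 B' hB' hne'
    have h2 := dist_triangle_left B.center B'.center x
    have h3 : dist x B'.center ≤ B'.radius := hxB'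
    simp only [htouch] at h1
    linarith
  have hnear : ∀ x, B.radius ≤ dist x B.center → dist x B.center < ρ → |‖u x‖ - 1| < 1 / 2 := by
    intro x hx1 hx2
    by_contra! hcon
    obtain ⟨B', hB', hxB'⟩ := hC.cover x (hballU' hx2) hcon
    by_cases e : B' = B
    · subst e; exact not_lt.2 hx1 hxB'
    · exact hother x hx2 B' hB' e (ball_subset_toSet _ hxB')
  have hdeg : ∀ ρ', B.radius < ρ' → Metric.closedBall B.center ρ' ⊆ U' →
      (∀ x, B.radius ≤ dist x B.center → dist x B.center ≤ ρ' → u x ≠ 0) →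
      deg u ⟨B.center, ρ'⟩ = deg u B := by
    intro ρ' h1 h2 h3
    have hs : IsDiscCollection {B} := hcol.subset (by simpa using hB)
    have := deg_eq_sum h.isOpen h.contDiffOn (K := ⟨B.center, ρ'⟩) (hρ0.trans h1)
      ((h2.trans hU'U).trans h.subset) hs (by
        intro B' hB'
        obtain rfl := Finset.mem_singleton.1 hB'
        exact Metric.closedBall_subset_closedBall h1.le) (by
        intro x hx hx'
        have := hx' B (Finset.mem_singleton_self B)
        exact h3 x (not_lt.1 this) hx)
    rwa [Finset.sum_singleton] at this
  set B₁ : Disc := ⟨B.center, ρ⟩ with hB₁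
  have hgrow : discEnergy ε u A U B + (ρ - B.radius) / (6400 * ε) ≤ discEnergy ε u A U B₁ := by
    refine discEnergy_grow h hε hρ0 hlow.le (hballU'.trans hU'U) hd1 hρ1 (fun ρ' hρ' => ?_) ?_
    · exact hdeg ρ' hρ'.1 ((Metric.closedBall_subset_ball hρ'.2).trans hballU')
        fun x hx1 hx2 => ne_zero_of_near_one (hnear x hx1 (hx2.trans_lt hρ'.2))
    · intro x hx
      have := (abs_lt.1 (hnear x hx.1.le hx.2)).1
      linarith
  set D : Disc → Disc := Function.update id B B₁ with hD
  have hDB : D B = B₁ := Function.update_self _ _ _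
  have hDne : ∀ B' ≠ B, D B' = B' := fun B' hB' => Function.update_of_ne hB' _ _
  have hsumr : ∑ B' ∈ 𝓒, (D B').radius = totalRadius 𝓒 + (ρ - B.radius) :=
    sum_update hB Disc.radius
  have hsumE : ∑ B' ∈ 𝓒, discEnergy ε u A U (D B') = ∑ B' ∈ 𝓒, discEnergy ε u A U B' +
      (discEnergy ε u A U B₁ - discEnergy ε u A U B) := sum_update hB _
  have hr : ∀ B' ∈ 𝓒, 0 < (D B').radius := by
    intro B' hB'
    by_cases e : B' = B
    · rw [e, hDB]; exact hρ0.trans hlow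
    · rw [hDne B' e]; exact hcol.radius_pos B' hB'
  have hcov : ∀ x ∈ U', 1 / 2 ≤ |‖u x‖ - 1| →
      ∃ B' ∈ 𝓒, x ∈ Metric.ball (D B').center (D B').radius := by
    intro x hx hx1
    obtain ⟨B', hB', hxB'⟩ := hC.cover x hx hx1
    refine ⟨B', hB', ?_⟩
    by_cases e : B' = B
    · rw [e, hDB]; rw [e] at hxB'; exact Metric.ball_subset_ball hlow.le hxB'
    · rwa [hDne B' e]
  have hL : ∑ B' ∈ 𝓒, (D B').radius ≤ L := by rw [hsumr]; linarith
  have hE : (∑ B' ∈ 𝓒, (D B').radius - ε) / (6400 * ε) ≤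
      ∑ B' ∈ 𝓒, discEnergy ε u A U (D B') := by
    rw [hsumr, hsumE]
    have e : (totalRadius 𝓒 + (ρ - B.radius) - ε) / (6400 * ε) =
      (totalRadius 𝓒 - ε) / (6400 * ε) + (ρ - B.radius) / (6400 * ε) := by ring
    have := hC.energy
    linarith
  by_cases hdis : ∀ B' ∈ 𝓒, B' ≠ B → Disjoint B₁.toSet B'.toSet
  · have hD_dis : ∀ i ∈ 𝓒, ∀ j ∈ 𝓒, i ≠ j → Disjoint (D i).toSet (D j).toSet := by
      intro i hi j hj hij
      by_cases ei : i = B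
      · rw [ei, hDB, hDne j fun e => hij (ei.trans e.symm)]
        exact hdis j hj fun e => hij (ei.trans e.symm)
      · by_cases ej : j = B
        · rw [ej, hDB, hDne i ei]; exact (hdis i hi ei).symm
        · rw [hDne i ei, hDne j ej]; exact hcol.disjoint i hi j hj hij
    have hinj : Set.InjOn D ↑𝓒 := by
      intro i hi j hj hij
      by_contra hne'
      have := hD_dis i hi j hj hne'
      rw [hij] at this
      exact Set.disjoint_left.1 this (center_mem_toSet (hr j hj)) (center_mem_toSet (hr j hj))
    have hcore : IsCore ε L u A U U' (𝓒.image D) := by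
      have htot : totalRadius (𝓒.image D) = ∑ B' ∈ 𝓒, (D B').radius := Finset.sum_image hinj
      refine ⟨⟨?_, ?_⟩, hC.nonempty.image D, ?_, htot.trans_le hL, ?_⟩
      · intro B' hB'
        obtain ⟨i, hi, rfl⟩ := Finset.mem_image.1 hB'
        exact hr i hi
      · intro B' hB' B'' hB'' hne'
        obtain ⟨i, hi, rfl⟩ := Finset.mem_image.1 hB'
        obtain ⟨j, hj, rfl⟩ := Finset.mem_image.1 hB''
        exact hD_dis i hi j hj fun e => hne' (by rw [e])
      · intro x hx hx1
        obtain ⟨B', hB', hxB'⟩ := hcov x hx hx1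
        exact ⟨D B', Finset.mem_image_of_mem D hB', hxB'⟩
      · rw [htot, Finset.sum_image hinj]; exact hE
    refine ⟨𝓒.image D, hcore, ?_⟩
    -- If the enlarged disc is not small, every small disc of the new collection was small before,
    -- and `B` has disappeared.
    have hlast : B₁ ∉ smallDiscs ε u U' (𝓒.image D) →
        (𝓒.image D).card ≤ 𝓒.card ∧
          (smallDiscs ε u U' (𝓒.image D)).card < (smallDiscs ε u U' 𝓒).card := by
      intro hnot
      refine ⟨Finset.card_image_le, Finset.card_lt_card ?_⟩
      refine Finset.ssubset_iff_of_subset ?_ |>.2 ⟨B, hBs, ?_⟩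
      · intro B' hB'
        have hB'2 := hB'
        rw [smallDiscs, Finset.mem_filter, mem_discsIn, Finset.mem_image] at hB'
        obtain ⟨⟨⟨i, hi, rfl⟩, h2⟩, h3⟩ := hB'
        by_cases ei : i = B
        · rw [ei, hDB] at hB'2; exact absurd hB'2 hnot
        · rw [hDne i ei] at h2 h3 ⊢
          rw [smallDiscs, Finset.mem_filter, mem_discsIn]
          exact ⟨⟨hi, h2⟩, h3⟩
      · intro hB'
        rw [smallDiscs, Finset.mem_filter, mem_discsIn, Finset.mem_image] at hB'
        obtain ⟨⟨⟨i, hi, hiB⟩, -⟩, -⟩ := hB'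
        by_cases ei : i = B
        · rw [ei, hDB] at hiB
          have : ρ = B.radius := by rw [← hiB]
          linarith
        · rw [hDne i ei] at hiB; exact ei hiB
    rw [hvals, Finset.mem_insert, Finset.mem_insert, Finset.mem_insert, Finset.mem_image] at hρmem
    rcases hρmem with e | e | e | ⟨B', hB', e⟩
    · refine Or.inr (Or.inr (hlast fun hmem => ?_))
      rw [smallDiscs, Finset.mem_filter, mem_discsIn] at hmem
      obtain ⟨⟨-, hU1⟩, h1⟩ := hmem
      have : deg u B₁ = deg u B := by
        refine hdeg ρ hlow hU1 fun x hx1 hx2 => ne_zero_of_near_one ?_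
        rcases hx2.lt_or_eq with hx2 | hx2
        · exact hnear x hx1 hx2
        · exact hcore.near_one_of_mem_sphere (B := B₁)
            (hDB ▸ Finset.mem_image_of_mem D hB) hU1 hx2
      rw [this] at h1
      exact h1.ne e
    · refine Or.inl ?_
      have : totalRadius (𝓒.image D) = ∑ B' ∈ 𝓒, (D B').radius := Finset.sum_image hinj
      rw [this, hsumr, e]; ring
    · refine Or.inr (Or.inr (hlast fun hmem => ?_))
      rw [smallDiscs, Finset.mem_filter, mem_discsIn] at hmem
      obtain ⟨⟨-, hU1⟩, -⟩ := hmem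
      have := lt_infDist_of_closedBall_subset hU' hne hU1
      exact this.ne e
    · exfalso
      have hB'C := Finset.mem_of_mem_erase hB'
      have := radius_add_lt_dist (hρ0.trans hlow : 0 < B₁.radius) (hcol.radius_pos B' hB'C)
        (hdis B' hB'C (Finset.ne_of_mem_erase hB'))
      simp only [htouch, hB₁] at e this
      linarith
  · push Not at hdis
    obtain ⟨B', hB', hne', hnd⟩ := hdis
    obtain ⟨𝓒', h1, -, h2⟩ := IsCore.merge h (U' := U') (L := L) hC.nonempty hr hcov hL (by
      intro i hi j hj hij
      refine Set.disjoint_left.2 fun x hxi hxj => ?_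
      change x ∈ Metric.ball (D i).center (D i).radius at hxi
      change x ∈ Metric.ball (D j).center (D j).radius at hxj
      by_cases ei : i = B
      · have hj' : j ≠ B := fun e => hij (ei.trans e.symm)
        rw [ei, hDB] at hxi
        rw [hDne j hj'] at hxj
        exact hother x hxi j hj hj' (ball_subset_toSet _ hxj)
      · rw [hDne i ei] at hxi
        by_cases ej : j = B
        · rw [ej, hDB] at hxj
          exact hother x hxj i hi ei (ball_subset_toSet _ hxi)
        · rw [hDne j ej] at hxj
          exact Set.disjoint_left.1 (hcol.disjoint i hi j hj hij) (ball_subset_toSet _ hxi)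
            (ball_subset_toSet _ hxj)) hE
    refine ⟨𝓒', h1, Or.inr (Or.inl (h2 ⟨B, hB, B', hB', hne'.symm, ?_⟩))⟩
    rwa [hDB, hDne B' hne']

/-- Starting from any core there is a core that either is as large as possible or has no small
discs. -/
lemma IsCore.exists_final (h : IsConfiguration Ω U u A) {ε L : ℝ} (hε : 0 < ε) {𝓒₀ : Finset Disc}
    (hU' : IsOpen U') (hU'U : U' ⊆ U) (hne : U'ᶜ.Nonempty) (hC₀ : IsCore ε L u A U U' 𝓒₀) :
    ∃ 𝓒, IsCore ε L u A U U' 𝓒 ∧ (totalRadius 𝓒 = L ∨ smallDiscs ε u U' 𝓒 = ∅) := by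
  by_contra! hcon
  -- Lexicographic descent: the number of discs is minimised first, then the number of small discs
  -- among the cores with no more discs.
  obtain ⟨𝓒, hC, hmin⟩ := (measure fun 𝓓 : Finset Disc => 𝓓.card).wf.has_min
    {𝓒 | IsCore ε L u A U U' 𝓒} ⟨𝓒₀, hC₀⟩
  obtain ⟨𝓓, ⟨hD, hDc⟩, hmin'⟩ := (measure fun 𝓓 => (smallDiscs ε u U' 𝓓).card).wf.has_min
    {𝓓 | IsCore ε L u A U U' 𝓓 ∧ 𝓓.card ≤ 𝓒.card} ⟨𝓒, hC, le_rfl⟩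
  obtain ⟨hne1, hne2⟩ := hcon 𝓓 hD
  obtain ⟨B, hB⟩ := hne2
  obtain ⟨𝓓', hD', h1 | h1 | h1⟩ := hD.step h hε hU' hU'U hne
    (lt_of_le_of_ne hD.totalRadius_le hne1) hB
  · exact (hcon 𝓓' hD').1 h1
  · exact hmin 𝓓' hD' (lt_of_lt_of_le h1 hDc)
  · exact hmin' 𝓓' ⟨hD', h1.1.trans hDc⟩ h1.2

end Core

end VortexBalls

namespace VortexBalls

open MeasureTheory

/-! ### The energy cover, the first core and the assembly of both phases -/

section Start

variable {Ω U : Set Plane} {u : Plane → ℂ} {A : Plane → Plane}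

open Classical in
/-- The part of `U` outside of the discs of a collection that are not contained in `U`. -/
def goodPart (U : Set Plane) (𝓐 : Finset Disc) : Set Plane :=
  U \ discUnion (𝓐.filter fun B => ¬ B.toSet ⊆ U)

lemma mem_goodPart {𝓐 : Finset Disc} {x : Plane} :
    x ∈ goodPart U 𝓐 ↔ x ∈ U ∧ ∀ B ∈ 𝓐, x ∈ B.toSet → B.toSet ⊆ U := by
  simp only [goodPart, Set.mem_sdiff, mem_discUnion, Finset.mem_filter]
  push Not
  exact and_congr_right fun _ => ⟨fun h B hB hx => by_contra fun hn => h B ⟨hB, hn⟩ hx,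
    fun h B hB hx => hB.2 (h B hB.1 hx)⟩

lemma IsConfiguration.isCompact_far (h : IsConfiguration Ω U u A) (δ : ℝ) :
    IsCompact {x | x ∈ closure U ∧ δ ≤ |‖u x‖ - 1|} := by
  have hc : ContinuousOn (fun x => |‖u x‖ - 1|) (closure U) :=
    ((h.contDiffOn.continuousOn.mono h.closure_subset).norm.sub continuousOn_const).abs
  refine h.isCompact_closure.of_isClosed_subset ?_ fun x hx => hx.1
  exact hc.preimage_isClosed_of_isClosed isClosed_closure isClosed_Ici

/-- Two thresholds are used: `𝓐` covers all points where the modulus differs from one by `δ`, the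
core only those where it differs by `1/2`, with a total radius of the smaller order `ε + E ε`.
Energy counts for the core only inside `U`; hence it uses only covering discs that lie in a disc of
`𝓐` inside `U`, and `goodPart` discards the rest. -/
lemma exists_cover_and_core (h : IsConfiguration Ω U u A) {ε δ E L : ℝ} (hε : 0 < ε) (hδ : 0 < δ)
    (hδ' : δ ≤ 1 / 2) (hE : 0 ≤ E) (hen : modulusEnergy ε u Ω ≤ ENNReal.ofReal E)
    (hB : ∀ x ∈ closure U, Metric.closedBall x (ε / 2) ⊆ Ω) (hL : ε + 12800 * (E * ε) ≤ L) :
    ∃ 𝓐 𝓒, IsDiscCollection 𝓐 ∧ totalRadius 𝓐 ≤ 3200 * (E * ε) / δ ^ 2 ∧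
      (∀ x ∈ U, δ ≤ |‖u x‖ - 1| → x ∈ discUnion 𝓐) ∧ IsCore ε L u A U (goodPart U 𝓐) 𝓒 := by
  classical
  obtain ⟨F₁, hF₁, hcov₁⟩ := exists_energy_cover h.isOpen h.contDiffOn hε (by norm_num) le_rfl
    (h.isCompact_far (1 / 2)) (fun x hx => hB x hx.1) fun x hx => hx.2
  obtain ⟨F₂, hF₂, hcov₂⟩ := exists_energy_cover h.isOpen h.contDiffOn hε hδ hδ'
    (h.isCompact_far δ) (fun x hx => hB x hx.1) fun x hx => hx.2
  have hF : ∀ B ∈ F₁ ∪ F₂, 0 < B.radius ∧ B.toSet ⊆ Ω ∧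
      δ ^ 2 / (400 * ε) * B.radius ≤ ∫ x in B.toSet, modDensity ε u x := by
    intro B hBF
    rcases Finset.mem_union.1 hBF with hBF | hBF
    · obtain ⟨h1, h2, h3⟩ := hF₁ B hBF
      refine ⟨h1, h2, le_trans ?_ h3⟩
      gcongr
    · exact hF₂ B hBF
  obtain ⟨V, hVF, hV, hVcov⟩ := exists_vitali (F₁ ∪ F₂) fun B hB => (hF B hB).1
  have hVtot := totalRadius_le_of_energy h.isOpen h.contDiffOn hE hen hV
    fun B hB => (hF B (hVF hB)).2
  have hV4 : ∀ B ∈ V, 0 < (B.dilate 4).radius := fun B hB =>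
    mul_pos (by norm_num) (hV.radius_pos B hB)
  obtain ⟨𝓐, p, hA, hp, hrad, -, -⟩ := exists_merge V.card V (Disc.dilate 4) rfl hV4
  have hAtot : totalRadius 𝓐 = 4 * totalRadius V := by
    rw [totalRadius_merge (fun i hi => (hp i hi).1) hrad, totalRadius, Finset.mul_sum]
    rfl
  have hcovA : ∀ B ∈ F₁ ∪ F₂, ∃ K ∈ 𝓐, B.toSet ⊆ K.toSet := fun B hB => by
    obtain ⟨B', hB', hsub⟩ := hVcov B hB
    exact ⟨p B', (hp B' hB').1, hsub.trans (hp B' hB').2⟩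
  set F₁' := F₁.filter fun B => ∃ K ∈ 𝓐, B.toSet ⊆ K.toSet ∧ K.toSet ⊆ U with hF₁'
  have hF₁'sub : ∀ B ∈ F₁', B ∈ F₁ ∧ B.toSet ⊆ U := fun B hB => by
    obtain ⟨h1, K, -, h2, h3⟩ := Finset.mem_filter.1 hB
    exact ⟨h1, h2.trans h3⟩
  obtain ⟨W, hWF, hW, hWcov⟩ := exists_vitali F₁' fun B hB => (hF₁ B (hF₁'sub B hB).1).1
  have hWen : ∀ B ∈ W, B.toSet ⊆ Ω ∧
      1 / (1600 * ε) * B.radius ≤ ∫ x in B.toSet, modDensity ε u x := fun B hB => by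
    obtain ⟨-, h2, h3⟩ := hF₁ B (hF₁'sub B (hWF hB)).1
    refine ⟨h2, le_trans (le_of_eq ?_) h3⟩
    congr 1
    field_simp
    norm_num
  have hWtot := totalRadius_le_of_energy h.isOpen h.contDiffOn hE hen hW hWen
  -- An auxiliary disc of radius `ε` makes the core nonempty, so that its total radius is positive
  -- and can be grown to a prescribed value. It carries no energy, whence the `ε` subtracted in
  -- `IsCore`.
  set D : Option Disc → Disc := fun o => o.elim ⟨0, ε⟩ (Disc.dilate 4) with hD
  set s : Finset (Option Disc) := W.insertNone with hs
  have hDr : ∀ i ∈ s, 0 < (D i).radius := by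
    rintro (_ | B) hi
    · exact hε
    · exact mul_pos (by norm_num) (hW.radius_pos B (by simpa [hs] using hi))
  obtain ⟨𝓒, q, hC, hq, hrad', -, -⟩ := exists_merge s.card s D rfl hDr
  have hsome : ∀ B ∈ W, some B ∈ s := fun B hB => by simpa [hs] using hB
  have hCtot : totalRadius 𝓒 = ε + 4 * totalRadius W := by
    rw [totalRadius_merge (fun i hi => (hq i hi).1) hrad', hs, Finset.sum_insertNone,
      totalRadius, Finset.mul_sum]
    rfl
  have hball : ∀ B ∈ W, Metric.ball B.center (4 * B.radius) ⊆
      Metric.ball (q (some B)).center (q (some B)).radius := fun B hB =>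
    ball_subset_ball_of_toSet (hDr _ (hsome B hB)) (hC.radius_pos _ (hq _ (hsome B hB)).1)
      (hq _ (hsome B hB)).2
  refine ⟨𝓐, 𝓒, hA, ?_, ?_, ⟨hC, ⟨q none, (hq none (by simp [hs])).1⟩, ?_, ?_, ?_⟩⟩
  · rw [hAtot, le_div_iff₀ (by positivity)]
    have e : δ ^ 2 / (400 * ε) * totalRadius V = δ ^ 2 * totalRadius V / (400 * ε) := by ring
    rw [e, div_le_iff₀ (by positivity)] at hVtot
    linarith
  · intro x hx hxδ
    have := hcov₂ ⟨subset_closure hx, hxδ⟩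
    simp only [Set.mem_iUnion] at this
    obtain ⟨B, hB, hxB⟩ := this
    obtain ⟨K, hK, hsub⟩ := hcovA B (Finset.mem_union_right _ hB)
    exact mem_discUnion.2 ⟨K, hK, hsub (ball_subset_toSet _ hxB)⟩
  · intro x hx hx1
    obtain ⟨hxU, hxA⟩ := mem_goodPart.1 hx
    have := hcov₁ ⟨subset_closure hxU, hx1⟩
    simp only [Set.mem_iUnion] at this
    obtain ⟨B, hB, hxB⟩ := this
    obtain ⟨K, hK, hsub⟩ := hcovA B (Finset.mem_union_left _ hB)
    have hKU := hxA K hK (hsub (ball_subset_toSet _ hxB))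
    have hB' : B ∈ F₁' := Finset.mem_filter.2 ⟨hB, K, hK, hsub, hKU⟩
    obtain ⟨B', hBW, hsub'⟩ := hWcov B hB'
    exact ⟨q (some B'), (hq _ (hsome B' hBW)).1, hball B' hBW
      (ball_subset_ball_of_toSet (hF₁ B hB).1 (hDr _ (hsome B' hBW)) hsub' hxB)⟩
  · have e : 1 / (1600 * ε) * totalRadius W = totalRadius W / (1600 * ε) := by ring
    rw [e, div_le_iff₀ (by positivity)] at hWtot
    rw [hCtot]
    linarith
  -- The constant is `6400 = 4 · 1600`: at the threshold `1/2` a disc carries its radius divided by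
  -- `1600 ε`, and the Vitali enlargement multiplies radii by four.
  · have e : (totalRadius 𝓒 - ε) / (6400 * ε) =
        ∑ B ∈ W, 1 / (1600 * ε) * B.radius := by
      rw [hCtot, ← Finset.mul_sum, totalRadius]
      field_simp
      ring
    rw [e]
    refine (Finset.sum_le_sum fun B hB => (hWen B hB).2).trans ?_
    rw [← Finset.sum_fiberwise_of_maps_to (g := fun B => q (some B))
      fun B hB => (hq _ (hsome B hB)).1]
    refine Finset.sum_le_sum fun K hK => ?_
    have hsubK : ∀ B ∈ W.filter (fun B => q (some B) = K),
        B.toSet ⊆ Metric.ball K.center K.radius ∩ U := by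
      intro B hB
      obtain ⟨hB, hqB⟩ := Finset.mem_filter.1 hB
      refine Set.subset_inter (Set.Subset.trans ?_ (hqB ▸ hball B hB)) (hF₁'sub B (hWF hB)).2
      have := hW.radius_pos B hB
      exact Metric.closedBall_subset_ball (by linarith)
    have h1 : ∑ B ∈ W.filter (fun B => q (some B) = K), ∫ x in B.toSet, modDensity ε u x ≤
        ∫ x in Metric.ball K.center K.radius ∩ U, modDensity ε u x := by
      refine sum_setIntegral_le (fun B _ => (isClosed_toSet B).measurableSet) ?_ hsubK
        (measurableSet_ball_inter h K) ((h.integrableOn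
          (continuousOn_modDensity ε h.isOpen h.contDiffOn)).mono_set Set.inter_subset_right)
        fun x _ => modDensity_nonneg ε u x
      exact fun B hB B' hB' hne => hW.disjoint B (Finset.mem_filter.1 hB).1 B'
        (Finset.mem_filter.1 hB').1 hne
    have h2 : ∫ x in Metric.ball K.center K.radius ∩ U, modDensity ε u x ≤
        ∫ x in Metric.ball K.center K.radius ∩ U, (covGradSq u A x + potential ε u x) := by
      refine setIntegral_mono_on ((h.integrableOn
          (continuousOn_modDensity ε h.isOpen h.contDiffOn)).mono_set Set.inter_subset_right)
        ((h.integrableOn_energy ε).mono_set Set.inter_subset_right)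
        (measurableSet_ball_inter h K) fun x hx => ?_
      exact modDensity_le_cov ε ((h.contDiffOn.contDiffAt
        (h.isOpen.mem_nhds (h.subset hx.2))).differentiableAt one_ne_zero) A
    have h3 : 0 ≤ ∫ x in Metric.ball K.center K.radius ∩ U, curl A x ^ 2 :=
      integral_nonneg fun x => sq_nonneg _
    have h4 : 0 ≤ K.radius ^ 2 / 16 *
      ∫ x in Metric.ball K.center K.radius ∩ U, curl A x ^ 2 := by positivity
    rw [discEnergy]
    linarith

lemma isOpen_goodPart (h : IsConfiguration Ω U u A) (𝓐 : Finset Disc) : IsOpen (goodPart U 𝓐) :=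
  h.isOpen_sub.sdiff (isClosed_discUnion _)

lemma goodPart_subset (U : Set Plane) (𝓐 : Finset Disc) : goodPart U 𝓐 ⊆ U := fun _ hx => hx.1

lemma IsConfiguration.compl_nonempty (h : IsConfiguration Ω U u A) {U' : Set Plane} (hU : U' ⊆ U) :
    U'ᶜ.Nonempty := by
  rw [Set.nonempty_compl]
  rintro rfl
  have := h.isCompact_closure
  rw [Set.eq_univ_of_univ_subset (hU.trans subset_closure)] at this
  exact noncompact_univ Plane this

/-! ### Construction of the two phases -/

/-- The delayed family is grown. -/
lemma IsDiscGrowth.shift {𝓑 : ℝ → Finset Disc} {T : Finset ℝ} (h : IsDiscGrowth 𝓑 T) {τ : ℝ}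
    (hτ : 0 ≤ τ) : IsDiscGrowth (fun t => 𝓑 (t + τ)) (T.image fun t => t - τ) where
  collection t ht := h.collection _ (by linarith)
  union_subset t s ht hts := h.union_subset _ _ (by linarith) (by linarith)
  dilate t s ht hts hT B := by
    have := h.dilate (t + τ) (s + τ) (by linarith) (by linarith) (fun q hq hmem =>
      hT (q - τ) (Finset.mem_image_of_mem _ hq) ⟨by linarith [hmem.1], by linarith [hmem.2]⟩) B
    rw [show s + τ - (t + τ) = s - t by ring] at this
    exact this
  totalRadius_eq t ht := by
    rw [h.totalRadius_eq _ (by linarith), h.totalRadius_eq (0 + τ) (by linarith), Real.exp_add,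
      zero_add, mul_assoc]

/-- The two phases, constructed from a core and a covering. -/
structure IsAdapted (P : TwoPhase) (ε L δ r : ℝ) (u : Plane → ℂ) (A : Plane → Plane) (U : Set Plane)
    (U' : Set Plane) : Prop where
  additive : IsAdditiveGrowth P.famC P.timesC
  core : IsCore ε L u A U U' (P.famC 0)
  small : P.σ = 0 ∨ smallDiscs ε u U' (P.famC 0) = ∅
  subset : ∀ K ∈ discsIn (P.famB 0) U, K.toSet ⊆ U'
  growthB : IsDiscGrowth P.famB P.timesB
  σ_nonneg : 0 ≤ P.σ
  s_nonneg : 0 ≤ P.s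
  totalRadius_famC : totalRadius (P.famC P.σ) = L
  totalRadius_famB : totalRadius (P.famB 0) = 8 / 3 * L
  totalRadius_final : totalRadius P.final = r
  famC_subset : discUnion (P.famC P.σ) ⊆ discUnion (P.famB 0)
  cover_famB : {x | x ∈ U ∧ δ ≤ |‖u x‖ - 1|} ⊆ discUnion (P.famB 0)

lemma IsDiscCollection.totalRadius_pos {𝓒 : Finset Disc} (h : IsDiscCollection 𝓒)
    (hne : 𝓒.Nonempty) : 0 < totalRadius 𝓒 :=
  Finset.sum_pos h.radius_pos hne

/-- All durations are logarithms of ratios of total radii. The core grows to the total radius `L`;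
merged with the cover it has at most `L + 5L/3 = 8L/3`; a preliminary growth by `τ` makes this
exact, and a further growth by `s` leads to `r`. -/
lemma exists_isAdapted (h : IsConfiguration Ω U u A) {ε δ E L r : ℝ} (hε : 0 < ε) (hδ : 0 < δ)
    (hδ' : δ ≤ 1 / 2) (hE : 0 ≤ E) (hen : modulusEnergy ε u Ω ≤ ENNReal.ofReal E)
    (hB : ∀ x ∈ closure U, Metric.closedBall x (ε / 2) ⊆ Ω) (hL : ε + 12800 * (E * ε) ≤ L)
    (hL' : 3200 * (E * ε) / δ ^ 2 ≤ 5 / 3 * L) (hr : 8 / 3 * L ≤ r) :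
    ∃ (P : TwoPhase) (U' : Set Plane), U' ⊆ U ∧ IsAdapted P ε L δ r u A U U' := by
  classical
  obtain ⟨𝓐, 𝓒₀, hA, hAtot, hcov, hcore⟩ := exists_cover_and_core h hε hδ hδ' hE hen hB hL
  have hsub := goodPart_subset U 𝓐
  obtain ⟨𝓒, hC, hfin⟩ := hcore.exists_final h hε (isOpen_goodPart h 𝓐) hsub
    (h.compl_nonempty hsub)
  have hrc := hC.collection.totalRadius_pos hC.nonempty
  have hL0 : 0 < L := hrc.trans_le hC.totalRadius_le
  have hr0 : 0 < r := lt_of_lt_of_le (by positivity) hr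
  obtain ⟨famC, timesC, hgC, hC0⟩ := exists_growth 𝓒.card 𝓒 rfl hC.collection
  set σ := Real.log (L / totalRadius 𝓒) with hσ
  have hσ0 : 0 ≤ σ := Real.log_nonneg (by rw [le_div_iff₀ hrc]; linarith [hC.totalRadius_le])
  have hCσ : totalRadius (famC σ) = L := by
    rw [hgC.totalRadius_eq σ hσ0, hC0, hσ, Real.exp_log (by positivity)]
    field_simp
  have hcolσ := hgC.collection σ hσ0
  have hmr : ∀ B ∈ famC σ ∪ 𝓐, 0 < B.radius := fun B hB =>
    (Finset.mem_union.1 hB).elim (hcolσ.radius_pos B) (hA.radius_pos B)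
  obtain ⟨𝓜, p, hM, hp, hrad, -, -⟩ := exists_merge (famC σ ∪ 𝓐).card (famC σ ∪ 𝓐) id rfl hmr
  have hMtot : totalRadius 𝓜 ≤ 8 / 3 * L := by
    rw [totalRadius_merge (fun i hi => (hp i hi).1) hrad]
    have h1 : ∑ i ∈ famC σ ∪ 𝓐, (id i : Disc).radius ≤ totalRadius (famC σ) + totalRadius 𝓐 := by
      rw [totalRadius, totalRadius, ← Finset.sum_union_inter]
      exact le_add_of_nonneg_right (Finset.sum_nonneg fun B hB =>
        (hA.radius_pos B (Finset.mem_inter.1 hB).2).le)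
    rw [hCσ] at h1
    linarith
  have hMne : 𝓜.Nonempty := by
    have h1 : (famC σ).Nonempty := by
      rw [Finset.nonempty_iff_ne_empty]
      intro h0
      rw [h0, totalRadius, Finset.sum_empty] at hCσ
      exact hL0.ne hCσ
    obtain ⟨B, hB⟩ := h1
    exact ⟨p B, (hp B (Finset.mem_union_left _ hB)).1⟩
  have hM0 := hM.totalRadius_pos hMne
  obtain ⟨famM, timesM, hgM, hM0'⟩ := exists_growth 𝓜.card 𝓜 rfl hM
  set τ := Real.log (8 / 3 * L / totalRadius 𝓜) with hτ
  have hτ0 : 0 ≤ τ := Real.log_nonneg (by rw [le_div_iff₀ hM0]; linarith)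
  set s := Real.log (r / (8 / 3 * L)) with hs
  have hs0 : 0 ≤ s := Real.log_nonneg (by rw [le_div_iff₀ (by positivity)]; linarith)
  have hB0 : totalRadius (famM (0 + τ)) = 8 / 3 * L := by
    rw [zero_add, hgM.totalRadius_eq τ hτ0, hM0', hτ, Real.exp_log (by positivity)]
    field_simp
  have hgB := hgM.toIsDiscGrowth.shift hτ0
  have hMB : discUnion 𝓜 ⊆ discUnion (famM (0 + τ)) := by
    rw [← hM0', zero_add]; exact hgM.union_subset 0 τ le_rfl hτ0
  have hAB : ∀ B ∈ famC σ ∪ 𝓐, B.toSet ⊆ discUnion (famM (0 + τ)) := fun B hB x hx =>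
    hMB (mem_discUnion.2 ⟨p B, (hp B hB).1, (hp B hB).2 hx⟩)
  have hC' : IsCore ε L u A U (goodPart U 𝓐) (famC 0) := by rw [hC0]; exact hC
  refine ⟨⟨famC, timesC, σ, fun t => famM (t + τ), timesM.image fun t => t - τ, s⟩,
    goodPart U 𝓐, hsub, ?_⟩
  refine ⟨hgC, hC', ?_, ?_, hgB, hσ0, hs0, hCσ, hB0, ?_, ?_, ?_⟩
  · dsimp only
    rw [hC0]
    refine hfin.imp_left fun e => ?_
    rw [hσ, e, div_self hL0.ne', Real.log_one]
  · intro K hK x hx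
    rw [mem_discsIn] at hK
    -- A covering disc that meets `K` lies in `K`, because it is contained in the union of the
    -- disjoint discs of the second family; hence it lies in `U`.
    refine mem_goodPart.2 ⟨hK.2 hx, fun B hB hxB => ?_⟩
    exact ((hgB.collection 0 le_rfl).toSet_subset (hAB B (Finset.mem_union_right _ hB)) hK.1 hxB
      hx).trans hK.2
  · change totalRadius (famM (s + τ)) = r
    rw [hgB.totalRadius_eq s hs0, hB0, hs, Real.exp_log (by positivity)]
    field_simp
  · exact Set.iUnion₂_subset fun B hB => hAB B (Finset.mem_union_left _ hB)
  · intro x hx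
    obtain ⟨B, hB, hxB⟩ := mem_discUnion.1 (hcov x hx.1 hx.2)
    exact hAB B (Finset.mem_union_right _ hB) hxB

lemma IsAdapted.isAdmissible {P : TwoPhase} {ε L δ r r₀ : ℝ} {U' : Set Plane}
    (h : IsAdapted P ε L δ r u A U U') (hr₀ : L = 3 / 8 * r₀) : P.IsAdmissible u U δ r₀ where
  growthC := h.additive.toIsDiscGrowth
  growthB := h.growthB
  σ_nonneg := h.σ_nonneg
  s_nonneg := h.s_nonneg
  totalRadius_famB := by rw [h.totalRadius_famB, hr₀]; ring
  cover_famB := h.cover_famB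
  totalRadius_famC := by rw [h.totalRadius_famC, hr₀]
  famC_subset := h.famC_subset
  cover_famC := by
    rintro x ⟨hx, hxu⟩
    obtain ⟨K, hK, hxK⟩ := mem_discUnion.1 hx
    obtain ⟨B, hB, hxB⟩ := h.core.cover x (h.subset K hK hxK) (by
      rw [le_abs]; rcases hxu with h1 | h1
      · right; linarith
      · left; linarith)
    exact mem_discUnion.2 ⟨B, hB, ball_subset_toSet _ hxB⟩

end Start

end VortexBalls

namespace VortexBalls

open MeasureTheory

/-! ### The energy of the region swept by growing discs -/

lemma Disc.center_dilate (B : Disc) (k : ℝ) : (B.dilate k).center = B.center := rfl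

lemma Disc.radius_dilate (B : Disc) (k : ℝ) : (B.dilate k).radius = k * B.radius := rfl

/-- During the time interval `(a, b)` the discs of the family are dilated, and those that meet `K`
are contained in `K` and cover the part of `K` where the modulus is far from one. -/
structure IsRegularOn (F : ℝ → Finset Disc) (a b : ℝ) (K : Disc) (u : Plane → ℂ) : Prop where
  collection : ∀ t ∈ Set.Ioo a b, IsDiscCollection (F t)
  dilate : ∀ t ∈ Set.Ioo a b, ∀ t' ∈ Set.Ioo a b, t ≤ t' →
    ∀ B, B ∈ F t' ↔ ∃ B' ∈ F t, B = B'.dilate (Real.exp (t' - t))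
  subset : ∀ t ∈ Set.Ioo a b, ∀ B ∈ F t, ∀ x ∈ B.toSet, x ∈ K.toSet → B.toSet ⊆ K.toSet
  far : ∀ t ∈ Set.Ioo a b, ∀ x ∈ K.toSet, 1 / 2 ≤ |‖u x‖ - 1| →
    ∃ B ∈ F t, x ∈ Metric.ball B.center B.radius

/-- The set swept by the boundaries of the discs inside `K` during `(a, b)`, up to the times
in `T`. -/
def swept (F : ℝ → Finset Disc) (T : Finset ℝ) (K : Disc) (a b : ℝ) : Set Plane :=
  {x | ∃ t ∈ Set.Ioo a b, t ∉ T ∧ ∃ B ∈ F t, B.toSet ⊆ K.toSet ∧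
    x ∈ Metric.sphere B.center B.radius}

section Regular

variable {F : ℝ → Finset Disc} {a b : ℝ} {K : Disc} {u : Plane → ℂ} {A : Plane → Plane}
  {Ω : Set Plane}

lemma IsRegularOn.dilate_mem (h : IsRegularOn F a b K u) {t t' : ℝ} (ht : t ∈ Set.Ioo a b)
    (ht' : t' ∈ Set.Ioo a b) {B : Disc} (hB : B ∈ F t) : B.dilate (Real.exp (t' - t)) ∈ F t' := by
  rcases le_total t t' with hle | hle
  · exact (h.dilate t ht t' ht' hle _).2 ⟨B, hB, rfl⟩
  · obtain ⟨B', hB', rfl⟩ := (h.dilate t' ht' t ht hle B).1 hB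
    rw [dilate_dilate, ← Real.exp_add, show t' - t + (t - t') = 0 by ring, Real.exp_zero,
      dilate_one]
    exact hB'

lemma IsRegularOn.exists_dilate (h : IsRegularOn F a b K u) {t t' : ℝ} (ht : t ∈ Set.Ioo a b)
    (ht' : t' ∈ Set.Ioo a b) {B : Disc} (hB : B ∈ F t') :
    ∃ B' ∈ F t, B = B'.dilate (Real.exp (t' - t)) := by
  refine ⟨_, h.dilate_mem ht' ht hB, ?_⟩
  rw [dilate_dilate, ← Real.exp_add, show t' - t + (t - t') = 0 by ring, Real.exp_zero,
    dilate_one]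

lemma IsRegularOn.subset_dilate (h : IsRegularOn F a b K u) {t t' : ℝ} (ht : t ∈ Set.Ioo a b)
    (ht' : t' ∈ Set.Ioo a b) {B : Disc} (hB : B ∈ F t) (hBK : B.toSet ⊆ K.toSet) :
    (B.dilate (Real.exp (t' - t))).toSet ⊆ K.toSet := by
  have h1 := h.dilate_mem ht ht' hB
  have h2 := (h.collection t' ht').radius_pos _ h1
  exact h.subset t' ht' _ h1 B.center (center_mem_toSet h2)
    (hBK (center_mem_toSet ((h.collection t ht).radius_pos B hB)))

/-- Degrees are constant along regular intervals. -/
lemma IsRegularOn.deg_dilate_of_le (h : IsRegularOn F a b K u) (hΩ : IsOpen Ω)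
    (hu : ContDiffOn ℝ 1 u Ω) (hKΩ : K.toSet ⊆ Ω) {t t' : ℝ} (ht : t ∈ Set.Ioo a b)
    (ht' : t' ∈ Set.Ioo a b) (hle : t ≤ t') {B : Disc} (hB : B ∈ F t) (hBK : B.toSet ⊆ K.toSet) :
    deg u (B.dilate (Real.exp (t' - t))) = deg u B := by
  set k := Real.exp (t' - t) with hk
  have hk1 : 1 ≤ k := Real.one_le_exp (by linarith)
  have hr := (h.collection t ht).radius_pos
  have hmem := h.dilate_mem ht ht' hB
  have hsub := h.subset_dilate ht ht' hB hBK
  have := deg_eq_sum hΩ hu (K := B.dilate k) ((h.collection t' ht').radius_pos _ hmem)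
    (hsub.trans hKΩ) (s := {B}) ((h.collection t ht).subset (by simpa using hB)) (by
      intro B' hB'
      obtain rfl := Finset.mem_singleton.1 hB'
      exact toSet_subset_dilate (hr B' hB) hk1) (by
      intro x hx hx' h0
      obtain ⟨B', hB', hxB'⟩ := h.far t ht x (hsub hx) (by rw [h0]; norm_num)
      have h1 : x ∈ (B'.dilate k).toSet :=
        toSet_subset_dilate (hr B' hB') hk1 (ball_subset_toSet _ hxB')
      have h2 := (h.collection t' ht').eq_of_mem (h.dilate_mem ht ht' hB') hmem h1 hx
      rw [← hk] at h2
      rw [dilate_injective (Real.exp_ne_zero _) h2] at hxB'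
      exact hx' B (Finset.mem_singleton_self B) hxB')
  rwa [Finset.sum_singleton] at this

lemma IsRegularOn.deg_dilate (h : IsRegularOn F a b K u) (hΩ : IsOpen Ω)
    (hu : ContDiffOn ℝ 1 u Ω) (hKΩ : K.toSet ⊆ Ω) {t t' : ℝ} (ht : t ∈ Set.Ioo a b)
    (ht' : t' ∈ Set.Ioo a b) {B : Disc} (hB : B ∈ F t) (hBK : B.toSet ⊆ K.toSet) :
    deg u (B.dilate (Real.exp (t' - t))) = deg u B := by
  rcases le_total t t' with hle | hle
  · exact h.deg_dilate_of_le hΩ hu hKΩ ht ht' hle hB hBK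
  · have h1 := h.deg_dilate_of_le hΩ hu hKΩ ht' ht hle (h.dilate_mem ht ht' hB)
      (h.subset_dilate ht ht' hB hBK)
    rw [dilate_dilate, ← Real.exp_add, show t - t' + (t' - t) = 0 by ring, Real.exp_zero,
      dilate_one] at h1
    exact h1.symm

/-- The radius at the time `t` of the disc that has the radius of `B` at the time `c`. -/
noncomputable def Disc.radiusAt (B : Disc) (c t : ℝ) : ℝ := Real.exp (t - c) * B.radius

lemma exists_time {B : Disc} (hB : 0 < B.radius) (c : ℝ) {ρ : ℝ} (hρ : 0 < ρ) :
    ∃ t, B.radiusAt c t = ρ := by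
  refine ⟨c + Real.log (ρ / B.radius), ?_⟩
  rw [Disc.radiusAt, add_sub_cancel_left, Real.exp_log (by positivity)]
  field_simp

lemma radiusAt_lt_iff {B : Disc} (hB : 0 < B.radius) {c t t' : ℝ} :
    B.radiusAt c t < B.radiusAt c t' ↔ t < t' := by
  rw [Disc.radiusAt, Disc.radiusAt, mul_lt_mul_iff_left₀ hB, Real.exp_lt_exp]
  constructor <;> intro h <;> linarith

lemma exists_time_mem {B : Disc} (hB : 0 < B.radius) {c : ℝ} {ρ : ℝ}
    (h1 : B.radiusAt c a < ρ) (h2 : ρ < B.radiusAt c b) :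
    ∃ t ∈ Set.Ioo a b, B.radiusAt c t = ρ := by
  obtain ⟨t, rfl⟩ := exists_time hB c (lt_trans (mul_pos (Real.exp_pos _) hB) h1)
  exact ⟨t, ⟨(radiusAt_lt_iff hB).1 h1, (radiusAt_lt_iff hB).1 h2⟩, rfl⟩

/-- Without merging, a swept circle is identified by its centre and radius, so any time `c` of the
interval can serve as reference and the swept set is a finite union of annuli. -/
lemma IsRegularOn.swept_eq (h : IsRegularOn F a b K u) {T : Finset ℝ}
    (hT : ∀ q ∈ T, q ∉ Set.Ioo a b) {c : ℝ} (hc : c ∈ Set.Ioo a b) :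
    swept F T K a b =
      ⋃ B ∈ discsIn (F c) K.toSet, annulus B.center (B.radiusAt c a) (B.radiusAt c b) := by
  ext x
  simp only [Set.mem_iUnion, mem_discsIn]
  constructor
  · rintro ⟨t, ht, -, B, hB, hBK, hx⟩
    have hBr := (h.collection t ht).radius_pos B hB
    refine ⟨B.dilate (Real.exp (c - t)), ⟨h.dilate_mem ht hc hB, h.subset_dilate ht hc hB hBK⟩, ?_⟩
    have e : ∀ t', (B.dilate (Real.exp (c - t))).radiusAt c t' = B.radiusAt t t' := fun t' => by
      rw [Disc.radiusAt, Disc.radiusAt, Disc.radius_dilate, ← mul_assoc, ← Real.exp_add]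
      ring_nf
    have e2 : dist x B.center = B.radiusAt t t := by
      rw [Metric.mem_sphere.1 hx, Disc.radiusAt]; simp
    refine ⟨?_, ?_⟩
    · rw [e, Disc.center_dilate, e2]; exact (radiusAt_lt_iff hBr).2 ht.1
    · rw [e, Disc.center_dilate, e2]; exact (radiusAt_lt_iff hBr).2 ht.2
  · rintro ⟨B, ⟨hB, hBK⟩, hx1, hx2⟩
    obtain ⟨t, ht, hρ⟩ := exists_time_mem ((h.collection c hc).radius_pos B hB) hx1 hx2
    exact ⟨t, ht, fun hq => hT t hq ht, _, h.dilate_mem hc ht hB, h.subset_dilate hc ht hB hBK,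
      hρ.symm⟩

lemma IsRegularOn.ball_subset (h : IsRegularOn F a b K u) {c : ℝ} (hc : c ∈ Set.Ioo a b) {B : Disc}
    (hB : B ∈ F c) (hBK : B.toSet ⊆ K.toSet) : Metric.ball B.center (B.radiusAt c b) ⊆ K.toSet := by
  have hBr := (h.collection c hc).radius_pos B hB
  intro x hx
  rcases lt_or_ge (B.radiusAt c c) (dist x B.center) with hlt | hle
  · obtain ⟨t, ht, hρ⟩ := exists_time_mem hBr hlt (Metric.mem_ball.1 hx)
    exact h.subset_dilate hc ⟨hc.1.trans ht.1, ht.2⟩ hB hBK hρ.ge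
  · refine hBK (hle.trans_eq ?_)
    rw [Disc.radiusAt]; simp

/-- At the end of the interval closed discs may touch. The open balls there are exhausted by the
closed discs of earlier times, which are disjoint. -/
lemma IsRegularOn.disjoint_ball (h : IsRegularOn F a b K u) {c : ℝ} (hc : c ∈ Set.Ioo a b)
    {B B' : Disc} (hB : B ∈ F c) (hB' : B' ∈ F c) (hne : B ≠ B') :
    Disjoint (Metric.ball B.center (B.radiusAt c b)) (Metric.ball B'.center (B'.radiusAt c b)) := by
  have hr := (h.collection c hc).radius_pos
  have key : ∀ B ∈ F c, ∀ x ∈ Metric.ball B.center (B.radiusAt c b),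
      ∃ t ∈ Set.Ioo a b, ∀ t' ∈ Set.Ioo a b, t ≤ t' →
        x ∈ (B.dilate (Real.exp (t' - c))).toSet := by
    intro B hB x hx
    rcases lt_or_ge (B.radiusAt c c) (dist x B.center) with hlt | hle
    · obtain ⟨t, ht, hρ⟩ := exists_time_mem (hr B hB) hlt (Metric.mem_ball.1 hx)
      refine ⟨t, ⟨hc.1.trans ht.1, ht.2⟩, fun t' _ htt' => ?_⟩
      change dist x B.center ≤ B.radiusAt c t'
      rw [← hρ]
      exact not_lt.1 fun hcon => not_lt.2 htt' ((radiusAt_lt_iff (hr B hB)).1 hcon)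
    · refine ⟨c, hc, fun t' _ htt' => ?_⟩
      change dist x B.center ≤ B.radiusAt c t'
      exact hle.trans (not_lt.1 fun hcon => not_lt.2 htt' ((radiusAt_lt_iff (hr B hB)).1 hcon))
  refine Set.disjoint_left.2 fun x hx hx' => hne ?_
  obtain ⟨t, ht, h1⟩ := key B hB x hx
  obtain ⟨t', ht', h2⟩ := key B' hB' x hx'
  have hm : max t t' ∈ Set.Ioo a b := ⟨lt_max_of_lt_left ht.1, max_lt ht.2 ht'.2⟩
  exact dilate_injective (Real.exp_ne_zero _) ((h.collection _ hm).eq_of_mem (h.dilate_mem hc hm hB)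
    (h.dilate_mem hc hm hB') (h1 _ hm (le_max_left _ _)) (h2 _ hm (le_max_right _ _)))

/-- On the swept circles the modulus is close to one. -/
lemma IsRegularOn.near_one (h : IsRegularOn F a b K u) {t : ℝ} (ht : t ∈ Set.Ioo a b) {B : Disc}
    (hB : B ∈ F t) (hBK : B.toSet ⊆ K.toSet) {x : Plane}
    (hx : x ∈ Metric.sphere B.center B.radius) : |‖u x‖ - 1| < 1 / 2 := by
  have hxB : x ∈ B.toSet := (Metric.mem_sphere.1 hx).le
  by_contra! hcon
  obtain ⟨B', hB', hxB'⟩ := h.far t ht x (hBK hxB) hcon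
  obtain rfl := (h.collection t ht).eq_of_mem hB hB' hxB (ball_subset_toSet _ hxB')
  exact (Metric.mem_ball.1 hxB').ne hx

lemma exp_sub_exp_le (a b k : ℝ) :
    Real.exp (k * b) - Real.exp (k * a) ≤ k * (b - a) * Real.exp (k * b) := by
  have h1 := Real.add_one_le_exp (k * a - k * b)
  have h2 : Real.exp (k * a) = Real.exp (k * a - k * b) * Real.exp (k * b) := by
    rw [← Real.exp_add]; ring_nf
  have h3 := Real.exp_pos (k * b)
  rw [h2]
  nlinarith

/-- Here `d` stands for `|d_K|`, `S` for the sum of the squared degrees, `ℓ` for the elapsed time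
and `l` for the loss. For the second weight `β² S = d` and `β S = √(d S) ≥ d`, so both weights give
at least `d` per unit of time. -/
lemma sqrt_weight_bound {S d ℓ l β : ℝ} (hd : 0 ≤ d) (hdS : d ≤ S) (hl0 : 0 ≤ l) (hl : l ≤ ℓ)
    (hβ : β = 1 ∨ β = Real.sqrt d / Real.sqrt S) :
    0 ≤ β ∧ β ≤ 1 ∧ d * (ℓ - l) ≤ (2 * β - β ^ 2) * S * ℓ - β ^ 2 * S * l := by
  have hS : 0 ≤ S := hd.trans hdS
  rcases hβ with rfl | rfl
  · refine ⟨zero_le_one, le_rfl, ?_⟩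
    nlinarith [mul_le_mul_of_nonneg_right hdS (sub_nonneg.2 hl)]
  · have h1 : Real.sqrt d ≤ Real.sqrt S := Real.sqrt_le_sqrt hdS
    refine ⟨by positivity, div_le_one_of_le₀ h1 (Real.sqrt_nonneg _), ?_⟩
    rcases hS.eq_or_lt with h0 | h0
    · have : d = 0 := le_antisymm (hdS.trans h0.ge) hd
      rw [this, ← h0]; simp
    · have e1 : (Real.sqrt d / Real.sqrt S) ^ 2 * S = d := by
        rw [div_pow, Real.sq_sqrt hd, Real.sq_sqrt hS]; field_simp
      have e2 : d ≤ Real.sqrt d / Real.sqrt S * S := by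
        have : Real.sqrt d / Real.sqrt S * S = Real.sqrt d * Real.sqrt S := by
          rw [div_mul_eq_mul_div, mul_div_assoc, Real.div_sqrt]
        rw [this]
        calc d = Real.sqrt d * Real.sqrt d := (Real.mul_self_sqrt hd).symm
          _ ≤ _ := by gcongr
      have e3 : (2 * (Real.sqrt d / Real.sqrt S) - (Real.sqrt d / Real.sqrt S) ^ 2) * S * ℓ -
          (Real.sqrt d / Real.sqrt S) ^ 2 * S * l =
          2 * (Real.sqrt d / Real.sqrt S * S) * ℓ - d * ℓ - d * l := by
        linear_combination (-ℓ - l) * e1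
      rw [e3]
      nlinarith [mul_le_mul_of_nonneg_right e2 (hl0.trans hl)]

/-- The part of the time elapsed during `(a, b)` that does not contribute to the energy. -/
noncomputable def timeLoss (κ r M m : ℝ) (a b : ℝ) : ℝ :=
  3 / 4 * κ / r * (Real.exp b - Real.exp a) + M * (Real.exp (-2 * a) - Real.exp (-2 * b)) +
    2 * m * (b - a)

lemma IsRegularOn.le_integral_excess (h : IsRegularOn F a b K u) (hΩ : IsOpen Ω)
    (hu : ContDiffOn ℝ 1 u Ω) (hA : ContDiffOn ℝ 1 A Ω) (hKΩ : K.toSet ⊆ Ω) (hab : a < b)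
    {T : Finset ℝ} (hT : ∀ q ∈ T, q ∉ Set.Ioo a b) {ε r κ M m₁ m₂ β : ℝ} {G : Plane → Plane}
    (hr : 0 < r) (hκ0 : 0 ≤ κ) (hm₁ : 0 ≤ m₁) (hm₂ : 0 ≤ m₂) (hM0 : 0 ≤ M)
    (hκ : ∀ t ∈ Set.Ioo a b, ∀ B ∈ F t, B.radius ≤ κ * Real.exp t)
    (hm : ∀ t ∈ Set.Ioo a b, ∀ B ∈ F t, B.toSet ⊆ K.toSet →
      ∀ x ∈ Metric.sphere B.center B.radius, ∀ g : ℝ,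
        9 / 4 * g ^ 2 * |1 - ‖u x‖ ^ 2| - 4 / 9 * potential ε u x ≤
          m₁ * g ^ 4 * ε ^ 2 + m₂ * g ^ 2)
    (hM : ∀ t ∈ Set.Ioo a b, ∀ B ∈ F t, B.toSet ⊆ K.toSet →
      m₁ * deg u B ^ 2 * ε ^ 2 * Real.exp (2 * t) ≤ M * B.radius ^ 2)
    (hG : ∀ t ∈ Set.Ioo a b, ∀ B ∈ F t, B.toSet ⊆ K.toSet →
      ∀ x ∈ Metric.sphere B.center B.radius,
        G x = (deg u B * β / dist x B.center) • tangent B.center x)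
    (hdeg : ∀ t ∈ Set.Ioo a b, |deg u K| ≤ ∑ B ∈ discsIn (F t) K.toSet, deg u B ^ 2)
    (hβ : ∀ t ∈ Set.Ioo a b, β = 1 ∨
      β = Real.sqrt |deg u K| / Real.sqrt (∑ B ∈ discsIn (F t) K.toSet, deg u B ^ 2))
    (hl : timeLoss κ r M m₂ a b ≤ b - a) :
    MeasurableSet (swept F T K a b) ∧ IntegrableOn (excess ε u A G) (swept F T K a b) ∧
    Real.pi * |deg u K| * (b - a - timeLoss κ r M m₂ a b)
      - r / 3 * κ * (Real.exp b - Real.exp a) * ∫ x in K.toSet, curl A x ^ 2 ≤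
      ∫ x in swept F T K a b, excess ε u A G x := by
  have hpi := Real.pi_pos
  set c := (a + b) / 2 with hc
  have hcm : c ∈ Set.Ioo a b := ⟨by rw [hc]; linarith, by rw [hc]; linarith⟩
  set 𝓕 := discsIn (F c) K.toSet with h𝓕
  have hF : ∀ B ∈ 𝓕, B ∈ F c ∧ B.toSet ⊆ K.toSet := fun B hB => mem_discsIn.1 hB
  have hρ : ∀ B ∈ 𝓕, 0 < B.radius := fun B hB => (h.collection c hcm).radius_pos B (hF B hB).1
  set S := ∑ B ∈ 𝓕, deg u B ^ 2 with hS
  set l := timeLoss κ r M m₂ a b with hldef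
  have hexp : 0 ≤ Real.exp b - Real.exp a := sub_nonneg.2 (Real.exp_le_exp.2 hab.le)
  have hexp2 : 0 ≤ Real.exp (-2 * a) - Real.exp (-2 * b) :=
    sub_nonneg.2 (Real.exp_le_exp.2 (by linarith))
  have hl0 : 0 ≤ l := by
    have : 0 ≤ b - a := by linarith
    rw [hldef, timeLoss]; positivity
  obtain ⟨hβ0, hβ1, hβS⟩ := sqrt_weight_bound (abs_nonneg (deg u K)) (hdeg c hcm) hl0 hl (hβ c hcm)
  have hsw := h.swept_eq hT hcm
  set ann : Disc → Set Plane := fun B => annulus B.center (B.radiusAt c a) (B.radiusAt c b) with hann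
  have hannball : ∀ B, ann B ⊆ Metric.ball B.center (B.radiusAt c b) := fun B x hx => hx.2
  have hpt : ∀ B ∈ 𝓕, ∀ x ∈ ann B, ∃ t ∈ Set.Ioo a b, ∃ B' ∈ F t, B'.toSet ⊆ K.toSet ∧
      B'.center = B.center ∧ deg u B' = deg u B ∧ x ∈ Metric.sphere B'.center B'.radius := by
    intro B hB x hx
    obtain ⟨t, ht, hρt⟩ := exists_time_mem (hρ B hB) hx.1 hx.2
    exact ⟨t, ht, _, h.dilate_mem hcm ht (hF B hB).1, h.subset_dilate hcm ht (hF B hB).1 (hF B hB).2,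
      rfl, h.deg_dilate hΩ hu hKΩ hcm ht (hF B hB).1 (hF B hB).2, hρt.symm⟩
  have hmain : ∀ B ∈ 𝓕, IntegrableOn (excess ε u A G) (ann B) ∧
      Real.pi * ((2 * β - β ^ 2) * deg u B ^ 2 * (b - a) - β ^ 2 * deg u B ^ 2 * l)
        - r / 3 * κ * (Real.exp b - Real.exp a) *
          ∫ x in Metric.ball B.center (B.radiusAt c b), curl A x ^ 2 ≤
        ∫ x in ann B, excess ε u A G x := by
    intro B hB
    have hBρ := hρ B hB
    set p := B.radiusAt c a with hp
    set q := B.radiusAt c b with hq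
    have hp0 : 0 < p := mul_pos (Real.exp_pos _) hBρ
    have hpq : p < q := (radiusAt_lt_iff hBρ).2 hab
    have hq0 : 0 < q := hp0.trans hpq
    have hcl : Metric.closedBall B.center q ⊆ Ω := by
      rw [← closure_ball B.center hq0.ne']
      exact (closure_minimal (h.ball_subset hcm (hF B hB).1 (hF B hB).2)
        (isClosed_toSet K)).trans hKΩ
    obtain ⟨h1, h2⟩ := annulus_excess (ε := ε) (β := β) (d := deg u B) (r := r) (m₁ := m₁)
      (m₂ := m₂) (G := G) hΩ hu hA hp0 hpq.le hcl hr hβ0 hβ1 hm₁ (fun ρ hρ' => by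
        obtain ⟨t, ht, hρt⟩ := exists_time_mem hBρ hρ'.1 hρ'.2
        rw [← h.deg_dilate hΩ hu hKΩ hcm ht (hF B hB).1 (hF B hB).2, ← hρt]
        rfl) (fun x hx => by
        obtain ⟨t, ht, B', hB', hB'K, -, -, hx'⟩ := hpt B hB x hx
        have := abs_lt.1 (h.near_one ht hB' hB'K hx')
        constructor <;> linarith [this.1, this.2]) (fun x hx => by
        obtain ⟨t, ht, B', hB', hB'K, -, -, hx'⟩ := hpt B hB x hx
        exact hm t ht B' hB' hB'K x hx' _) (fun x hx => by
        obtain ⟨t, ht, B', hB', hB'K, hcen, hd', hx'⟩ := hpt B hB x hx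
        rw [hG t ht B' hB' hB'K x hx', hcen, hd'])
    refine ⟨h1, le_trans ?_ h2⟩
    have hqp : q / p = Real.exp (b - a) := by
      rw [hp, hq, Disc.radiusAt, Disc.radiusAt, mul_div_mul_right _ _ hBρ.ne', ← Real.exp_sub]
      ring_nf
    have hlog : Real.log (q / p) = b - a := by rw [hqp, Real.log_exp]
    have hΔ : q - p ≤ κ * (Real.exp b - Real.exp a) := by
      have e : q - p = (Real.exp b - Real.exp a) * (B.radius * (Real.exp c)⁻¹) := by
        rw [hp, hq, Disc.radiusAt, Disc.radiusAt, Real.exp_sub, Real.exp_sub]; field_simp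
      have e2 : B.radius * (Real.exp c)⁻¹ ≤ κ := by
        rw [← div_eq_mul_inv, div_le_iff₀ (Real.exp_pos c)]
        exact hκ c hcm B (hF B hB).1
      rw [e, mul_comm κ]
      exact mul_le_mul_of_nonneg_left e2 hexp
    have hMd : m₁ * deg u B ^ 2 * ε ^ 2 * ((p ^ 2)⁻¹ - (q ^ 2)⁻¹) ≤
        M * (Real.exp (-2 * a) - Real.exp (-2 * b)) := by
      have e : ∀ t, ((B.radiusAt c t) ^ 2)⁻¹ =
          Real.exp (2 * c) * (B.radius ^ 2)⁻¹ * Real.exp (-2 * t) := by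
        intro t
        have : Real.exp (t - c) ^ 2 = (Real.exp (2 * c) * Real.exp (-2 * t))⁻¹ := by
          rw [← Real.exp_add, ← Real.exp_neg, ← Real.exp_nat_mul]; push_cast; ring_nf
        rw [Disc.radiusAt, mul_pow, mul_inv, this, inv_inv]
        ring
      rw [hp, hq, e, e]
      have h3 := hM c hcm B (hF B hB).1 (hF B hB).2
      have h4 : m₁ * deg u B ^ 2 * ε ^ 2 * (Real.exp (2 * c) * (B.radius ^ 2)⁻¹) ≤ M := by
        rw [← mul_assoc, ← div_eq_mul_inv, div_le_iff₀ (by positivity)]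
        exact h3
      calc _ = m₁ * deg u B ^ 2 * ε ^ 2 * (Real.exp (2 * c) * (B.radius ^ 2)⁻¹) *
            (Real.exp (-2 * a) - Real.exp (-2 * b)) := by ring
        _ ≤ _ := mul_le_mul_of_nonneg_right h4 hexp2
    set Z := ∫ x in Metric.ball B.center q, curl A x ^ 2
    have hZ : 0 ≤ Z := integral_nonneg fun x => sq_nonneg _
    rw [hlog]
    have h5 : 3 * Real.pi / 4 * β ^ 2 * deg u B ^ 2 / r * (q - p) ≤
        3 * Real.pi / 4 * β ^ 2 * deg u B ^ 2 / r * (κ * (Real.exp b - Real.exp a)) := by gcongr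
    have h6 : r / 3 * Z * (q - p) ≤ r / 3 * Z * (κ * (Real.exp b - Real.exp a)) := by gcongr
    have h7 : Real.pi * β ^ 2 * deg u B ^ 2 *
        (m₁ * deg u B ^ 2 * ε ^ 2 * ((p ^ 2)⁻¹ - (q ^ 2)⁻¹)) ≤
        Real.pi * β ^ 2 * deg u B ^ 2 * (M * (Real.exp (-2 * a) - Real.exp (-2 * b))) := by gcongr
    have e8 : Real.pi * (β ^ 2 * deg u B ^ 2 * l) =
        3 * Real.pi / 4 * β ^ 2 * deg u B ^ 2 / r * (κ * (Real.exp b - Real.exp a)) +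
        Real.pi * β ^ 2 * deg u B ^ 2 * (M * (Real.exp (-2 * a) - Real.exp (-2 * b))) +
        Real.pi * β ^ 2 * deg u B ^ 2 * (2 * m₂ * (b - a)) := by
      rw [hldef, timeLoss]; ring
    linarith
  have hmeas : ∀ B ∈ 𝓕, MeasurableSet (ann B) := fun B _ => (isOpen_annulus _ _ _).measurableSet
  have hdis : (↑𝓕 : Set Disc).PairwiseDisjoint ann := fun B hB B' hB' hne =>
    (h.disjoint_ball hcm (hF B hB).1 (hF B' hB').1 hne).mono (hannball B) (hannball B')
  rw [hsw]
  refine ⟨Finset.measurableSet_biUnion 𝓕 hmeas, ?_, ?_⟩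
  · rw [integrableOn_finset_iUnion]
    exact fun B hB => (hmain B hB).1
  · rw [integral_biUnion_finset 𝓕 hmeas hdis fun B hB => (hmain B hB).1]
    refine le_trans ?_ (Finset.sum_le_sum fun B hB => (hmain B hB).2)
    have hZ : ∑ B ∈ 𝓕, ∫ x in Metric.ball B.center (B.radiusAt c b), curl A x ^ 2 ≤
        ∫ x in K.toSet, curl A x ^ 2 := by
      refine sum_setIntegral_le (fun B _ => Metric.isOpen_ball.measurableSet) ?_
        (fun B hB => h.ball_subset hcm (hF B hB).1 (hF B hB).2) (isClosed_toSet K).measurableSet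
        ((((continuousOn_curl hΩ hA).pow 2).mono hKΩ).integrableOn_compact (isCompact_toSet K))
        fun x _ => sq_nonneg _
      exact fun B hB B' hB' hne => h.disjoint_ball hcm (hF B hB).1 (hF B' hB').1 hne
    have hZ' : r / 3 * κ * (Real.exp b - Real.exp a) *
        ∑ B ∈ 𝓕, ∫ x in Metric.ball B.center (B.radiusAt c b), curl A x ^ 2 ≤
        r / 3 * κ * (Real.exp b - Real.exp a) * ∫ x in K.toSet, curl A x ^ 2 :=
      mul_le_mul_of_nonneg_left hZ (by positivity)
    rw [Finset.sum_sub_distrib, ← Finset.mul_sum, ← Finset.mul_sum, Finset.sum_sub_distrib,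
      ← Finset.sum_mul, ← Finset.sum_mul, ← Finset.mul_sum, ← Finset.mul_sum]
    have := mul_le_mul_of_nonneg_left hβS hpi.le
    linarith

end Regular

end VortexBalls

namespace VortexBalls

open MeasureTheory

/-! ### Summation over successive time intervals -/

section Induction

variable {F : ℝ → Finset Disc} {T : Finset ℝ} {K : Disc}

lemma not_mem_ball_of_mem_sphere {𝓑 : Finset Disc} (h : IsDiscCollection 𝓑) {B : Disc} (hB : B ∈ 𝓑)
    {x : Plane} (hx : x ∈ Metric.sphere B.center B.radius) :
    ¬ ∃ B' ∈ 𝓑, x ∈ Metric.ball B'.center B'.radius := by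
  rintro ⟨B', hB', hx'⟩
  obtain rfl := h.eq_of_mem hB hB' (Metric.mem_sphere.1 hx).le (ball_subset_toSet _ hx')
  exact (Metric.mem_ball.1 hx').ne hx

lemma swept_self (F : ℝ → Finset Disc) (T : Finset ℝ) (K : Disc) (a : ℝ) :
    swept F T K a a = ∅ := by
  simp [swept]

lemma swept_union {a b q : ℝ} (hq : q ∈ T) (haq : a < q) (hqb : q < b) :
    swept F T K a b = swept F T K a q ∪ swept F T K q b := by
  ext x
  constructor
  · rintro ⟨t, ht, htT, h⟩
    rcases lt_trichotomy t q with hlt | rfl | hlt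
    · exact Or.inl ⟨t, ⟨ht.1, hlt⟩, htT, h⟩
    · exact absurd hq htT
    · exact Or.inr ⟨t, ⟨hlt, ht.2⟩, htT, h⟩
  · rintro (⟨t, ht, htT, h⟩ | ⟨t, ht, htT, h⟩)
    · exact ⟨t, ⟨ht.1, ht.2.trans hqb⟩, htT, h⟩
    · exact ⟨t, ⟨haq.trans ht.1, ht.2⟩, htT, h⟩

/-- A point swept earlier lies in the interior of a later disc, hence on none of the later circles.
-/
lemma disjoint_swept {a₀ b₀ : ℝ}
    (hnest : ∀ t t', a₀ < t → t < t' → t' < b₀ → ∀ x ∈ discUnion (F t),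
      ∃ B ∈ F t', x ∈ Metric.ball B.center B.radius)
    (hcol : ∀ t, a₀ < t → t < b₀ → IsDiscCollection (F t)) {a q b : ℝ} (ha : a₀ ≤ a)
    (hb : b ≤ b₀) :
    Disjoint (swept F T K a q) (swept F T K q b) := by
  refine Set.disjoint_left.2 ?_
  rintro x ⟨t, ht, -, B, hB, -, hx⟩ ⟨t', ht', -, B', hB', -, hx'⟩
  have ht0 : a₀ < t := ha.trans_lt ht.1
  have htt : t < t' := ht.2.trans ht'.1
  have htb : t' < b₀ := ht'.2.trans_le hb
  exact not_mem_ball_of_mem_sphere (hcol t' (ht0.trans htt) htb) hB' hx'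
    (hnest t t' ht0 htt htb x (mem_discUnion.2 ⟨B, hB, (Metric.mem_sphere.1 hx).le⟩))

/-- Adding up the energies of the regions swept during successive time intervals. -/
lemma swept_induction {f : Plane → ℝ} {g : ℝ → ℝ} {a₀ b₀ : ℝ}
    (hnest : ∀ t t', a₀ < t → t < t' → t' < b₀ → ∀ x ∈ discUnion (F t),
      ∃ B ∈ F t', x ∈ Metric.ball B.center B.radius)
    (hcol : ∀ t, a₀ < t → t < b₀ → IsDiscCollection (F t))
    (hbase : ∀ a b, a₀ ≤ a → a < b → b ≤ b₀ → (∀ q ∈ T, q ∉ Set.Ioo a b) →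
      MeasurableSet (swept F T K a b) ∧ IntegrableOn f (swept F T K a b) ∧
      g b - g a ≤ ∫ x in swept F T K a b, f x) (n : ℕ) :
    ∀ a b, (T.filter fun q => a < q ∧ q < b).card = n → a₀ ≤ a → a ≤ b → b ≤ b₀ →
      MeasurableSet (swept F T K a b) ∧ IntegrableOn f (swept F T K a b) ∧
      g b - g a ≤ ∫ x in swept F T K a b, f x := by
  induction n using Nat.strong_induction_on with
  | _ n ih =>
    intro a b hn ha hab hb
    rcases hab.eq_or_lt with rfl | hab
    · rw [swept_self]
      simp
    by_cases hT : ∀ q ∈ T, q ∉ Set.Ioo a b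
    · exact hbase a b ha hab hb hT
    push Not at hT
    obtain ⟨q, hq, haq, hqb⟩ := hT
    have hc : ∀ a' b', a ≤ a' → b' ≤ b → ¬ (a' < q ∧ q < b') →
        (T.filter fun q => a' < q ∧ q < b').card < n := by
      intro a' b' ha' hb' hnot
      rw [← hn]
      refine Finset.card_lt_card ((Finset.ssubset_iff_of_subset ?_).2 ⟨q, ?_, ?_⟩)
      · intro y hy
        rw [Finset.mem_filter] at hy ⊢
        exact ⟨hy.1, ha'.trans_lt hy.2.1, hy.2.2.trans_le hb'⟩
      · exact Finset.mem_filter.2 ⟨hq, haq, hqb⟩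
      · exact fun h => hnot (Finset.mem_filter.1 h).2
    obtain ⟨h1, h2, h3⟩ := ih _ (hc a q le_rfl hqb.le fun h => lt_irrefl _ h.2) a q rfl ha haq.le
      (hqb.le.trans hb)
    obtain ⟨h4, h5, h6⟩ := ih _ (hc q b haq.le le_rfl fun h => lt_irrefl _ h.1) q b rfl
      (ha.trans haq.le) hqb.le hb
    rw [swept_union hq haq hqb]
    refine ⟨h1.union h4, h2.union h5, ?_⟩
    rw [setIntegral_union (disjoint_swept hnest hcol ha hb) h4 h2 h5]
    linarith

end Induction

/-! ### The concatenated family -/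

section Family

variable {P : TwoPhase} {u : Plane → ℂ} {A : Plane → Plane} {U U' Ω : Set Plane} {ε L δ r : ℝ}

lemma famD_of_lt {t : ℝ} (h : t < P.σ) : P.famD t = P.famC t := if_pos h

lemma famD_of_le {t : ℝ} (h : P.σ ≤ t) : P.famD t = P.famB (t - P.σ) := if_neg (not_lt.2 h)

namespace IsAdapted

variable (h : IsAdapted P ε L δ r u A U U')
include h

lemma collection {t : ℝ} (ht : 0 ≤ t) : IsDiscCollection (P.famD t) := by
  rcases lt_or_ge t P.σ with hlt | hle
  · rw [famD_of_lt hlt]; exact h.additive.collection t ht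
  · rw [famD_of_le hle]; exact h.growthB.collection _ (by linarith)

/-- The discs of the first phase are covered by those of the second one. -/
lemma mem_discUnion_famB {t t' : ℝ} (ht : 0 ≤ t) (htσ : t ≤ P.σ) (ht' : P.σ < t') {x : Plane}
    (hx : x ∈ discUnion (P.famC t)) : ∃ B ∈ P.famD t', x ∈ Metric.ball B.center B.radius := by
  rw [famD_of_le ht'.le]
  exact h.growthB.mem_ball le_rfl (sub_pos.2 ht')
    (h.famC_subset (h.additive.union_subset t P.σ ht htσ hx))

lemma nest {t t' : ℝ} (ht : 0 ≤ t) (htt' : t < t') {x : Plane} (hx : x ∈ discUnion (P.famD t)) :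
    ∃ B ∈ P.famD t', x ∈ Metric.ball B.center B.radius := by
  rcases lt_or_ge t P.σ with hlt | hle
  · rw [famD_of_lt hlt] at hx
    rcases lt_trichotomy t' P.σ with hlt' | rfl | hlt'
    · rw [famD_of_lt hlt']; exact h.additive.mem_ball ht htt' hx
    · obtain ⟨B, hB, hxB⟩ := h.additive.mem_ball ht htt' hx
      have hBr := (h.additive.collection _ h.σ_nonneg).radius_pos B hB
      have hcol := h.growthB.collection 0 le_rfl
      obtain ⟨B', hB', hsub⟩ := hcol.exists_subset hBr
        fun y hy => h.famC_subset (mem_discUnion.2 ⟨B, hB, hy⟩)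
      rw [famD_of_le le_rfl, sub_self]
      exact ⟨B', hB', ball_subset_ball_of_toSet hBr (hcol.radius_pos B' hB') hsub hxB⟩
    · exact h.mem_discUnion_famB ht hlt.le hlt' hx
  · rw [famD_of_le hle] at hx
    rw [famD_of_le (hle.trans htt'.le)]
    exact h.growthB.mem_ball (by linarith) (by linarith) hx

/-- If `σ = 0` the concatenated family never passes through `famC 0`, so the core has to be compared
with the second family directly. -/
lemma nest_core {t : ℝ} (ht : 0 < t) {x : Plane} (hx : x ∈ discUnion (P.famC 0)) :
    ∃ B ∈ P.famD t, x ∈ Metric.ball B.center B.radius := by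
  rcases h.σ_nonneg.eq_or_lt with h0 | h0
  · exact h.mem_discUnion_famB le_rfl h.σ_nonneg (h0 ▸ ht) hx
  · exact h.nest le_rfl ht (by rwa [famD_of_lt h0])

lemma famD_final : P.famD (P.σ + P.s) = P.final := by
  rw [famD_of_le (by linarith [h.s_nonneg]), add_sub_cancel_left]; rfl

lemma collection_final : IsDiscCollection P.final := h.growthB.collection _ h.s_nonneg

lemma subset_final {t : ℝ} (ht : t ∈ Set.Icc 0 (P.σ + P.s)) :
    discUnion (P.famD t) ⊆ discUnion P.final := by
  intro x hx
  rcases ht.2.eq_or_lt with rfl | hlt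
  · rwa [h.famD_final] at hx
  · obtain ⟨B, hB, hxB⟩ := h.nest ht.1 hlt hx
    rw [h.famD_final] at hB
    exact mem_discUnion.2 ⟨B, hB, ball_subset_toSet _ hxB⟩

lemma toSet_subset {t : ℝ} (ht : t ∈ Set.Icc 0 (P.σ + P.s)) {K : Disc} (hK : K ∈ discsIn P.final U)
    {B : Disc} (hB : B ∈ P.famD t) {x : Plane} (hxB : x ∈ B.toSet) (hxK : x ∈ K.toSet) :
    B.toSet ⊆ K.toSet :=
  h.collection_final.toSet_subset
    (fun _ hy => h.subset_final ht (mem_discUnion.2 ⟨B, hB, hy⟩)) (mem_discsIn.1 hK).1 hxB hxK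

/-- The discs of `𝓑(0)` that meet a final disc contained in `U` avoid the bad region. -/
lemma famB_zero_subset {K : Disc} (hK : K ∈ discsIn P.final U) {B : Disc} (hB : B ∈ P.famB 0)
    {x : Plane} (hxB : x ∈ B.toSet) (hxK : x ∈ K.toSet) : B.toSet ⊆ U' := by
  refine h.subset B (mem_discsIn.2 ⟨hB, ?_⟩)
  refine (h.collection_final.toSet_subset (fun y hy => ?_) (mem_discsIn.1 hK).1 hxB hxK).trans
    (mem_discsIn.1 hK).2
  exact h.growthB.union_subset 0 P.s le_rfl h.s_nonneg (mem_discUnion.2 ⟨B, hB, hy⟩)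

/-- Such a point lies in a disc of `famB 0`, since `δ ≤ 1/2`. This disc lies in `K` and therefore in
`U'`, where the core covers the point. -/
lemma far (hδ : δ ≤ 1 / 2) {K : Disc} (hK : K ∈ discsIn P.final U) {t : ℝ} (ht : 0 < t) {x : Plane}
    (hx : x ∈ K.toSet) (hxu : 1 / 2 ≤ |‖u x‖ - 1|) :
    ∃ B ∈ P.famD t, x ∈ Metric.ball B.center B.radius := by
  obtain ⟨B, hB, hxB⟩ := mem_discUnion.1
    (h.cover_famB ⟨(mem_discsIn.1 hK).2 hx, hδ.trans hxu⟩)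
  obtain ⟨B', hB', hxB'⟩ := h.core.cover x (h.famB_zero_subset hK hB hxB hx hxB) hxu
  exact h.nest_core ht (mem_discUnion.2 ⟨B', hB', ball_subset_toSet _ hxB'⟩)

lemma near_one_of_phase_two {K : Disc} (hK : K ∈ discsIn P.final U) {t : ℝ} (ht : P.σ < t)
    {B : Disc} (hB : B ∈ P.famD t) {x : Plane} (hxK : x ∈ K.toSet)
    (hx : x ∈ Metric.sphere B.center B.radius) : |‖u x‖ - 1| < δ := by
  by_contra! hcon
  have h1 := h.growthB.mem_ball le_rfl (sub_pos.2 ht)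
    (h.cover_famB ⟨(mem_discsIn.1 hK).2 hxK, hcon⟩)
  rw [← famD_of_le ht.le] at h1
  exact not_mem_ball_of_mem_sphere (h.collection (h.σ_nonneg.trans ht.le)) hB hx h1

/-- In the first phase radii are large compared to degrees. -/
lemma deg_le_radius (hc : IsConfiguration Ω U u A) (hU'U : U' ⊆ U) {K : Disc} (hK : K ∈ discsIn P.final U) {t : ℝ} (ht0 : 0 ≤ t)
    (ht : t < P.σ) {B : Disc} (hB : B ∈ P.famD t) (hBK : B.toSet ⊆ K.toSet) (hε : 0 < ε) :
    10 * ε * Real.exp t * |deg u B| ≤ B.radius := by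
  rw [famD_of_lt ht] at hB
  have hcol := h.additive.collection t ht0
  have hBr := hcol.radius_pos B hB
  obtain ⟨K₀, hK₀, hBK₀⟩ := (h.growthB.collection 0 le_rfl).exists_subset hBr (fun y hy =>
    h.famC_subset (h.additive.union_subset t P.σ ht0 ht.le (mem_discUnion.2 ⟨B, hB, hy⟩)))
  have hBU' : B.toSet ⊆ U' := hBK₀.trans (h.famB_zero_subset hK hK₀
    (hBK₀ (center_mem_toSet hBr)) (hBK (center_mem_toSet hBr)))
  have hdeg : deg u B = ∑ B' ∈ discsIn (P.famC 0) B.toSet, deg u B' := by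
    refine deg_eq_sum hc.isOpen hc.contDiffOn hBr ((hBU'.trans hU'U).trans hc.subset)
      ((h.additive.collection 0 le_rfl).discsIn _) (fun B' hB' => (mem_discsIn.1 hB').2) ?_
    intro x hx hx' h0
    obtain ⟨B', hB', hxB'⟩ := h.core.cover x (hBU' hx) (by rw [h0]; norm_num)
    refine hx' B' (mem_discsIn.2 ⟨hB', hcol.toSet_subset (fun y hy => ?_) hB
      (ball_subset_toSet _ hxB') hx⟩) hxB'
    exact h.additive.union_subset 0 t le_rfl ht0 (mem_discUnion.2 ⟨B', hB', hy⟩)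
  have hsmall := h.small.resolve_left (ht0.trans_lt ht).ne'
  have h1 : ∀ B' ∈ discsIn (P.famC 0) B.toSet, 10 * ε * |deg u B'| ≤ B'.radius := by
    intro B' hB'
    obtain ⟨hB'C, hB'B⟩ := mem_discsIn.1 hB'
    by_contra! hcon
    have : B' ∈ smallDiscs ε u U' (P.famC 0) := by
      classical
      rw [smallDiscs, Finset.mem_filter, mem_discsIn]
      exact ⟨⟨hB'C, hB'B.trans hBU'⟩, hcon⟩
    rw [hsmall] at this
    exact absurd this (Finset.notMem_empty _)
  -- Radii, up to the factor `e^t`, and degrees are both sums over the core discs inside `B`, so the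
  -- inequality for core discs passes to `B` by the triangle inequality.
  rw [h.additive.radius_eq t ht0 B hB, hdeg]
  calc 10 * ε * Real.exp t * |∑ B' ∈ discsIn (P.famC 0) B.toSet, deg u B'|
      ≤ 10 * ε * Real.exp t * ∑ B' ∈ discsIn (P.famC 0) B.toSet, |deg u B'| := by
        gcongr; exact Finset.abs_sum_le_sum_abs _ _
    _ = Real.exp t * ∑ B' ∈ discsIn (P.famC 0) B.toSet, 10 * ε * |deg u B'| := by
        rw [← Finset.mul_sum]; ring
    _ ≤ _ := by gcongr with B' hB'; exact h1 B' hB'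

variable (hc : IsConfiguration Ω U u A) (hδ : δ ≤ 1 / 2)
include hc hδ

lemma deg_final_eq {K : Disc} (hK : K ∈ discsIn P.final U) {t : ℝ}
    (ht : t ∈ Set.Ioc 0 (P.σ + P.s)) :
    deg u K = ∑ B ∈ discsIn (P.famD t) K.toSet, deg u B := by
  obtain ⟨hKf, hKU⟩ := mem_discsIn.1 hK
  refine deg_eq_sum hc.isOpen hc.contDiffOn (h.collection_final.radius_pos K hKf)
    (hKU.trans hc.subset) ((h.collection ht.1.le).discsIn _) (fun B hB => (mem_discsIn.1 hB).2) ?_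
  intro x hx hx' h0
  obtain ⟨B, hB, hxB⟩ := h.far hδ hK ht.1 hx (by rw [h0]; norm_num)
  exact hx' B (mem_discsIn.2 ⟨hB, h.toSet_subset ⟨ht.1.le, ht.2⟩ hK hB (ball_subset_toSet _ hxB) hx⟩)
    hxB

lemma exists_int_deg {K : Disc} (hK : K ∈ discsIn P.final U) {t : ℝ} (ht : 0 < t) {B : Disc}
    (hB : B ∈ P.famD t) (hBK : B.toSet ⊆ K.toSet) : ∃ k : ℤ, deg u B = k := by
  have hs : ∀ θ, B.bdryPoint θ ∈ Metric.sphere B.center B.radius := fun θ =>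
    bdryPoint_mem_sphere ((h.collection ht.le).radius_pos B hB) θ
  have hs' : ∀ θ, B.bdryPoint θ ∈ K.toSet := fun θ => hBK (Metric.mem_sphere.1 (hs θ)).le
  refine deg_int hc.isOpen hc.contDiffOn
    (fun θ => hc.subset ((mem_discsIn.1 hK).2 (hs' θ))) fun θ h0 => ?_
  exact not_mem_ball_of_mem_sphere (h.collection ht.le) hB (hs θ)
    (h.far hδ hK ht (hs' θ) (by rw [h0]; norm_num))

/-- Degrees are integers, so each absolute value is at most the square. This supplies the hypothesis
`d ≤ S` of `sqrt_weight_bound`. -/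
lemma abs_deg_le {K : Disc} (hK : K ∈ discsIn P.final U) {t : ℝ} (ht : t ∈ Set.Ioc 0 (P.σ + P.s)) :
    |deg u K| ≤ ∑ B ∈ discsIn (P.famD t) K.toSet, deg u B ^ 2 := by
  rw [h.deg_final_eq hc hδ hK ht]
  refine (Finset.abs_sum_le_sum_abs _ _).trans (Finset.sum_le_sum fun B hB => ?_)
  obtain ⟨hB, hBK⟩ := mem_discsIn.1 hB
  obtain ⟨k, hk⟩ := h.exists_int_deg hc hδ hK ht.1 hB hBK
  rw [hk]
  have : |k| ≤ k ^ 2 := by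
    rcases eq_or_ne k 0 with rfl | h0
    · simp
    · have := Int.one_le_abs h0
      nlinarith [sq_abs k]
  exact_mod_cast this

end IsAdapted

end Family

end VortexBalls

namespace VortexBalls

open MeasureTheory

/-! ### Energy bound for one phase with the prescribed weights -/

section Phases

variable {P : TwoPhase} {u : Plane → ℂ} {A : Plane → Plane} {U U' Ω : Set Plane} {ε L δ r : ℝ}

lemma IsRegularOn.discsIn_eq {F : ℝ → Finset Disc} {a b : ℝ} {K : Disc} [DecidableEq Disc]
    (h : IsRegularOn F a b K u) {t t' : ℝ} (ht : t ∈ Set.Ioo a b) (ht' : t' ∈ Set.Ioo a b) :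
    discsIn (F t') K.toSet = (discsIn (F t) K.toSet).image (Disc.dilate (Real.exp (t' - t))) := by
  ext B
  rw [Finset.mem_image, mem_discsIn]
  constructor
  · rintro ⟨hB, hBK⟩
    obtain ⟨B', hB', rfl⟩ := h.exists_dilate ht ht' hB
    refine ⟨B', mem_discsIn.2 ⟨hB', ?_⟩, rfl⟩
    exact h.subset t ht B' hB' _ (center_mem_toSet ((h.collection t ht).radius_pos B' hB'))
      (hBK (center_mem_toSet ((h.collection t' ht').radius_pos _ hB)))
  · rintro ⟨B', hB', rfl⟩
    obtain ⟨hB', hBK⟩ := mem_discsIn.1 hB'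
    exact ⟨h.dilate_mem ht ht' hB', h.subset_dilate ht ht' hB' hBK⟩

lemma IsRegularOn.sum_deg_sq_eq {F : ℝ → Finset Disc} {a b : ℝ} {K : Disc}
    (h : IsRegularOn F a b K u) (hΩ : IsOpen Ω) (hu : ContDiffOn ℝ 1 u Ω) (hKΩ : K.toSet ⊆ Ω)
    {t t' : ℝ} (ht : t ∈ Set.Ioo a b) (ht' : t' ∈ Set.Ioo a b) :
    ∑ B ∈ discsIn (F t') K.toSet, deg u B ^ 2 = ∑ B ∈ discsIn (F t) K.toSet, deg u B ^ 2 := by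
  classical
  rw [h.discsIn_eq ht ht', Finset.sum_image fun _ _ _ _ e =>
    dilate_injective (Real.exp_ne_zero _) e]
  refine Finset.sum_congr rfl fun B hB => ?_
  obtain ⟨hB, hBK⟩ := mem_discsIn.1 hB
  rw [h.deg_dilate hΩ hu hKΩ ht ht' hB hBK]

lemma IsRegularOn.beta_eq {a b η : ℝ} {K : Disc} (h : IsRegularOn P.famD a b K u)
    (hΩ : IsOpen Ω) (hu : ContDiffOn ℝ 1 u Ω) (hKΩ : K.toSet ⊆ Ω)
    (hT : P.transitionTime u η K ∉ Set.Ioo a b) {t t' : ℝ} (ht : t ∈ Set.Ioo a b)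
    (ht' : t' ∈ Set.Ioo a b) : P.beta u η K t' = P.beta u η K t := by
  have hiff : t' < P.transitionTime u η K ↔ t < P.transitionTime u η K := by
    constructor
    · intro hlt
      by_contra! hle
      exact hT ⟨ht'.1.trans hlt, hle.trans_lt ht.2⟩
    · intro hlt
      by_contra! hle
      exact hT ⟨ht.1.trans hlt, hle.trans_lt ht'.2⟩
  rw [TwoPhase.beta, TwoPhase.beta, h.sum_deg_sq_eq hΩ hu hKΩ ht ht']
  simp only [hiff]

open Classical in
/-- The times at which the circles inside `K` or their weights may change abruptly. -/
noncomputable def switchTimes (P : TwoPhase) (u : Plane → ℂ) (η : ℝ) (K : Disc) : Finset ℝ :=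
  insert (P.transitionTime u η K) (P.timesC ∪ P.timesB.image fun q => P.σ + q)

lemma transitionTime_mem (P : TwoPhase) (u : Plane → ℂ) (η : ℝ) (K : Disc) :
    P.transitionTime u η K ∈ switchTimes P u η K := by
  classical
  exact Finset.mem_insert_self _ _

lemma timesC_subset (P : TwoPhase) (u : Plane → ℂ) (η : ℝ) (K : Disc) {q : ℝ} (hq : q ∈ P.timesC) :
    q ∈ switchTimes P u η K := by
  classical
  exact Finset.mem_insert_of_mem (Finset.mem_union_left _ hq)

lemma timesB_subset (P : TwoPhase) (u : Plane → ℂ) (η : ℝ) (K : Disc) {q : ℝ} (hq : q ∈ P.timesB) :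
    P.σ + q ∈ switchTimes P u η K := by
  classical
  exact Finset.mem_insert_of_mem (Finset.mem_union_right _ (Finset.mem_image_of_mem _ hq))

lemma not_isMergingTime {η : ℝ} {K : Disc} {t : ℝ} (ht : t ∉ switchTimes P u η K) :
    ¬ P.IsMergingTime t := by
  rintro (⟨-, h⟩ | ⟨-, h⟩)
  · exact ht (timesC_subset P u η K h)
  · exact ht (by simpa using timesB_subset P u η K h)

namespace IsAdapted

variable (h : IsAdapted P ε L δ r u A U U')
include h

lemma isRegularOn_phase_one (hδ : δ ≤ 1 / 2) {K : Disc} (hK : K ∈ discsIn P.final U) {a b : ℝ}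
    (ha : 0 ≤ a) (hb : b ≤ P.σ) (hT : ∀ q ∈ P.timesC, q ∉ Set.Ioo a b) :
    IsRegularOn P.famD a b K u where
  collection t ht := h.collection (ha.trans ht.1.le)
  dilate t ht t' ht' htt' B := by
    rw [famD_of_lt (ht.2.trans_le hb), famD_of_lt (ht'.2.trans_le hb)]
    exact h.additive.dilate t t' (ha.trans ht.1.le) htt' (fun q hq hmem =>
      hT q hq ⟨ht.1.trans_le hmem.1, hmem.2.trans_lt ht'.2⟩) B
  subset t ht B hB x hxB hxK := h.toSet_subset
    ⟨ha.trans ht.1.le, by linarith [ht.2, h.s_nonneg]⟩ hK hB hxB hxK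
  far t ht x hx hxu := h.far hδ hK (ha.trans_lt ht.1) hx hxu

lemma isRegularOn_phase_two (hδ : δ ≤ 1 / 2) {K : Disc} (hK : K ∈ discsIn P.final U) {a b : ℝ}
    (ha : P.σ ≤ a) (hb : b ≤ P.σ + P.s) (hT : ∀ q ∈ P.timesB, P.σ + q ∉ Set.Ioo a b) :
    IsRegularOn P.famD a b K u where
  collection t ht := h.collection (h.σ_nonneg.trans (ha.trans ht.1.le))
  dilate t ht t' ht' htt' B := by
    rw [famD_of_le (ha.trans ht.1.le), famD_of_le (ha.trans ht'.1.le)]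
    have := h.growthB.dilate (t - P.σ) (t' - P.σ) (by linarith [ht.1]) (by linarith)
      (fun q hq hmem => hT q hq ⟨by linarith [ht.1, hmem.1], by linarith [ht'.2, hmem.2]⟩) B
    rw [sub_sub_sub_cancel_right] at this
    exact this
  subset t ht B hB x hxB hxK := h.toSet_subset
    ⟨h.σ_nonneg.trans (ha.trans ht.1.le), ht.2.le.trans hb⟩ hK hB hxB hxK
  far t ht x hx hxu := h.far hδ hK (h.σ_nonneg.trans_lt (ha.trans_lt ht.1)) hx hxu

lemma onCircle_time_le {x : Plane} {t t' : ℝ} {B B' K K' : Disc} (h1 : P.OnCircle U x t B K)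
    (h2 : P.OnCircle U x t' B' K') : t' ≤ t := by
  by_contra! hlt
  exact not_mem_ball_of_mem_sphere (h.collection h2.time_mem.1) h2.mem_famD h2.mem_sphere
    (h.nest h1.time_mem.1 hlt (mem_discUnion.2 ⟨B, h1.mem_famD,
      (Metric.mem_sphere.1 h1.mem_sphere).le⟩))

/-- Strict nesting of the discs in time places each point on at most one circle, so the prescription
for the vector field is consistent. -/
lemma onCircle_unique {x : Plane} {t t' : ℝ} {B B' K K' : Disc} (h1 : P.OnCircle U x t B K)
    (h2 : P.OnCircle U x t' B' K') : t = t' ∧ B = B' ∧ K = K' := by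
  obtain rfl : t = t' := le_antisymm (h.onCircle_time_le h2 h1) (h.onCircle_time_le h1 h2)
  have hx1 : x ∈ B.toSet := (Metric.mem_sphere.1 h1.mem_sphere).le
  have hx2 : x ∈ B'.toSet := (Metric.mem_sphere.1 h2.mem_sphere).le
  exact ⟨rfl, (h.collection h1.time_mem.1).eq_of_mem h1.mem_famD h2.mem_famD hx1 hx2,
    h.collection_final.eq_of_mem (mem_discsIn.1 h1.mem_final).1 (mem_discsIn.1 h2.mem_final).1
      (h1.subset hx1) (h2.subset hx2)⟩

lemma exists_isVortexField (η : ℝ) : ∃ G, IsVortexField P u U η G := by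
  classical
  refine ⟨fun x => if hx : ∃ p : ℝ × Disc × Disc, P.OnCircle U x p.1 p.2.1 p.2.2 then
    (deg u hx.choose.2.1 * P.beta u η hx.choose.2.2 hx.choose.1 / dist x hx.choose.2.1.center) •
      tangent hx.choose.2.1.center x else 0, ?_, ?_⟩
  · intro x t B K hx
    have hex : ∃ p : ℝ × Disc × Disc, P.OnCircle U x p.1 p.2.1 p.2.2 := ⟨(t, B, K), hx⟩
    obtain ⟨e1, e2, e3⟩ := h.onCircle_unique hx hex.choose_spec
    rw [dif_pos hex, ← e1, ← e2, ← e3]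
  · intro x hx
    exact dif_neg fun ⟨p, hp⟩ => hx _ _ _ hp

/-- Between consecutive switch times the discs only dilate and the weight is constant. The lower
bound is an increment of one function of time, so the intervals add up without further loss. -/
lemma phase_bound (hc : IsConfiguration Ω U u A) (hδ : δ ≤ 1 / 2) {K : Disc}
    (hK : K ∈ discsIn P.final U) {η : ℝ} {G : Plane → Plane} (hG : IsVortexField P u U η G)
    {a₀ b₀ κ M m₁ m₂ : ℝ} (ha₀ : 0 ≤ a₀) (hab₀ : a₀ ≤ b₀) (hb₀ : b₀ ≤ P.σ + P.s)
    (hr : 0 < r) (hκ0 : 0 ≤ κ) (hm₁ : 0 ≤ m₁) (hm₂ : 0 ≤ m₂) (hM0 : 0 ≤ M)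
    (hreg : ∀ a b, a₀ ≤ a → b ≤ b₀ → (∀ q ∈ switchTimes P u η K, q ∉ Set.Ioo a b) →
      IsRegularOn P.famD a b K u)
    (hκ : ∀ t ∈ Set.Ioo a₀ b₀, totalRadius (P.famD t) = κ * Real.exp t)
    (hm : ∀ t ∈ Set.Ioo a₀ b₀, ∀ B ∈ P.famD t, B.toSet ⊆ K.toSet →
      ∀ x ∈ Metric.sphere B.center B.radius, ∀ g : ℝ,
        9 / 4 * g ^ 2 * |1 - ‖u x‖ ^ 2| - 4 / 9 * potential ε u x ≤
          m₁ * g ^ 4 * ε ^ 2 + m₂ * g ^ 2)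
    (hM : ∀ t ∈ Set.Ioo a₀ b₀, ∀ B ∈ P.famD t, B.toSet ⊆ K.toSet →
      m₁ * deg u B ^ 2 * ε ^ 2 * Real.exp (2 * t) ≤ M * B.radius ^ 2)
    (hl : ∀ a b, a₀ ≤ a → a < b → b ≤ b₀ → timeLoss κ r M m₂ a b ≤ b - a) :
    MeasurableSet (swept P.famD (switchTimes P u η K) K a₀ b₀) ∧
    IntegrableOn (excess ε u A G) (swept P.famD (switchTimes P u η K) K a₀ b₀) ∧
    Real.pi * |deg u K| * (b₀ - a₀ - timeLoss κ r M m₂ a₀ b₀)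
      - r / 3 * κ * (Real.exp b₀ - Real.exp a₀) * ∫ x in K.toSet, curl A x ^ 2 ≤
      ∫ x in swept P.famD (switchTimes P u η K) K a₀ b₀, excess ε u A G x := by
  have hKΩ : K.toSet ⊆ Ω := (mem_discsIn.1 hK).2.trans hc.subset
  set Z := ∫ x in K.toSet, curl A x ^ 2 with hZ
  set T := switchTimes P u η K with hT
  set g : ℝ → ℝ := fun t => Real.pi * |deg u K| * (t - (3 / 4 * κ / r * Real.exp t
    - M * Real.exp (-2 * t) + 2 * m₂ * t)) - r / 3 * κ * Real.exp t * Z with hg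
  have hgab : ∀ a b, g b - g a = Real.pi * |deg u K| * (b - a - timeLoss κ r M m₂ a b)
      - r / 3 * κ * (Real.exp b - Real.exp a) * Z := fun a b => by
    rw [hg, timeLoss]; ring
  rw [← hgab]
  refine swept_induction (a₀ := a₀) (b₀ := b₀) (fun t t' ht htt' _ x hx =>
    h.nest (ha₀.trans ht.le) htt' hx) (fun t ht _ => h.collection (ha₀.trans ht.le)) ?_ _ a₀ b₀ rfl
    le_rfl hab₀ le_rfl
  intro a b ha hab hb hTab
  rw [hgab]
  have hR := hreg a b ha hb hTab
  have hin : ∀ t ∈ Set.Ioo a b, t ∈ Set.Ioo a₀ b₀ := fun t ht =>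
    ⟨ha.trans_lt ht.1, ht.2.trans_le hb⟩
  have hpos : ∀ t ∈ Set.Ioo a b, t ∈ Set.Ioc 0 (P.σ + P.s) := fun t ht =>
    ⟨ha₀.trans_lt (hin t ht).1, (hin t ht).2.le.trans hb₀⟩
  have htT : P.transitionTime u η K ∉ Set.Ioo a b := hTab _ (transitionTime_mem P u η K)
  have hcm : (a + b) / 2 ∈ Set.Ioo a b := ⟨by linarith, by linarith⟩
  have hβ : ∀ t ∈ Set.Ioo a b, P.beta u η K t = P.beta u η K ((a + b) / 2) := fun t ht =>
    hR.beta_eq hc.isOpen hc.contDiffOn hKΩ htT hcm ht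
  refine hR.le_integral_excess (κ := κ) (m₁ := m₁) (β := P.beta u η K ((a + b) / 2)) hc.isOpen
    hc.contDiffOn hc.contDiffOn_field hKΩ hab hTab hr hκ0 hm₁ hm₂ hM0 ?_
    (fun t ht => hm t (hin t ht)) (fun t ht => hM t (hin t ht)) ?_
    (fun t ht => h.abs_deg_le hc hδ hK (hpos t ht)) ?_ (hl a b ha hab hb)
  · intro t ht B hB
    rw [← hκ t (hin t ht)]
    exact Finset.single_le_sum (f := Disc.radius)
      (fun B hB => ((hR.collection t ht).radius_pos B hB).le) hB
  · intro t ht B hB hBK x hx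
    rw [← hβ t ht]
    exact hG.on_circle x t B K ⟨⟨(hpos t ht).1.le, (hpos t ht).2⟩,
      not_isMergingTime fun hq => hTab t hq ht, hB, hK, hBK, hx⟩
  · intro t ht
    rw [← hβ t ht, TwoPhase.beta]
    split_ifs
    · exact Or.inl rfl
    · exact Or.inr rfl

lemma totalRadius_phase_one {t : ℝ} (ht : 0 ≤ t) (ht' : t < P.σ) :
    totalRadius (P.famD t) = totalRadius (P.famC 0) * Real.exp t := by
  rw [famD_of_lt ht', h.additive.totalRadius_eq t ht, mul_comm]

lemma totalRadius_phase_two {t : ℝ} (ht : P.σ ≤ t) :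
    totalRadius (P.famD t) = 8 / 3 * L * Real.exp (-P.σ) * Real.exp t := by
  rw [famD_of_le ht, h.growthB.totalRadius_eq _ (sub_nonneg.2 ht), h.totalRadius_famB, sub_eq_add_neg,
    Real.exp_add]
  ring

lemma totalRadius_mul_exp : totalRadius (P.famC 0) * Real.exp P.σ = L := by
  rw [mul_comm, ← h.additive.totalRadius_eq _ h.σ_nonneg, h.totalRadius_famC]

lemma mul_exp_s : 8 / 3 * L * Real.exp P.s = r := by
  rw [← h.totalRadius_final, TwoPhase.final, h.growthB.totalRadius_eq _ h.s_nonneg,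
    h.totalRadius_famB, mul_comm]

lemma totalRadius_core_pos : 0 < totalRadius (P.famC 0) :=
  h.core.collection.totalRadius_pos h.core.nonempty

lemma L_pos : 0 < L := h.totalRadius_core_pos.trans_le h.core.totalRadius_le

lemma le_r : 8 / 3 * L ≤ r := by
  rw [← h.mul_exp_s]
  exact le_mul_of_one_le_right (by linarith [h.L_pos]) (Real.one_le_exp h.s_nonneg)

lemma r_pos : 0 < r := by linarith [h.L_pos, h.le_r]

end IsAdapted

/-- In the first phase the potential pays for the modulus error: completing the square in `|y|/ε`
leaves `(2/9) (81/16)² < 6` times `g⁴ ε²`. -/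
lemma weight_error_le_of_any {ε g y : ℝ} (hε : 0 < ε) :
    9 / 4 * g ^ 2 * |y| - 4 / 9 * (1 / (2 * ε ^ 2) * y ^ 2) ≤ 6 * g ^ 4 * ε ^ 2 + 0 * g ^ 2 := by
  have e : 6 * g ^ 4 * ε ^ 2 + 0 * g ^ 2 - (9 / 4 * g ^ 2 * |y| - 4 / 9 * (1 / (2 * ε ^ 2) * y ^ 2)) =
      2 / 9 * (|y| / ε - 81 / 16 * (g ^ 2 * ε)) ^ 2 + (6 - 2 / 9 * (81 / 16) ^ 2) * (g ^ 2 * ε) ^ 2 := by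
    rw [← sq_abs y]; field_simp; ring
  have : 0 ≤ 2 / 9 * (|y| / ε - 81 / 16 * (g ^ 2 * ε)) ^ 2 +
      (6 - 2 / 9 * (81 / 16) ^ 2) * (g ^ 2 * ε) ^ 2 := by
    have h1 : (0 : ℝ) ≤ 6 - 2 / 9 * (81 / 16) ^ 2 := by norm_num
    positivity
  linarith

/-- In the second phase `|1 - f²| ≤ 5δ/2` directly, and `(9/4) · (5/2) < 7`. -/
lemma weight_error_le_of_near_one {ε g f δ p : ℝ} (hf : |f - 1| < δ) (hδ : δ ≤ 1 / 2)
    (hp : 0 ≤ p) : 9 / 4 * g ^ 2 * |1 - f ^ 2| - 4 / 9 * p ≤ 0 * g ^ 4 * ε ^ 2 + 7 * δ * g ^ 2 := by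
  have h1 : |1 - f ^ 2| ≤ 5 / 2 * δ := by
    have e : 1 - f ^ 2 = -((f - 1) * (2 + (f - 1))) := by ring
    have h2 : |2 + (f - 1)| ≤ 5 / 2 := by
      have := abs_lt.1 hf
      rw [abs_le]; constructor <;> linarith [this.1, this.2]
    rw [e, abs_neg, abs_mul, mul_comm (5 / 2)]
    exact mul_le_mul hf.le h2 (abs_nonneg _) ((abs_nonneg _).trans hf.le)
  have h2 : g ^ 2 * |1 - f ^ 2| ≤ g ^ 2 * (5 / 2 * δ) := by gcongr
  have h3 : 0 ≤ g ^ 2 * δ := mul_nonneg (sq_nonneg g) ((abs_nonneg _).trans hf.le)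
  linarith

/-- The three kinds of loss proceed at rates of at most `3/4`, `2M` and `2m`. A loss not exceeding
the elapsed time is needed in `sqrt_weight_bound`, where the squared degrees are bounded below by
`|d_K|`. -/
lemma timeLoss_le {κ r M m a b : ℝ} (hr : 0 < r) (hab : a < b) (ha : 0 ≤ a)
    (hκr : κ * Real.exp b ≤ r) (hκ0 : 0 ≤ κ) (hM0 : 0 ≤ M) (hm0 : 3 / 4 + 2 * M + 2 * m ≤ 1) :
    timeLoss κ r M m a b ≤ b - a := by
  have h1 := exp_sub_exp_le a b 1
  have h2 := exp_sub_exp_le b a (-2)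
  rw [one_mul, one_mul, one_mul] at h1
  have h3 : Real.exp (-2 * a) ≤ 1 := Real.exp_le_one_iff.2 (by linarith)
  have h4 : Real.exp (-2 * a) - Real.exp (-2 * b) ≤ 2 * (b - a) := by nlinarith
  have h5 : 3 / 4 * κ / r * (Real.exp b - Real.exp a) ≤ 3 / 4 * (b - a) := by
    calc 3 / 4 * κ / r * (Real.exp b - Real.exp a)
        ≤ 3 / 4 * κ / r * ((b - a) * Real.exp b) := by gcongr
      _ = 3 / 4 * (κ * Real.exp b / r) * (b - a) := by ring
      _ ≤ 3 / 4 * 1 * (b - a) := by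
        have : κ * Real.exp b / r ≤ 1 := (div_le_one hr).2 hκr
        have : 0 ≤ b - a := by linarith
        gcongr
      _ = _ := by ring
  have h6 : M * (Real.exp (-2 * a) - Real.exp (-2 * b)) ≤ M * (2 * (b - a)) := by gcongr
  have h7 := mul_le_mul_of_nonneg_right hm0 (by linarith : 0 ≤ b - a)
  rw [timeLoss]
  linarith

end Phases

end VortexBalls

namespace VortexBalls

open MeasureTheory

/-! ### Total loss over both phases -/

section Bound

variable {P : TwoPhase} {u : Plane → ℂ} {A : Plane → Plane} {U U' Ω : Set Plane} {ε L δ r : ℝ}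

lemma swept_subset {F : ℝ → Finset Disc} {T : Finset ℝ} {K : Disc} {a b : ℝ} :
    swept F T K a b ⊆ K.toSet := by
  rintro x ⟨t, -, -, B, -, hBK, hx⟩
  exact hBK (Metric.mem_sphere.1 hx).le

namespace IsAdapted

variable (h : IsAdapted P ε L δ r u A U U')
include h

/-- The duration is only logarithmic in `1/δ`: `e^s = r / (8L/3) ≤ δ⁻²`, so `δ (1 + s/2) ≤ δ e^{s/2}
≤ 1`. -/
lemma delta_mul_s_le (hδ0 : 0 < δ) (hδL : δ ^ 2 ≤ 8 / 3 * L) (hr1 : r < 1) : δ * P.s ≤ 2 := by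
  have h1 := Real.add_one_le_exp (P.s / 2)
  have h2 : Real.exp (P.s / 2) ^ 2 = Real.exp P.s := by
    rw [← Real.exp_nat_mul]; push_cast; ring_nf
  have h3 : (δ * Real.exp (P.s / 2)) ^ 2 ≤ 1 ^ 2 := by
    rw [mul_pow, h2, one_pow]
    have := mul_le_mul_of_nonneg_right hδL (Real.exp_pos P.s).le
    rw [h.mul_exp_s] at this
    linarith
  have h4 := le_of_sq_le_sq h3 zero_le_one
  nlinarith

lemma phase_one_bound (hc : IsConfiguration Ω U u A) (hε : 0 < ε) (hδ : δ ≤ 1 / 2) (hU'U : U' ⊆ U)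
    {K : Disc} (hK : K ∈ discsIn P.final U) {η : ℝ} {G : Plane → Plane}
    (hG : IsVortexField P u U η G) :
    MeasurableSet (swept P.famD (switchTimes P u η K) K 0 P.σ) ∧
    IntegrableOn (excess ε u A G) (swept P.famD (switchTimes P u η K) K 0 P.σ) ∧
    Real.pi * |deg u K| * (P.σ - 0 - timeLoss (totalRadius (P.famC 0)) r (6 / 100) 0 0 P.σ)
      - r / 3 * totalRadius (P.famC 0) * (Real.exp P.σ - Real.exp 0) *
        ∫ x in K.toSet, curl A x ^ 2 ≤
      ∫ x in swept P.famD (switchTimes P u η K) K 0 P.σ, excess ε u A G x := by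
  have hrc := h.totalRadius_core_pos
  refine h.phase_bound hc hδ hK hG le_rfl h.σ_nonneg (by linarith [h.s_nonneg]) h.r_pos hrc.le
    (m₁ := 6) (by norm_num) le_rfl (by norm_num)
    (fun a b ha hb hT => h.isRegularOn_phase_one hδ hK ha hb fun q hq =>
      hT q (timesC_subset P u η K hq))
    (fun t ht => h.totalRadius_phase_one ht.1.le ht.2) ?_ ?_ ?_
  · intro t ht B hB hBK x hx g
    exact weight_error_le_of_any hε
  · intro t ht B hB hBK
    -- Squaring the bound by `10 ε e^t |d_B|` gives a factor `100`, whence `M = 6/100` for `m₁ = 6`.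
    have h1 := h.deg_le_radius hc hU'U hK ht.1.le ht.2 hB hBK hε
    have h2 := pow_le_pow_left₀ (by positivity) h1 2
    have e : (10 * ε * Real.exp t * |deg u B|) ^ 2 =
        100 * (deg u B ^ 2 * ε ^ 2 * Real.exp (2 * t)) := by
      have : Real.exp (2 * t) = Real.exp t ^ 2 := by rw [← Real.exp_nat_mul]; push_cast; rfl
      rw [this, ← sq_abs (deg u B)]; ring
    rw [e] at h2
    linarith
  · intro a b ha hab hb
    refine timeLoss_le h.r_pos hab ha ?_ hrc.le (by norm_num) (by norm_num)
    calc totalRadius (P.famC 0) * Real.exp b ≤ totalRadius (P.famC 0) * Real.exp P.σ := by gcongr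
      _ = L := h.totalRadius_mul_exp
      _ ≤ r := by linarith [h.le_r, h.L_pos]

lemma phase_two_bound (hc : IsConfiguration Ω U u A) (hδ0 : 0 < δ) (hδ : δ ≤ 1 / 100)
    {K : Disc} (hK : K ∈ discsIn P.final U) {η : ℝ} {G : Plane → Plane}
    (hG : IsVortexField P u U η G) :
    MeasurableSet (swept P.famD (switchTimes P u η K) K P.σ (P.σ + P.s)) ∧
    IntegrableOn (excess ε u A G) (swept P.famD (switchTimes P u η K) K P.σ (P.σ + P.s)) ∧
    Real.pi * |deg u K| * (P.σ + P.s - P.σ -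
        timeLoss (8 / 3 * L * Real.exp (-P.σ)) r 0 (7 * δ) P.σ (P.σ + P.s))
      - r / 3 * (8 / 3 * L * Real.exp (-P.σ)) * (Real.exp (P.σ + P.s) - Real.exp P.σ) *
        ∫ x in K.toSet, curl A x ^ 2 ≤
      ∫ x in swept P.famD (switchTimes P u η K) K P.σ (P.σ + P.s), excess ε u A G x := by
  have hL := h.L_pos
  have hκ0 : 0 ≤ 8 / 3 * L * Real.exp (-P.σ) := by positivity
  have hδ2 : δ ≤ 1 / 2 := by linarith
  refine h.phase_bound hc hδ2 hK hG h.σ_nonneg (by linarith [h.s_nonneg]) le_rfl h.r_pos hκ0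
    (m₁ := 0) le_rfl (by positivity) le_rfl
    (fun a b ha hb hT => h.isRegularOn_phase_two hδ2 hK ha hb fun q hq =>
      hT _ (timesB_subset P u η K hq))
    (fun t ht => h.totalRadius_phase_two ht.1.le) ?_ ?_ ?_
  · intro t ht B hB hBK x hx g
    exact weight_error_le_of_near_one (h.near_one_of_phase_two hK ht.1 hB
      (hBK (Metric.mem_sphere.1 hx).le) hx) hδ2 (potential_nonneg ε u x)
  · intro t ht B hB hBK
    simp
  · intro a b ha hab hb
    refine timeLoss_le h.r_pos hab (h.σ_nonneg.trans ha) ?_ hκ0 le_rfl (by linarith)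
    calc 8 / 3 * L * Real.exp (-P.σ) * Real.exp b
        ≤ 8 / 3 * L * Real.exp (-P.σ) * Real.exp (P.σ + P.s) := by gcongr
      _ = 8 / 3 * L * Real.exp P.s := by
        rw [mul_assoc, ← Real.exp_add, neg_add_cancel_left]
      _ = r := h.mul_exp_s
      _ ≤ r := le_rfl

/-- The energy in the region swept inside a final disc. -/
lemma exists_swept (hc : IsConfiguration Ω U u A) (hε : 0 < ε) (hδ0 : 0 < δ) (hδ : δ ≤ 1 / 100)
    (hδL : δ ^ 2 ≤ 8 / 3 * L) (hr1 : r < 1) (hU'U : U' ⊆ U)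
    {K : Disc} (hK : K ∈ discsIn P.final U) {η : ℝ} {G : Plane → Plane}
    (hG : IsVortexField P u U η G) :
    ∃ S N : Set Plane, MeasurableSet S ∧ volume N = 0 ∧ S ⊆ K.toSet ∧
      Disjoint S (discUnion (P.famC 0)) ∧ IntegrableOn (excess ε u A G) S ∧
      (∀ x ∈ K.toSet, x ∉ S → x ∉ N → G x = 0) ∧
      Real.pi * |deg u K| * (P.σ + P.s - 30) - r ^ 2 / 3 * ∫ x in K.toSet, curl A x ^ 2 ≤
        ∫ x in S, excess ε u A G x := by
  have hδ2 : δ ≤ 1 / 2 := by linarith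
  obtain ⟨hm1, hi1, hb1⟩ := h.phase_one_bound hc hε hδ2 hU'U hK hG
  obtain ⟨hm2, hi2, hb2⟩ := h.phase_two_bound hc hδ0 hδ hK hG
  set T := switchTimes P u η K with hT
  have hσ := h.σ_nonneg
  have hs := h.s_nonneg
  have hdisj : Disjoint (swept P.famD T K 0 P.σ) (swept P.famD T K P.σ (P.σ + P.s)) :=
    disjoint_swept (a₀ := 0) (b₀ := P.σ + P.s) (fun t t' ht htt' _ x hx => h.nest ht.le htt' hx)
      (fun t ht _ => h.collection ht.le) le_rfl le_rfl
  refine ⟨swept P.famD T K 0 P.σ ∪ swept P.famD T K P.σ (P.σ + P.s),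
    -- The null set consists of the circles at the finitely many end, merging and transition times,
    -- which the swept regions omit.
    ⋃ t ∈ ({0, P.σ, P.σ + P.s} ∪ (↑T : Set ℝ)), ⋃ B ∈ P.famD t,
      Metric.sphere B.center B.radius, hm1.union hm2, ?_, Set.union_subset swept_subset swept_subset,
      ?_, hi1.union hi2, ?_, ?_⟩
  · have hfin : ({0, P.σ, P.σ + P.s} ∪ (↑T : Set ℝ)).Finite :=
      (Set.toFinite _).union T.finite_toSet
    rw [measure_biUnion_null_iff hfin.countable]
    intro t _
    exact (measure_biUnion_null_iff (P.famD t).countable_toSet).2 fun B _ => volume_sphere _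
  · refine Set.disjoint_left.2 ?_
    have key : ∀ t, 0 < t → ∀ B ∈ P.famD t, ∀ x ∈ Metric.sphere B.center B.radius,
        x ∉ discUnion (P.famC 0) := fun t ht B hB x hx hx' =>
      not_mem_ball_of_mem_sphere (h.collection ht.le) hB hx (h.nest_core ht hx')
    rintro x (⟨t, ht, -, B, hB, -, hx⟩ | ⟨t, ht, -, B, hB, -, hx⟩)
    · exact key t ht.1 B hB x hx
    · exact key t (hσ.trans_lt ht.1) B hB x hx
  · intro x hxK hxS hxN
    refine hG.off_circle x fun t B K' hx => ?_
    have hxB : x ∈ B.toSet := (Metric.mem_sphere.1 hx.mem_sphere).le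
    obtain rfl : K' = K := h.collection_final.eq_of_mem (mem_discsIn.1 hx.mem_final).1
      (mem_discsIn.1 hK).1 (hx.subset hxB) hxK
    have hnot : t ∉ ({0, P.σ, P.σ + P.s} ∪ (↑T : Set ℝ)) := fun hmem =>
      hxN (Set.mem_biUnion hmem (Set.mem_biUnion hx.mem_famD hx.mem_sphere))
    simp only [Set.mem_union, Set.mem_insert_iff, Set.mem_singleton_iff, Finset.mem_coe] at hnot
    push Not at hnot
    obtain ⟨⟨h0, h1, h2⟩, h3⟩ := hnot
    have ht0 : 0 < t := lt_of_le_of_ne hx.time_mem.1 (Ne.symm h0)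
    have ht1 : t < P.σ + P.s := lt_of_le_of_ne hx.time_mem.2 h2
    refine hxS ?_
    rcases lt_or_gt_of_ne h1 with hlt | hlt
    · exact Or.inl ⟨t, ⟨ht0, hlt⟩, h3, B, hx.mem_famD, hx.subset, hx.mem_sphere⟩
    · exact Or.inr ⟨t, ⟨hlt, ht1⟩, h3, B, hx.mem_famD, hx.subset, hx.mem_sphere⟩
  · rw [setIntegral_union hdisj hm2 hi1 hi2]
    set Z := ∫ x in K.toSet, curl A x ^ 2
    have hZ : 0 ≤ Z := integral_nonneg fun x => sq_nonneg _
    have hr := h.r_pos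
    have hL := h.L_pos
    have hrc := h.totalRadius_core_pos
    have e1 : totalRadius (P.famC 0) * (Real.exp P.σ - Real.exp 0) = L - totalRadius (P.famC 0) := by
      rw [Real.exp_zero, mul_sub, h.totalRadius_mul_exp, mul_one]
    have e2 : 8 / 3 * L * Real.exp (-P.σ) * (Real.exp (P.σ + P.s) - Real.exp P.σ) =
        r - 8 / 3 * L := by
      have h1 : Real.exp (-P.σ) * Real.exp (P.σ + P.s) = Real.exp P.s := by
        rw [← Real.exp_add, neg_add_cancel_left]
      have h2 : Real.exp (-P.σ) * Real.exp P.σ = 1 := by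
        rw [← Real.exp_add, neg_add_cancel, Real.exp_zero]
      linear_combination 8 / 3 * L * h1 - 8 / 3 * L * h2 + h.mul_exp_s
    have l1 : timeLoss (totalRadius (P.famC 0)) r (6 / 100) 0 0 P.σ ≤
        3 / 4 * (L - totalRadius (P.famC 0)) / r + 6 / 100 := by
      have h1 : Real.exp (-2 * 0) - Real.exp (-2 * P.σ) ≤ 1 := by
        have := Real.exp_pos (-2 * P.σ)
        rw [mul_zero, Real.exp_zero]; linarith
      rw [timeLoss, ← e1]
      have e : 3 / 4 * totalRadius (P.famC 0) / r * (Real.exp P.σ - Real.exp 0) =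
        3 / 4 * (totalRadius (P.famC 0) * (Real.exp P.σ - Real.exp 0)) / r := by ring
      rw [e, mul_zero 2, zero_mul, add_zero]
      exact add_le_add le_rfl
        ((mul_le_mul_of_nonneg_left h1 (by norm_num)).trans_eq (mul_one _))
    have l2 : timeLoss (8 / 3 * L * Real.exp (-P.σ)) r 0 (7 * δ) P.σ (P.σ + P.s) ≤
        3 / 4 * (r - 8 / 3 * L) / r + 28 := by
      have h1 := h.delta_mul_s_le hδ0 hδL hr1
      rw [timeLoss, ← e2]
      have e : 3 / 4 * (8 / 3 * L * Real.exp (-P.σ)) / r * (Real.exp (P.σ + P.s) - Real.exp P.σ) =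
        3 / 4 * (8 / 3 * L * Real.exp (-P.σ) * (Real.exp (P.σ + P.s) - Real.exp P.σ)) / r := by ring
      rw [e]
      linarith
    have l3 : 3 / 4 * (L - totalRadius (P.famC 0)) / r + 3 / 4 * (r - 8 / 3 * L) / r ≤ 3 / 4 := by
      rw [← add_div, div_le_iff₀ hr]
      linarith
    -- The losses are `3/4` from the circulation in both phases together, `6/100` from the modulus
    -- in the first phase and `2 · 7 δ s ≤ 28` in the second.
    have hloss : P.σ + P.s - 30 ≤
        (P.σ - 0 - timeLoss (totalRadius (P.famC 0)) r (6 / 100) 0 0 P.σ) +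
        (P.σ + P.s - P.σ - timeLoss (8 / 3 * L * Real.exp (-P.σ)) r 0 (7 * δ) P.σ (P.σ + P.s)) := by
      linarith
    have h3 := mul_le_mul_of_nonneg_left hloss
      (by positivity : 0 ≤ Real.pi * |deg u K|)
    have h4 : r / 3 * totalRadius (P.famC 0) * (Real.exp P.σ - Real.exp 0) * Z +
        r / 3 * (8 / 3 * L * Real.exp (-P.σ)) * (Real.exp (P.σ + P.s) - Real.exp P.σ) * Z ≤
        r ^ 2 / 3 * Z := by
      have e : r / 3 * totalRadius (P.famC 0) * (Real.exp P.σ - Real.exp 0) * Z +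
        r / 3 * (8 / 3 * L * Real.exp (-P.σ)) * (Real.exp (P.σ + P.s) - Real.exp P.σ) * Z =
        r / 3 * ((L - totalRadius (P.famC 0)) + (r - 8 / 3 * L)) * Z := by
        rw [← e1, ← e2]; ring
      have e' : r ^ 2 / 3 * Z = r / 3 * r * Z := by ring
      rw [e, e']
      have : L - totalRadius (P.famC 0) + (r - 8 / 3 * L) ≤ r := by linarith
      gcongr
    linarith

end IsAdapted

end Bound

end VortexBalls

namespace VortexBalls

open MeasureTheory

/-! ### Balance between the initial energy and the logarithm, and the conclusion -/

section Final

variable {P : TwoPhase} {u : Plane → ℂ} {A : Plane → Plane} {U U' Ω : Set Plane} {ε L δ r : ℝ}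

lemma excess_of_eq_zero {G : Plane → Plane} {x : Plane} (hG : G x = 0) :
    excess ε u A G x = 4 / 9 * (covGradSq u A x + potential ε u x) := by
  rw [excess_congr (G' := 0) hG, excess, add_zero]
  ring

/-- With `x = rc/(ε D)`, the wanted logarithm exceeds `τ` by `log x` and a constant. If `x` is
large, the energy of the initial discs, of order `rc/ε = D x`, outweighs `D log x`. -/
lemma log_ratio_bound {D rc τ : ℝ} (hD : 1 ≤ D) (hε : 0 < ε) (hrc : 0 < rc)
    (hτ : 8 / 3 * rc * Real.exp τ = r) :
    Real.pi * D * (Real.log (r / (ε * D)) - 25600) ≤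
      Real.pi * D * (τ - 30) + 4 / 9 * ((rc - ε) / (6400 * ε)) := by
  have hpi := Real.pi_gt_three
  have hpi4 := Real.pi_le_four
  have hD0 : 0 < D := by linarith
  set x := rc / (ε * D) with hx
  have hx0 : 0 < x := by positivity
  have hlog : Real.log (r / (ε * D)) = Real.log (8 / 3) + Real.log x + τ := by
    have e : r / (ε * D) = 8 / 3 * x * Real.exp τ := by rw [← hτ, hx]; ring
    rw [e, Real.log_mul (by positivity) (Real.exp_ne_zero _), Real.log_exp,
      Real.log_mul (by norm_num) hx0.ne']
  have h1 : Real.log (8 / 3) ≤ 8 / 3 - 1 := Real.log_le_sub_one_of_pos (by norm_num)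
  -- The slope is dictated by the initial energy: `(4/9) rc / (6400 ε) = 4 D x / 57600`, and `π ≤
  -- 4`. The constant comes from `57600 = 240²`.
  have h2 : Real.log x ≤ x / 57600 + 480 := by
    have e : x = x / 57600 * (240 * 240) := by ring
    have h3 : Real.log (x / 57600) ≤ x / 57600 - 1 := Real.log_le_sub_one_of_pos (by positivity)
    have h4 : Real.log 240 ≤ 240 - 1 := Real.log_le_sub_one_of_pos (by norm_num)
    have h5 : Real.log x = Real.log (x / 57600) + (Real.log 240 + Real.log 240) := by
      rw [← Real.log_mul (by norm_num) (by norm_num), ← Real.log_mul (by positivity) (by norm_num),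
        ← e]
    linarith
  have h6 : Real.pi * D * (x / 57600) ≤ 4 / 9 * (rc / (6400 * ε)) := by
    have e : 4 / 9 * (rc / (6400 * ε)) = 4 * (D * (x / 57600)) := by
      rw [hx]; field_simp; norm_num
    rw [e, mul_assoc]
    exact mul_le_mul_of_nonneg_right hpi4 (by positivity)
  have h7 : 4 / 9 * ((rc - ε) / (6400 * ε)) = 4 / 9 * (rc / (6400 * ε)) - 1 / 14400 := by
    field_simp; ring
  have h8 : Real.pi * D * (Real.log (r / (ε * D)) - 25600) ≤
      Real.pi * D * (τ - 30 + x / 57600 - 1) :=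
    mul_le_mul_of_nonneg_left (by rw [hlog]; linarith) (by positivity)
  have h9 : 3 * 1 ≤ Real.pi * D := mul_le_mul hpi.le hD zero_le_one (by positivity)
  rw [h7]
  linarith

namespace IsAdapted

variable (h : IsAdapted P ε L δ r u A U U')
include h

lemma core_subset_final : discUnion (P.famC 0) ⊆ discUnion P.final :=
  (h.additive.union_subset 0 P.σ le_rfl h.σ_nonneg).trans
    (h.famC_subset.trans (h.growthB.union_subset 0 P.s le_rfl h.s_nonneg))

lemma s_pos (hr : 8 / 3 * L < r) : 0 < P.s := by
  refine lt_of_le_of_ne h.s_nonneg fun h0 => ?_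
  have := h.mul_exp_s
  rw [← h0, Real.exp_zero, mul_one] at this
  exact hr.ne this

lemma one_le_totalDegree (hc : IsConfiguration Ω U u A) (hδ : δ ≤ 1 / 2) (hr : 8 / 3 * L < r)
    (hD : totalDegree u U P.final ≠ 0) : 1 ≤ totalDegree u U P.final := by
  obtain ⟨K, hK, hne⟩ := Finset.exists_ne_zero_of_sum_ne_zero hD
  obtain ⟨k, hk⟩ := h.exists_int_deg hc hδ hK (t := P.σ + P.s)
    (add_pos_of_nonneg_of_pos h.σ_nonneg (h.s_pos hr))
    (by rw [h.famD_final]; exact (mem_discsIn.1 hK).1) subset_rfl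
  have h1 : 1 ≤ |deg u K| := by
    rw [hk] at hne ⊢
    exact_mod_cast Int.one_le_abs (by simpa using hne)
  exact h1.trans (Finset.single_le_sum (f := fun K => |deg u K|) (fun K _ => abs_nonneg _) hK)

/-- The energy in the initial discs. -/
lemma core_energy_le (hc : IsConfiguration Ω U u A) :
    (totalRadius (P.famC 0) - ε) / (6400 * ε) ≤
      (∫ x in (⋃ B ∈ P.famC 0, (Metric.ball B.center B.radius ∩ U)),
        (covGradSq u A x + potential ε u x)) +
      r ^ 2 / 16 * ∫ x in U ∩ discUnion P.final, curl A x ^ 2 := by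
  have hcol := h.core.collection
  have hm : ∀ B ∈ P.famC 0, MeasurableSet (Metric.ball B.center B.radius ∩ U) :=
    fun B _ => measurableSet_ball_inter hc B
  have hd : (↑(P.famC 0) : Set Disc).PairwiseDisjoint
      fun B => Metric.ball B.center B.radius ∩ U := fun B hB B' hB' hne =>
    (hcol.disjoint B hB B' hB' hne).mono
      (Set.inter_subset_left.trans (ball_subset_toSet B))
      (Set.inter_subset_left.trans (ball_subset_toSet B'))
  refine h.core.energy.trans ?_
  simp only [discEnergy]
  rw [Finset.sum_add_distrib, integral_biUnion_finset _ hm hd fun B _ =>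
    (hc.integrableOn_energy ε).mono_set Set.inter_subset_right]
  refine add_le_add le_rfl ?_
  have hV : MeasurableSet (U ∩ discUnion P.final) :=
    hc.isOpen_sub.measurableSet.inter (isClosed_discUnion _).measurableSet
  have h1 : ∑ B ∈ P.famC 0, ∫ x in Metric.ball B.center B.radius ∩ U, curl A x ^ 2 ≤
      ∫ x in U ∩ discUnion P.final, curl A x ^ 2 :=
    sum_setIntegral_le hm hd (fun B hB x hx => ⟨hx.2, h.core_subset_final
      (mem_discUnion.2 ⟨B, hB, ball_subset_toSet _ hx.1⟩)⟩) hV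
      (hc.integrableOn_curl_sq.mono_set Set.inter_subset_left) fun x _ => sq_nonneg _
  refine le_trans ?_ (mul_le_mul_of_nonneg_left h1 (by positivity))
  rw [Finset.mul_sum]
  refine Finset.sum_le_sum fun B hB => ?_
  have h2 : B.radius ≤ r := by
    have h3 : B.radius ≤ totalRadius (P.famC 0) :=
      Finset.single_le_sum (f := Disc.radius) (fun B hB => (hcol.radius_pos B hB).le) hB
    linarith [h.core.totalRadius_le, h.le_r, h.L_pos]
  have h4 := (hcol.radius_pos B hB).le
  have h5 : 0 ≤ ∫ x in Metric.ball B.center B.radius ∩ U, curl A x ^ 2 :=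
    integral_nonneg fun x => sq_nonneg _
  gcongr

/-- The lower bound for the energy in the final discs. -/
lemma energy_bound (hc : IsConfiguration Ω U u A) (hε : 0 < ε) (hδ0 : 0 < δ) (hδ : δ ≤ 1 / 100)
    (hδL : δ ^ 2 ≤ 8 / 3 * L) (hr1 : r < 1) (hr : 8 / 3 * L < r) (hU'U : U' ⊆ U) {η : ℝ}
    {G : Plane → Plane} (hG : IsVortexField P u U η G) :
    IntegrableOn (fun x => covGradSq u A x + potential ε u x + r ^ 2 * curl A x ^ 2)
      (U ∩ discUnion P.final) ∧
    IntegrableOn (fun x => covGradSq u (A + G) x + potential ε u x) (U ∩ discUnion P.final) ∧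
    (totalDegree u U P.final ≠ 0 →
      Real.pi * totalDegree u U P.final *
          (Real.log (r / (ε * totalDegree u U P.final)) - 25600)
        + 1 / 18 * ∫ x in U ∩ discUnion P.final, (covGradSq u (A + G) x + potential ε u x)
      ≤ 1 / 2 * ∫ x in U ∩ discUnion P.final,
          (covGradSq u A x + potential ε u x + r ^ 2 * curl A x ^ 2)) := by
  classical
  set V := U ∩ discUnion P.final with hVdef
  set 𝓚 := discsIn P.final U with h𝓚
  have hVm : MeasurableSet V :=
    hc.isOpen_sub.measurableSet.inter (isClosed_discUnion _).measurableSet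
  have hEV : IntegrableOn (fun x => covGradSq u A x + potential ε u x) V :=
    (hc.integrableOn_energy ε).mono_set Set.inter_subset_left
  have hCV : IntegrableOn (fun x => curl A x ^ 2) V :=
    hc.integrableOn_curl_sq.mono_set Set.inter_subset_left
  choose! S N hSm hN hSK hScore hSi hGz hSb using fun K (hK : K ∈ 𝓚) =>
    h.exists_swept hc hε hδ0 hδ hδL hr1 hU'U hK hG
  have hKV : ∀ K ∈ 𝓚, K.toSet ⊆ V := fun K hK x hx =>
    ⟨(mem_discsIn.1 hK).2 hx, mem_discUnion.2 ⟨K, (mem_discsIn.1 hK).1, hx⟩⟩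
  set W := ⋃ K ∈ 𝓚, S K with hW
  have hWm : MeasurableSet W := Finset.measurableSet_biUnion 𝓚 hSm
  have hWV : W ⊆ V := Set.iUnion₂_subset fun K hK => (hSK K hK).trans (hKV K hK)
  have hKdis : (↑𝓚 : Set Disc).PairwiseDisjoint Disc.toSet := fun K hK K' hK' hne =>
    h.collection_final.disjoint K (mem_discsIn.1 hK).1 K' (mem_discsIn.1 hK').1 hne
  have hSdis : (↑𝓚 : Set Disc).PairwiseDisjoint S := fun K hK K' hK' hne =>
    (hKdis hK hK' hne).mono (hSK K hK) (hSK K' hK')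
  have hWi : IntegrableOn (excess ε u A G) W := by
    rw [hW, integrableOn_finset_iUnion]; exact hSi
  have hN0 : volume (⋃ K ∈ 𝓚, N K) = 0 :=
    (measure_biUnion_null_iff 𝓚.countable_toSet).2 hN
  have hzero : ∀ x ∈ V \ W, x ∉ ⋃ K ∈ 𝓚, N K → G x = 0 := by
    rintro x ⟨⟨hxU, hxV⟩, hxW⟩ hxN
    by_contra hne
    have hex : ∃ t B K, P.OnCircle U x t B K := by
      by_contra! hcon
      exact hne (hG.off_circle x hcon)
    obtain ⟨t, B, K, hx⟩ := hex
    have hxK : x ∈ K.toSet := hx.subset (Metric.mem_sphere.1 hx.mem_sphere).le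
    exact hne (hGz K hx.mem_final x hxK (fun hxS => hxW (Set.mem_biUnion hx.mem_final hxS))
      fun hxN' => hxN (Set.mem_biUnion hx.mem_final hxN'))
  -- Off the swept region the vector field vanishes almost everywhere, so there the excess is `4/9`
  -- of the full energy density; the initial discs lie in this part.
  have hae : (fun x => 4 / 9 * (covGradSq u A x + potential ε u x)) =ᵐ[volume.restrict (V \ W)]
      excess ε u A G := by
    have h1 : ∀ᵐ x ∂volume.restrict (V \ W), x ∉ ⋃ K ∈ 𝓚, N K :=
      ae_restrict_of_ae (measure_eq_zero_iff_ae_notMem.1 hN0)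
    filter_upwards [h1, ae_restrict_mem (hVm.diff hWm)] with x hx1 hx2
    exact (excess_of_eq_zero (hzero x hx2 hx1)).symm
  have hEd : IntegrableOn (fun x => 4 / 9 * (covGradSq u A x + potential ε u x)) (V \ W) :=
    (hEV.mono_set Set.sdiff_subset).const_mul _
  have hdi : IntegrableOn (excess ε u A G) (V \ W) := hEd.congr hae
  have hVi : IntegrableOn (excess ε u A G) V := by
    have := hWi.union hdi
    rwa [Set.union_sdiff_cancel hWV] at this
  -- The shifted energy is a combination of the original energy and the excess, so its integrability
  -- needs no separate study of the vector field.
  have hGi : IntegrableOn (fun x => covGradSq u (A + G) x + potential ε u x) V := by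
    have e : (fun x => covGradSq u (A + G) x + potential ε u x) =
        fun x => 9 * (covGradSq u A x + potential ε u x) - 18 * excess ε u A G x := by
      funext x; rw [excess]; ring
    rw [e]
    exact (hEV.const_mul 9).sub (hVi.const_mul 18)
  refine ⟨hEV.add (hCV.const_mul _), hGi, fun hD => ?_⟩
  have hD1 := h.one_le_totalDegree hc (by linarith) hr hD
  set D := totalDegree u U P.final with hDdef
  have hsplit : ∫ x in V, excess ε u A G x =
      1 / 2 * (∫ x in V, (covGradSq u A x + potential ε u x)) -
      1 / 18 * ∫ x in V, (covGradSq u (A + G) x + potential ε u x) := by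
    simp only [excess]
    rw [integral_sub (hEV.const_mul _) (hGi.const_mul _), integral_const_mul, integral_const_mul]
  have hcurl : ∫ x in V, (covGradSq u A x + potential ε u x + r ^ 2 * curl A x ^ 2) =
      (∫ x in V, (covGradSq u A x + potential ε u x)) + r ^ 2 * ∫ x in V, curl A x ^ 2 := by
    rw [integral_add hEV (hCV.const_mul _), integral_const_mul]
  have hexc : ∫ x in V, excess ε u A G x =
      (∫ x in W, excess ε u A G x) + ∫ x in V \ W, excess ε u A G x := by
    rw [← setIntegral_union disjoint_sdiff_self_right (hVm.diff hWm) hWi hdi,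
      Set.union_sdiff_cancel hWV]
  set Z := ∫ x in V, curl A x ^ 2 with hZ
  have hWb : Real.pi * D * (P.σ + P.s - 30) - r ^ 2 / 3 * Z ≤ ∫ x in W, excess ε u A G x := by
    rw [hW, integral_biUnion_finset 𝓚 hSm hSdis hSi]
    refine le_trans ?_ (Finset.sum_le_sum hSb)
    rw [Finset.sum_sub_distrib, ← Finset.sum_mul, ← Finset.mul_sum, ← Finset.mul_sum]
    have h1 : ∑ K ∈ 𝓚, ∫ x in K.toSet, curl A x ^ 2 ≤ Z :=
      sum_setIntegral_le (fun K _ => (isClosed_toSet K).measurableSet) hKdis hKV hVm hCV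
        fun x _ => sq_nonneg _
    have h2 := mul_le_mul_of_nonneg_left h1 (by positivity : 0 ≤ r ^ 2 / 3)
    have h3 : D = ∑ K ∈ 𝓚, |deg u K| := rfl
    rw [h3]
    linarith
  -- The curl weight `1/16` of the initial discs becomes `(4/9)/16 = 1/36`. Together with the `1/3`
  -- spent on the growth this stays below the available `1/2`.
  have hdb : 4 / 9 * ((totalRadius (P.famC 0) - ε) / (6400 * ε)) - r ^ 2 / 36 * Z ≤
      ∫ x in V \ W, excess ε u A G x := by
    rw [← setIntegral_congr_ae₀ (hVm.diff hWm).nullMeasurableSet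
      ((ae_restrict_iff' (hVm.diff hWm)).1 hae), integral_const_mul]
    have h1 := h.core_energy_le hc
    have h2 : ∫ x in (⋃ B ∈ P.famC 0, (Metric.ball B.center B.radius ∩ U)),
        (covGradSq u A x + potential ε u x) ≤
        ∫ x in V \ W, (covGradSq u A x + potential ε u x) := by
      refine setIntegral_mono_set (hEV.mono_set Set.sdiff_subset)
        (ae_of_all _ fun x => energyDensity_nonneg ε u A x) (LE.le.eventuallyLE ?_)
      refine Set.iUnion₂_subset fun B hB x hx => ?_
      have hxC : x ∈ discUnion (P.famC 0) := mem_discUnion.2 ⟨B, hB, ball_subset_toSet _ hx.1⟩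
      refine ⟨⟨hx.2, h.core_subset_final hxC⟩, fun hxW => ?_⟩
      simp only [hW, Set.mem_iUnion] at hxW
      obtain ⟨K, hK, hxS⟩ := hxW
      exact Set.disjoint_left.1 (hScore K hK) hxS hxC
    linarith
  have hZ0 : 0 ≤ Z := integral_nonneg fun x => sq_nonneg _
  have hrZ : 0 ≤ r ^ 2 * Z := by positivity
  have hlog := log_ratio_bound (r := r) (τ := P.σ + P.s) hD1 hε h.totalRadius_core_pos (by
    rw [Real.exp_add, ← h.mul_exp_s, ← h.totalRadius_mul_exp]; ring)
  rw [hcurl]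
  linarith

end IsAdapted

/-! ### The interior region -/

/-- The ball is connected, meets the open set at its centre and avoids the frontier. -/
lemma closedBall_subset_of_lt_infDist (hΩ : IsOpen Ω) {x : Plane} (hx : x ∈ Ω) {ρ : ℝ}
    (hρ : ρ < Metric.infDist x (frontier Ω)) : Metric.closedBall x ρ ⊆ Ω := by
  rcases lt_or_ge ρ 0 with h0 | h0
  · rw [Metric.closedBall_eq_empty.2 h0]; exact Set.empty_subset _
  refine (convex_closedBall x ρ).isPreconnected.subset_left_of_subset_union hΩ
    isClosed_closure.isOpen_compl (disjoint_compl_right.mono_left subset_closure) ?_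
    ⟨x, Metric.mem_closedBall_self h0, hx⟩
  intro y hy
  by_contra hcon
  simp only [Set.mem_union, Set.mem_compl_iff, not_or, not_not] at hcon
  have hyf : y ∈ frontier Ω := by rw [hΩ.frontier_eq]; exact ⟨hcon.2, hcon.1⟩
  have h1 := Metric.infDist_le_dist_of_mem (x := x) hyf
  rw [Metric.mem_closedBall, dist_comm] at hy
  linarith

lemma closure_interiorAt (hΩ : IsOpen Ω) (hε : 0 < ε) {x : Plane}
    (hx : x ∈ closure (interiorAt Ω ε)) : x ∈ Ω ∧ ε ≤ Metric.infDist x (frontier Ω) := by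
  have h1 : ε ≤ Metric.infDist x (frontier Ω) := by
    have hcl : IsClosed {x | ε ≤ Metric.infDist x (frontier Ω)} :=
      isClosed_le continuous_const (Metric.continuous_infDist_pt _)
    exact closure_minimal (fun y hy => hy.2.le) hcl hx
  refine ⟨?_, h1⟩
  by_contra hxΩ
  have h2 : x ∈ frontier Ω := by
    rw [hΩ.frontier_eq]
    exact ⟨closure_mono (fun y hy => hy.1) hx, hxΩ⟩
  rw [Metric.infDist_zero_of_mem h2] at h1
  linarith

lemma isConfiguration_interiorAt (hΩ : IsOpen Ω) (hb : Bornology.IsBounded Ω) (hε : 0 < ε)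
    (hu : ContDiffOn ℝ 1 u Ω) (hA : ContDiffOn ℝ 1 A Ω) :
    IsConfiguration Ω (interiorAt Ω ε) u A where
  isOpen := hΩ
  isOpen_sub := hΩ.inter (isOpen_lt continuous_const (Metric.continuous_infDist_pt _))
  isCompact_closure := (hb.subset fun _ hx => hx.1).isCompact_closure
  closure_subset _ hx := (closure_interiorAt hΩ hε hx).1
  contDiffOn := hu
  contDiffOn_field := hA

/-- With `δ = ε^(α/4)` everything becomes a power of `δ`: the energy bound times `ε` equals `δ⁴`. So
the core has total radius of order `δ⁴` before enlargement, and the cover, after division by `δ²`,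
of order `δ²`. -/
lemma small_parameter {α : ℝ} (hα : α ∈ Set.Ioo (0 : ℝ) 1) (hε : 0 < ε)
    (hε₀ : ε ≤ (1 / 100) ^ (4 / α)) : ε ^ (α / 4) ≤ 1 / 100 ∧ ε ^ (α / 2) = (ε ^ (α / 4)) ^ 2 ∧
      ε ^ (α - 1) * ε = (ε ^ (α / 4)) ^ 4 ∧ ε ≤ (ε ^ (α / 4)) ^ 4 := by
  have hα0 := hα.1
  have h4 : (ε ^ (α / 4)) ^ 4 = ε ^ α := by
    rw [← Real.rpow_natCast, ← Real.rpow_mul hε.le]; congr 1; push_cast; ring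
  have h1 : ε ^ (α / 4) ≤ 1 / 100 := by
    refine (Real.rpow_le_rpow hε.le hε₀ (by positivity)).trans_eq ?_
    rw [← Real.rpow_mul (by norm_num)]
    have : 4 / α * (α / 4) = 1 := by field_simp
    rw [this, Real.rpow_one]
  have hε1 : ε ≤ 1 := hε₀.trans (Real.rpow_le_one (by norm_num) (by norm_num) (by positivity))
  refine ⟨h1, ?_, ?_, ?_⟩
  · rw [← Real.rpow_natCast, ← Real.rpow_mul hε.le]; congr 1; push_cast; ring
  · rw [h4]
    nth_rewrite 2 [← Real.rpow_one ε]
    rw [← Real.rpow_add hε, sub_add_cancel]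
  · rw [h4]
    calc ε = ε ^ (1 : ℝ) := (Real.rpow_one ε).symm
      _ ≤ ε ^ α := Real.rpow_le_rpow_of_exponent_ge hε hε1 hα.2.le

end Final

end VortexBalls

theorem theorem1 :
    ∃ C₀ C : ℝ, 0 < C₀ ∧ 0 < C ∧
    ∀ α ∈ Set.Ioo (0 : ℝ) 1, ∃ ε₀ : ℝ, 0 < ε₀ ∧
    ∀ ε : ℝ, 0 < ε → ε ≤ ε₀ →
    ∀ Ω : Set Plane, IsOpen Ω → Bornology.IsBounded Ω →
    ∀ (u : Plane → ℂ) (A : Plane → Plane),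
      ContDiffOn ℝ 1 u Ω → ContDiffOn ℝ 1 A Ω →
      modulusEnergy ε u Ω ≤ ENNReal.ofReal (ε ^ (α - 1)) →
    ∀ r : ℝ, C * ε ^ (α / 2) < r → r < 1 →
    ∃ 𝓑 : Finset Disc, IsDiscCollection 𝓑 ∧
      totalRadius 𝓑 = r ∧
      {x | x ∈ interiorAt Ω ε ∧ ε ^ (α / 4) ≤ |‖u x‖ - 1|} ⊆ interiorAt Ω ε ∩ discUnion 𝓑 ∧
      ∃ P : TwoPhase,
        P.IsAdmissible u (interiorAt Ω ε) (ε ^ (α / 4)) (C₀ * ε ^ (α / 2)) ∧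
        P.final = 𝓑 ∧
        ∀ η ∈ Set.Ioo (0 : ℝ) 1, ∃ G : Plane → Plane,
          IsVortexField P u (interiorAt Ω ε) η G ∧
          MeasureTheory.IntegrableOn
            (fun x => covGradSq u A x + potential ε u x + r ^ 2 * curl A x ^ 2)
            (interiorAt Ω ε ∩ discUnion 𝓑) ∧
          MeasureTheory.IntegrableOn
            (fun x => covGradSq u (A + G) x + potential ε u x)
            (interiorAt Ω ε ∩ discUnion 𝓑) ∧
          (totalDegree u (interiorAt Ω ε) 𝓑 ≠ 0 →
            Real.pi * totalDegree u (interiorAt Ω ε) 𝓑 *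
                (Real.log (r / (ε * totalDegree u (interiorAt Ω ε) 𝓑)) - C)
              + 1 / 18 * ∫ x in interiorAt Ω ε ∩ discUnion 𝓑,
                  (covGradSq u (A + G) x + potential ε u x)
            ≤ 1 / 2 * ∫ x in interiorAt Ω ε ∩ discUnion 𝓑,
                  (covGradSq u A x + potential ε u x + r ^ 2 * curl A x ^ 2)) := by
  -- The choice `C₀ = 25600` means `L = 9600 δ²`, which leaves room for the cover, as `3200 δ² ≤
  -- 5L/3`, and for the first core, whose total radius is at most `12801 δ⁴`. The choice `C = C₀`
  -- makes `r` larger than the total radius of `𝓑(0)`, so that the second phase has positive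
  -- duration.
  refine ⟨25600, 25600, by norm_num, by norm_num, fun α hα => ⟨(1 / 100) ^ (4 / α),
    by positivity, fun ε hε hε₀ Ω hΩ hb u A hu hA hen r hr hr1 => ?_⟩⟩
  obtain ⟨hδ, h2, h3, h4⟩ := small_parameter hα hε hε₀
  rw [h2] at hr ⊢
  set δ := ε ^ (α / 4) with hδdef
  have hδ0 : 0 < δ := Real.rpow_pos_of_pos hε _
  have hδ2 : δ ^ 2 ≤ (1 / 100) ^ 2 := pow_le_pow_left₀ hδ0.le hδ 2
  have hδ4 : δ ^ 4 ≤ δ ^ 2 * (1 / 100) ^ 2 := by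
    have e : δ ^ 4 = δ ^ 2 * δ ^ 2 := by ring
    rw [e]
    gcongr
  have hc := isConfiguration_interiorAt hΩ hb hε hu hA
  obtain ⟨P, U', hU', hP⟩ := exists_isAdapted hc (L := 3 / 8 * (25600 * δ ^ 2)) (r := r) hε hδ0
    (by linarith) (Real.rpow_nonneg hε.le (α - 1)) hen (fun x hx => by
      obtain ⟨hx1, hx2⟩ := closure_interiorAt hΩ hε hx
      exact closedBall_subset_of_lt_infDist hΩ hx1 (by linarith)) (by
      rw [h3]
      nlinarith [sq_nonneg δ]) (by
      rw [h3]
      have e : 3200 * δ ^ 4 / δ ^ 2 = 3200 * δ ^ 2 := by field_simp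
      rw [e]
      nlinarith [sq_nonneg δ]) (by linarith)
  refine ⟨P.final, hP.collection_final, hP.totalRadius_final, fun x hx => ⟨hx.1, ?_⟩, P,
    hP.isAdmissible rfl, rfl, fun η _ => ?_⟩
  · exact hP.growthB.union_subset 0 P.s le_rfl hP.s_nonneg (hP.cover_famB hx)
  · obtain ⟨G, hG⟩ := hP.exists_isVortexField η
    exact ⟨G, hG, hP.energy_bound hc hε hδ0 hδ (by nlinarith [sq_nonneg δ]) hr1 (by linarith) hU' hG⟩
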